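/- **Equation.** Let $k\ge 1$, $\Omega=[0,2\pi]$, $T>0$; let $\alpha$ be smooth on $[0,2\pi]$ with $\alpha(0)=\alpha(2\pi)$ ($\alpha$ may vanish and change sign), let $g$ be smooth on $[0,2\pi]\times[0,T]$, and let $u$, with $u(\cdot,t)\in W^{k+3,\infty}(0,2\pi)$ bounded in this space uniformly in $t\in[0,T]$, solve $u_t+(\alpha u)_x=g$ on $[0,2\pi]\times[0,T]$ with $u(0,t)=u(2\pi,t)$. Write $\|\cdot\|_{m,\infty}$ for the norm of $W^{m,\infty}(0,2\pi)$. **Mesh.** Let $0=x_{1/2}<\dots<x_{N+1/2}=2\pi$, $V_i=[x_{i-1/2},x_{i+1/2}]$, $h_i=x_{i+1/2}-x_{i-1/2}$, $h=\max_i h_i\le\kappa h_i$ for all $i$; indices are cyclic ($V_{N+1}=V_1$, $V_0=V_N$, $x_{1/2}$ and $x_{N+1/2}$ being identified). On each $V_i$ take the affine images $x_{i,j}$ of points $-1=s_0<s_1<\dots<s_{k+1}=1$. LSV method: $s_1,\dots,s_k$ are the zeros of the Legendre polynomial $L_k$. RSV method: either $s_1,\dots,s_{k+1}$ are the zeros of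 $L_{k+1}-L_k$ (right Radau) or $s_0,\dots,s_k$ are the zeros of $L_{k+1}+L_k$ (left Radau); right Radau is used if $\alpha>0$ at both ends of $V_i$, left Radau if $\alpha<0$ at both ends, and either one otherwise. Let $A_j$ be the weights of the interpolatory quadrature on $[-1,1]$ at the Gauss (Radau) points ($A_j=0$ at an end point which is not one of them) and $A_{i,j}=\frac{h_i}2A_j$. **Forms and norms.** $V_h$ is the space of functions that are polynomials of degree $\le k$ on each $V_i$. For $p\in V_h$, $p^*$ is the piecewise constant function with value $p^*_{i,j}$ on $[x_{i,j},x_{i,j+1}]$ ($0\le j\le k$), where $p^*_{i,0}=p(x_{i-1/2}^+)+A_{i,0}p_x(x_{i,0})$ and $p^*_{i,j}=p^*_{i,j-1}+A_{i,j}p_x(x_{i,j})$. The upwind value $\hat v|_{i+1/2}$ is $v(x_{i+1/2}^-)$ if $\alpha(x_{i+1/2})>0$ and $v(x_{i+1/2}^+)$ otherwise; at interior points $\hat v=v$. Put $\tilde\alpha_i^2=\alpha(x_{i-1/2})^2+\alpha(x_{i+1/2})^2$, $(f,g)_i=\int_{V_i}fg\,dx$, $$A_h(v,p^*)=\sum_{i=1}^N\tilde\alpha_i^2\sum_{j=0}^kp^*_{i,j}\Big(\int_{x_{i,j}}^{x_{i,j+1}}v_t\,dx+\alpha\hat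 v|_{x_{i,j+1}}-\alpha\hat v|_{x_{i,j}}\Big),\qquad \|v\|_\alpha^2=\sum_{i=1}^N\tilde\alpha_i^2\int_{V_i}v^2\,dx .$$ **Interpolation and correction.** Call $V_i$ *positive* if $\alpha(x_{i-1/2})\ge0$ and $\alpha(x_{i+1/2})>0$, *negative* if $\alpha(x_{i-1/2})\le0$ and $\alpha(x_{i+1/2})<0$, and *mixed* otherwise. $I_hu\in V_h$ interpolates $u$ at $x_{i,j}$ for $j=1,\dots,k+1$ on positive, for $j=0,\dots,k$ on negative, and for $j=0,\dots,k-1,k+1$ on mixed elements. Let $\bar\alpha_i=\max_{V_i}|\alpha|$. At each time the correction function $w\in V_h$ is given on positive elements by $$w(x_{i+1/2}^-)=0,\qquad(\bar\alpha_iw,v_x)_i=(\partial_t(u-I_hu),v^*)_i,$$ on negative elements by $$w(x_{i-1/2}^+)=0,\qquad(-\bar\alpha_iw,v_x)_i=(\partial_t(u-I_hu),v^*)_i,$$ in both cases for all polynomials $v$ of degree $\le k$ with $v(x_{i-1/2})=0$, and by $w=0$ on mixed elements. **Theorem 5.1.** For both methods: 1. $w$ exists, is unique and is differentiable in $t\in[0,T]$.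 Its upwind flux vanishes, $\alpha\hat w|_{i+1/2}=0$ for all $i$; moreover $\hat w|_{i+1/2}=0$ for all $i$ except possibly those with $\alpha(x_{i+1/2})=0<\alpha(x_{i+3/2})$. 2. There is a constant $C$ depending only on $k,\alpha,\kappa$ such that for every $t\in[0,T]$, with $B=Ch^{k+2}\big(\|u(\cdot,t)\|_{k+3,\infty}+\|g(\cdot,t)\|_{k+2,\infty}+\|g_t(\cdot,t)\|_{k+1,\infty}\big)$, $$\|w\|_\alpha+\|\partial_tw\|_\alpha\le B,$$ and, for all $v_h\in V_h$, except for the LSV method with $k=1$, $$|A_h(u-I_hu+w,v_h^*)|\le B\,\|v_h\|_\alpha .$$ In particular, for $g=0$ these hold with $B=Ch^{k+2}\|u(\cdot,t)\|_{k+3,\infty}$. 3. For given $g$ and $T$ there is a constant $C$ depending only on $k,\alpha,\kappa,g,T$ such that for every $t\in[0,T]$ the same estimates hold with $B=Ch^{k+2}\sup_{0\le\tau\le T}\|u(\cdot,\tau)\|_{k+3,\infty}$. -/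

import Mathlib

open Set MeasureTheory Polynomial
open scoped ContDiff ENNReal

namespace SpectralVolume

noncomputable section

/-! ### The Sobolev spaces `W^{m,∞}(0, 2π)` -/

/-- `v` is the `j`-th weak derivative of `f` on the open interval `(0, 2π)`. -/
def HasWeakDeriv (j : ℕ) (f v : ℝ → ℝ) : Prop :=
  LocallyIntegrableOn f (Ioo 0 (2 * Real.pi)) ∧
  LocallyIntegrableOn v (Ioo 0 (2 * Real.pi)) ∧
  ∀ φ : ℝ → ℝ, ContDiff ℝ ∞ φ → HasCompactSupport φ → tsupport φ ⊆ Ioo 0 (2 * Real.pi) →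
    ∫ x, f x * iteratedDeriv j φ x = (-1) ^ j * ∫ x, v x * φ x

/-- The norm of `W^{m,∞}(0, 2π)`: the sum of the `L^∞` norms of the weak derivatives of order
at most `m`.  Weak derivatives are unique up to null sets, so the infimum is over one class of
functions; it is `∞` when the weak derivative does not exist.  Thus `f ∈ W^{m,∞}(0, 2π)` if and
only if this norm is finite. -/
def sobolevNorm (m : ℕ) (f : ℝ → ℝ) : ℝ≥0∞ :=
  ∑ j ∈ Finset.range (m + 1), ⨅ (v : ℝ → ℝ) (_ : HasWeakDeriv j f v),
    eLpNorm v ⊤ (volume.restrict (Ioo 0 (2 * Real.pi)))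

/-- The norm `sup_{0 ≤ t ≤ T} ‖u(·, t)‖_{m,∞}`. Functions of time and space are written `u t x`. -/
def sobolevSupNorm (m : ℕ) (T : ℝ) (u : ℝ → ℝ → ℝ) : ℝ≥0∞ :=
  ⨆ t ∈ Icc 0 T, sobolevNorm m (u t)

/-! ### The hyperbolic equation -/

/-- `u` solves `u_t + (α u)_x = g` on `[0, 2π] × [0, T]` with periodic boundary condition (the
initial value is `u 0`), and `u(·, t)` is the continuous representative of an element of `W^{m,∞}`,
with norm bounded on `[0, T]`. Derivatives at the boundary are one-sided. -/
structure IsSolution (m : ℕ) (α : ℝ → ℝ) (T : ℝ) (g u : ℝ → ℝ → ℝ) : Prop where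
  periodic : ∀ t ∈ Icc 0 T, u t 0 = u t (2 * Real.pi)
  continuousOn : ∀ t ∈ Icc 0 T, ContinuousOn (u t) (Icc 0 (2 * Real.pi))
  bounded : sobolevSupNorm m T u < ⊤
  differentiableOn : ∀ t ∈ Icc 0 T,
    DifferentiableOn ℝ (fun y => α y * u t y) (Icc 0 (2 * Real.pi))
  equation : ∀ t ∈ Icc 0 T, ∀ x ∈ Icc 0 (2 * Real.pi),
    HasDerivWithinAt (fun s => u s x)
      (g t x - derivWithin (fun y => α y * u t y) (Icc 0 (2 * Real.pi)) x) (Icc 0 T) t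

/-! ### Partitions of the reference element and quadrature weights -/

/-- The Legendre polynomial of degree `n` (Rodrigues' formula). -/
def legendre (n : ℕ) : ℝ[X] :=
  C ((2 ^ n * (n.factorial : ℝ))⁻¹) * derivative^[n] ((X ^ 2 - 1) ^ n)

/-- The three families of points used to divide an element. -/
inductive NodeKind
  | gauss
  | radauRight
  | radauLeft

/-- The polynomial whose zeros are the Gauss, right Radau or left Radau points. -/
def NodeKind.poly (k : ℕ) : NodeKind → ℝ[X]
  | .gauss => legendre k
  | .radauRight => legendre (k + 1) - legendre k
  | .radauLeft => legendre (k + 1) + legendre k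

/-- The indices `j` of `s_0 < ⋯ < s_{k+1}` for which `s_j` is a Gauss (Radau) point:
`1, …, k` for Gauss, `1, …, k + 1` for right Radau, `0, …, k` for left Radau points. -/
def NodeKind.active (k : ℕ) : NodeKind → Finset (Fin (k + 2))
  | .gauss => Finset.univ.filter fun j => j ≠ 0 ∧ j ≠ Fin.last (k + 1)
  | .radauRight => Finset.univ.filter fun j => j ≠ 0
  | .radauLeft => Finset.univ.filter fun j => j ≠ Fin.last (k + 1)

/-- A partition `-1 = s_0 < s_1 < ⋯ < s_{k+1} = 1` of the reference element by Gauss, right Radau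
or left Radau points. -/
structure RefPartition (k : ℕ) where
  kind : NodeKind
  s : Fin (k + 2) → ℝ
  strictMono : StrictMono s
  first : s 0 = -1
  last : s (Fin.last (k + 1)) = 1
  root : ∀ j ∈ kind.active k, (kind.poly k).eval (s j) = 0

/-- The weights `A_j` of the Gauss or Radau quadrature on `[-1, 1]`: integrals of the Lagrange basis
functions at the Gauss (Radau) points, and zero at an end point which is not one of them. -/
def RefPartition.weight {k : ℕ} (P : RefPartition k) (j : Fin (k + 2)) : ℝ :=
  if j ∈ P.kind.active k then
    ∫ x in (-1 : ℝ)..1, (Lagrange.basis (P.kind.active k) P.s j).eval x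
  else 0

/-! ### Meshes -/

/-- A mesh `0 = x_{1/2} < ⋯ < x_{N+1/2} = 2π` with `N` elements, each with its division into
`k + 1` control volumes. The elements are numbered by `Fin N`, cyclically. -/
structure Grid (k N : ℕ) where
  x : Fin (N + 1) → ℝ
  strictMono : StrictMono x
  first : x 0 = 0
  last : x (Fin.last N) = 2 * Real.pi
  part : Fin N → RefPartition k

namespace Grid

variable {k N : ℕ}

/-- Left end point of the element `i`. -/
def left (G : Grid k N) (i : Fin N) : ℝ := G.x i.castSucc

/-- Right end point of the element `i`. -/
def right (G : Grid k N) (i : Fin N) : ℝ := G.x i.succ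

/-- Length `h_i`. -/
def len (G : Grid k N) (i : Fin N) : ℝ := G.right i - G.left i

/-- Mesh size `h = max_i h_i`. -/
def meshSize (G : Grid k N) : ℝ := ⨆ i, G.len i

/-- The points `x_{i,j}`, `j = 0, …, k + 1`. -/
def node (G : Grid k N) (i : Fin N) (j : Fin (k + 2)) : ℝ :=
  G.len i / 2 * (G.part i).s j + (G.left i + G.right i) / 2

/-- The quadrature weights `A_{i,j}`. -/
def weight (G : Grid k N) (i : Fin N) (j : Fin (k + 2)) : ℝ :=
  G.len i / 2 * (G.part i).weight j

/-- Shape regularity with constant `κ`. -/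
def ShapeRegular (G : Grid k N) (κ : ℝ) : Prop := ∀ i, G.meshSize ≤ κ * G.len i

end Grid

/-- The two spectral volume methods. -/
inductive Scheme
  | LSV
  | RSV

/-- The points dividing the elements are those of the given method. -/
def Scheme.Uses {k N : ℕ} (α : ℝ → ℝ) (G : Grid k N) : Scheme → Prop
  | .LSV => ∀ i, (G.part i).kind = .gauss
  | .RSV => ∀ i,
      (0 < α (G.left i) → 0 < α (G.right i) → (G.part i).kind = .radauRight) ∧
      (α (G.left i) < 0 → α (G.right i) < 0 → (G.part i).kind = .radauLeft) ∧
      ((G.part i).kind = .radauRight ∨ (G.part i).kind = .radauLeft)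

section Method

variable {k N : ℕ} [NeZero N]

/-! A piecewise function is a family `v : Fin N → ℝ → ℝ`, where `v i` is used only on the closed
element `i`; the one-sided limits at mesh points are the values of `v i` at its end points. -/

/-! ### The bilinear form -/

/-- The upwind value at the right end point of the element `i`: from the left where `α > 0` and from
the right where `α ≤ 0`. The element following the last one is the first one (periodicity). -/
def upwind (α : ℝ → ℝ) (G : Grid k N) (v : Fin N → ℝ → ℝ) (i : Fin N) : ℝ :=
  if 0 < α (G.right i) then v i (G.right i) else v (i + 1) (G.left (i + 1))

/-- The numerical flux `α v̂` at `x_{i,j}`. -/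
def flux (α : ℝ → ℝ) (G : Grid k N) (v : Fin N → ℝ → ℝ) (i : Fin N) (j : Fin (k + 2)) : ℝ :=
  if j = 0 then α (G.left i) * upwind α G v (i - 1)
  else if j = Fin.last (k + 1) then α (G.right i) * upwind α G v i
  else α (G.node i j) * v i (G.node i j)

/-- The value on the control volume `[x_{i,j}, x_{i,j+1}]` of the piecewise constant function
`p* = T p`: `p*_0 = p(x_{i-1/2}) + A_{i,0} p'(x_{i,0})`, `p*_j = p*_{j-1} + A_{i,j} p'(x_{i,j})`. -/
def star (G : Grid k N) (i : Fin N) (p : ℝ[X]) (j : Fin (k + 1)) : ℝ :=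
  p.eval (G.left i) + ∑ l ∈ Finset.univ.filter (fun l : Fin (k + 2) => l ≤ j.castSucc),
    G.weight i l * (derivative p).eval (G.node i l)

/-- The inner product `(f, p*)_i` on the element `i`. -/
def pairing (G : Grid k N) (i : Fin N) (f : ℝ → ℝ) (p : ℝ[X]) : ℝ :=
  ∑ j : Fin (k + 1), star G i p j * ∫ x in (G.node i j.castSucc)..(G.node i j.succ), f x

/-- The time derivative on `[0, T]` of a time dependent piecewise function. -/
def timeDeriv (T : ℝ) (v : ℝ → Fin N → ℝ → ℝ) (t : ℝ) : Fin N → ℝ → ℝ :=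
  fun i x => derivWithin (fun s => v s i x) (Icc 0 T) t

/-- The form `a_{h,i}(v, p*)` at time `t`. -/
def formElem (α : ℝ → ℝ) (G : Grid k N) (T : ℝ) (v : ℝ → Fin N → ℝ → ℝ) (t : ℝ)
    (i : Fin N) (p : ℝ[X]) : ℝ :=
  pairing G i (timeDeriv T v t i) p +
    ∑ j : Fin (k + 1), star G i p j *
      (flux α G (v t) i j.succ - flux α G (v t) i j.castSucc)

/-- `α(x_{i-1/2})² + α(x_{i+1/2})²`. -/
def alphaSq (α : ℝ → ℝ) (G : Grid k N) (i : Fin N) : ℝ :=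
  α (G.left i) ^ 2 + α (G.right i) ^ 2

/-- The form `A_h(v, v_h*)` at time `t`. -/
def form (α : ℝ → ℝ) (G : Grid k N) (T : ℝ) (v : ℝ → Fin N → ℝ → ℝ) (t : ℝ)
    (vh : Fin N → ℝ[X]) : ℝ :=
  ∑ i, alphaSq α G i * formElem α G T v t i (vh i)

/-- The norm `‖v‖_α`. -/
def alphaNorm (α : ℝ → ℝ) (G : Grid k N) (v : Fin N → ℝ → ℝ) : ℝ :=
  √(∑ i, alphaSq α G i * ∫ x in (G.left i)..(G.right i), v i x ^ 2)

/-- The piecewise function given by a piecewise polynomial. -/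
def toFun (W : Fin N → ℝ[X]) : Fin N → ℝ → ℝ := fun i x => (W i).eval x

/-! ### Interpolation and correction function -/

/-- The three cases in the definitions of the interpolation and of the correction function. -/
inductive ElemCase
  | positive
  | negative
  | mixed

/-- Which of the three cases the element `i` belongs to. -/
def elemCase (α : ℝ → ℝ) (G : Grid k N) (i : Fin N) : ElemCase :=
  if 0 ≤ α (G.left i) ∧ 0 < α (G.right i) then .positive
  else if α (G.left i) ≤ 0 ∧ α (G.right i) < 0 then .negative
  else .mixed

/-- The indices of the `k + 1` interpolation points: `1, …, k + 1` for `I_h^-`, `0, …, k` for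
`I_h^+`, and `0, …, k - 1, k + 1` for `I_h^±`. -/
def ElemCase.stencil (k : ℕ) : ElemCase → Finset (Fin (k + 2))
  | .positive => Finset.univ.filter fun j => j ≠ 0
  | .negative => Finset.univ.filter fun j => j ≠ Fin.last (k + 1)
  | .mixed => Finset.univ.filter fun j => (j : ℕ) ≠ k

/-- The interpolation `I_h f` on the element `i`. -/
def interp (α : ℝ → ℝ) (G : Grid k N) (f : ℝ → ℝ) (i : Fin N) : ℝ[X] :=
  Lagrange.interpolate ((elemCase α G i).stencil k) (G.node i) fun j => f (G.node i j)

/-- The interpolation error `u - I_h u`, as a time dependent piecewise function. -/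
def interpError (α : ℝ → ℝ) (G : Grid k N) (u : ℝ → ℝ → ℝ) : ℝ → Fin N → ℝ → ℝ :=
  fun t i x => u t x - (interp α G (u t) i).eval x

/-- `max |α|` over the element `i`. -/
def alphaMax (α : ℝ → ℝ) (G : Grid k N) (i : Fin N) : ℝ :=
  sSup ((fun x => |α x|) '' Icc (G.left i) (G.right i))

/-- `W` is the correction function at time `t`. It is a piecewise polynomial of degree at most `k`.
On positive (negative) elements it vanishes at the right (left) end point and satisfies
`(±ᾱ_i W, v_x)_i = (∂_t (u - I_h u), v*)_i` for all polynomials `v` of degree at most `k` in the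
complement of the constants formed by those vanishing at the left end point; it is zero on the
remaining elements. -/
structure IsCorrection (α : ℝ → ℝ) (G : Grid k N) (T : ℝ) (u : ℝ → ℝ → ℝ) (t : ℝ)
    (W : Fin N → ℝ[X]) : Prop where
  degree : ∀ i, (W i).natDegree ≤ k
  positive : ∀ i, elemCase α G i = .positive →
    (W i).eval (G.right i) = 0 ∧
    ∀ v : ℝ[X], v.natDegree ≤ k → v.eval (G.left i) = 0 →
      ∫ x in (G.left i)..(G.right i), alphaMax α G i * (W i).eval x * (derivative v).eval x =
        pairing G i (timeDeriv T (interpError α G u) t i) v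
  negative : ∀ i, elemCase α G i = .negative →
    (W i).eval (G.left i) = 0 ∧
    ∀ v : ℝ[X], v.natDegree ≤ k → v.eval (G.left i) = 0 →
      ∫ x in (G.left i)..(G.right i), -alphaMax α G i * (W i).eval x * (derivative v).eval x =
        pairing G i (timeDeriv T (interpError α G u) t i) v
  mixed : ∀ i, elemCase α G i = .mixed → W i = 0

/-- The corrected error `u - I_h u + w`, as a time dependent piecewise function. -/
def correctedError (α : ℝ → ℝ) (G : Grid k N) (u : ℝ → ℝ → ℝ) (w : ℝ → Fin N → ℝ[X]) :
    ℝ → Fin N → ℝ → ℝ :=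
  fun t i x => interpError α G u t i x + toFun (w t) i x

/-- The two estimates `‖w‖_α + ‖∂_t w‖_α ≤ B` and `|A_h(u - I_h u + w, v_h*)| ≤ B ‖v_h‖_α` for all
`v_h ∈ V_h` at time `t`. The second one is not claimed for the LSV method with `k = 1`. -/
def CorrectionEstimates (m : Scheme) (α : ℝ → ℝ) (G : Grid k N) (T : ℝ) (u : ℝ → ℝ → ℝ)
    (w : ℝ → Fin N → ℝ[X]) (t B : ℝ) : Prop :=
  alphaNorm α G (toFun (w t)) + alphaNorm α G (timeDeriv T (fun s => toFun (w s)) t) ≤ B ∧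
  ((m = .LSV → 2 ≤ k) → ∀ vh : Fin N → ℝ[X], (∀ i, (vh i).natDegree ≤ k) →
    |form α G T (correctedError α G u w) t vh| ≤ B * alphaNorm α G (toFun vh))

end Method

end

end SpectralVolume

namespace SpectralVolume

/-! ### Polynomials: antiderivatives, Legendre polynomials, quadrature -/

/-! Write `e` for `u - I_h u`, and on an element of length `d` let `ᾱ` be the maximum of `|α|`. The
weight `α̃²` is split into two equal factors. One belongs to the test function and builds `‖v_h‖_α`;
the other is at most `2ᾱ`. Hence every quantity need only be bounded after multiplication by one
factor `ᾱ`, and `α` may vanish freely. Inverse inequalities and Cauchy-Schwarz sum the local bounds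
(`exists_sum_estimate`).

Correction. Its equation, with `c = ±ᾱ`, prescribes `∫ c W q` for all `q` of degree less than `k`,
while `W` has a zero `b` at one end of the element. So `W` is `b - y` times a polynomial of degree
less than `k`, and `∫ (b - y) q r` is positive definite on such polynomials. This gives existence
and uniqueness, and each value of `c W` is a fixed functional of the right hand side
(`exists_eval_eq_pairing`). Scaling of that functional gains a factor `d`, so `ᾱ w` and `ᾱ w_t` are
`O(h^(k+2))`. The same formula transfers differentiability in time to `w`.

Bilinear form. The interpolation points and the zeros of `w` are placed so that the numerical flux
of `e + w` vanishes at all mesh points. Summation by parts leaves `(e_t + w_t, p*)` minus a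
quadrature sum of `p'` times the flux (`formElem_eq`), and `small_or_sign` gives two cases. If the
end values of `α` have no common strict sign, `α` has a zero in the element, so `ᾱ = O(d)` supplies
the missing power. Otherwise the interior quadrature points are interpolation points, so only `α w`
survives in the sum; `α` may be replaced by `c` at a relative cost `O(d)`; quadrature turns the sum
into `∫ c w p'`; and the correction equation cancels it against `e_t`, up to `p(x_{i-1/2}) ∫ e_t`.
That mean value is `O(d^(k+3))`, because the quadrature is exact in degree `k + 1` and its points
are interpolation points of `I_h`. The exactness needs at least two points, which excludes only the
one-point Gauss rule, LSV with `k = 1`.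

Regularity. A continuous function in `W^{n+1,∞}` has `n` derivatives, the last one Lipschitz
(`lipBall_of_sobolevNorm_lt_top`), which suffices for interpolation estimates by Rolle's theorem.
Using the equation twice, `u_t` and `u_tt` lose one and two derivatives against `u`
(`exists_time_derivatives`). For a fixed nonzero source, `u` cannot be small, so its norm dominates
the norms of `g` (`exists_source_le`). -/

lemma exists_antiderivative (a : ℝ) (q : ℝ[X]) {k : ℕ} (hq : q.natDegree < k) :
    ∃ v : ℝ[X], derivative v = q ∧ v.eval a = 0 ∧ v.natDegree ≤ k := by
  set v₀ : ℝ[X] := ∑ i ∈ Finset.range k, monomial (i + 1) (q.coeff i / (i + 1)) with hv₀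
  have hd : derivative v₀ = q := by
    rw [hv₀, derivative_sum, q.as_sum_range' k hq]
    refine Finset.sum_congr rfl fun i _ => ?_
    rw [derivative_monomial, ← q.as_sum_range' k hq]
    have : ((i : ℝ) + 1) ≠ 0 := by positivity
    push_cast
    rw [div_mul_cancel₀ _ this]
  have hdeg : v₀.natDegree ≤ k := by
    refine natDegree_sum_le_of_forall_le _ _ fun i hi => ?_
    exact (natDegree_monomial_le _).trans (Finset.mem_range.1 hi)
  refine ⟨v₀ - C (v₀.eval a), by simp [hd], by simp, ?_⟩
  exact (natDegree_sub_le _ _).trans (by simpa using hdeg)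

lemma intervalIntegrable_eval (p : ℝ[X]) (a b : ℝ) :
    IntervalIntegrable (fun x => p.eval x) volume a b :=
  p.continuous.intervalIntegrable _ _

lemma integral_eval_derivative (p : ℝ[X]) (a b : ℝ) :
    ∫ x in a..b, (derivative p).eval x = p.eval b - p.eval a :=
  intervalIntegral.integral_eq_sub_of_hasDerivAt (fun x _ => p.hasDerivAt x)
    (intervalIntegrable_eval _ _ _)

/-- Repeated integration by parts. `F` is a general multiple of `(X² - 1)^n` because it stays fixed
while `n` decreases in the induction; the surplus factor `X² - 1` kills the boundary terms. -/
lemma integral_iterate_derivative_mul_eq_zero (n : ℕ) : ∀ (F q : ℝ[X]),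
    (X ^ 2 - 1) ^ n ∣ F → q.degree < n →
      ∫ x in (-1 : ℝ)..1, (derivative^[n] F * q).eval x = 0 := by
  induction n with
  | zero =>
    intro F q _ hq
    have : q = 0 := by
      rw [← degree_eq_bot]
      exact Nat.WithBot.lt_zero_iff.1 (by simpa using hq)
    simp [this]
  | succ n ih =>
    intro F q hF hq
    have h0 := ih F (derivative q) ((pow_dvd_pow _ n.le_succ).trans hF) (by
      rcases eq_or_ne q 0 with rfl | hq0
      · simp
      · have h := degree_derivative_lt hq0
        rcases eq_or_ne (derivative q) 0 with h0 | h0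
        · simp [h0]
        · rw [degree_eq_natDegree h0, degree_eq_natDegree hq0] at h
          rw [degree_eq_natDegree hq0] at hq
          rw [degree_eq_natDegree h0]
          norm_cast at *
          omega)
    have h1 : (X ^ 2 - 1 : ℝ[X]) ∣ derivative^[n] F := by
      simpa using pow_sub_dvd_iterate_derivative_of_pow_dvd n hF
    have h2 := integral_eval_derivative (derivative^[n] F * q) (-1) 1
    rw [derivative_mul, ← Function.iterate_succ_apply' (⇑derivative)] at h2
    obtain ⟨r, hr⟩ := h1
    have e1 : (derivative^[n] F).eval 1 = 0 := by rw [hr]; simp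
    have e2 : (derivative^[n] F).eval (-1) = 0 := by rw [hr]; simp
    simp only [eval_add] at h2
    rw [intervalIntegral.integral_add (intervalIntegrable_eval _ _ _)
      (intervalIntegrable_eval _ _ _), h0] at h2
    simpa [e1, e2] using h2

lemma integral_legendre_mul_eq_zero (n : ℕ) (q : ℝ[X]) (hq : q.degree < n) :
    ∫ x in (-1 : ℝ)..1, (legendre n * q).eval x = 0 := by
  unfold legendre
  simp only [mul_assoc, eval_C_mul]
  rw [intervalIntegral.integral_const_mul,
    integral_iterate_derivative_mul_eq_zero n _ q dvd_rfl hq, mul_zero]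

lemma natDegree_legendre (n : ℕ) : (legendre n).natDegree = n := by
  have hm : ((X ^ 2 - 1 : ℝ[X]) ^ n).Monic := (monic_X_pow_sub_C 1 two_ne_zero).pow n
  have hd : ((X ^ 2 - 1 : ℝ[X]) ^ n).natDegree = 2 * n := by
    rw [natDegree_pow, show (X ^ 2 - 1 : ℝ[X]) = X ^ 2 - C 1 by simp, natDegree_X_pow_sub_C,
      mul_comm]
  have h1 : (derivative^[n] ((X ^ 2 - 1 : ℝ[X]) ^ n)).natDegree ≤ n := by
    refine (natDegree_iterate_derivative _ n).trans ?_
    omega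
  have h2 : (derivative^[n] ((X ^ 2 - 1 : ℝ[X]) ^ n)).coeff n ≠ 0 := by
    rw [coeff_iterate_derivative]
    have : ((X ^ 2 - 1 : ℝ[X]) ^ n).coeff (n + n) = 1 := by
      rw [← two_mul, ← hd]; exact hm
    rw [this]
    simp
  have hc : ((2 ^ n * (n.factorial : ℝ))⁻¹) ≠ 0 := by positivity
  unfold legendre
  rw [natDegree_C_mul hc]
  exact natDegree_eq_of_le_of_coeff_ne_zero h1 h2

/-- The number of quadrature points. -/
lemma NodeKind.card_active (k : ℕ) (K : NodeKind) :
    (K.active k).card = (K.poly k).natDegree ∧ k ≤ (K.active k).card ∧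
      (K.active k).card ≤ k + 1 := by
  have h1 := natDegree_legendre k
  have h2 := natDegree_legendre (k + 1)
  have hlt : (legendre k).natDegree < (legendre (k + 1)).natDegree := by omega
  cases K
  · have : (NodeKind.active k .gauss) =
        ((Finset.univ : Finset (Fin (k + 2))).erase 0).erase (Fin.last (k + 1)) := by
      ext j; simp [NodeKind.active, and_comm]
    have hc : (NodeKind.active k .gauss).card = k := by
      rw [this, Finset.card_erase_of_mem, Finset.card_erase_of_mem] <;>
        simp [Fin.ext_iff]
    simp [hc, NodeKind.poly, h1]
  · have : (NodeKind.active k .radauRight) = (Finset.univ : Finset (Fin (k + 2))).erase 0 := by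
      ext j; simp [NodeKind.active]
    have hc : (NodeKind.active k .radauRight).card = k + 1 := by
      rw [this, Finset.card_erase_of_mem] <;> simp
    simp [hc, NodeKind.poly, natDegree_sub_eq_left_of_natDegree_lt hlt, h2]
  · have : (NodeKind.active k .radauLeft) =
        (Finset.univ : Finset (Fin (k + 2))).erase (Fin.last (k + 1)) := by
      ext j; simp [NodeKind.active]
    have hc : (NodeKind.active k .radauLeft).card = k + 1 := by
      rw [this, Finset.card_erase_of_mem] <;> simp
    simp [hc, NodeKind.poly, natDegree_add_eq_left_of_natDegree_lt hlt, h2]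

lemma NodeKind.integral_poly_mul_eq_zero {k : ℕ} (K : NodeKind) (q : ℝ[X]) (hq : q.degree < k) :
    ∫ x in (-1 : ℝ)..1, (K.poly k * q).eval x = 0 := by
  have h1 := integral_legendre_mul_eq_zero k q hq
  have h2 := integral_legendre_mul_eq_zero (k + 1) q
    (hq.trans (by exact_mod_cast k.lt_succ_self))
  have i1 := intervalIntegrable_eval (legendre k * q) (-1) 1
  have i2 := intervalIntegrable_eval (legendre (k + 1) * q) (-1) 1
  cases K
  · exact h1
  · simp only [NodeKind.poly, sub_mul, eval_sub]
    rw [intervalIntegral.integral_sub i2 i1, h1, h2, sub_zero]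
  · simp only [NodeKind.poly, add_mul, eval_add]
    rw [intervalIntegral.integral_add i2 i1, h1, h2, add_zero]

/-! ### Exactness and positivity of Gauss and Radau quadrature -/

namespace RefPartition

variable {k : ℕ} (P : RefPartition k)

/-- Exactness of Gauss and Radau quadrature. -/
lemma integral_eq_sum_weight (hk : 1 ≤ k) (f : ℝ[X]) (hf : f.degree < ((P.kind.active k).card + k : ℕ)) :
    ∫ x in (-1 : ℝ)..1, f.eval x = ∑ j, P.weight j * f.eval (P.s j) := by
  classical
  obtain ⟨hcard, -, -⟩ := P.kind.card_active k
  set S := P.kind.active k with hS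
  have hinj : Set.InjOn P.s S := P.strictMono.injective.injOn
  set Q := Lagrange.nodal S P.s
  have hQm : Q.Monic := Lagrange.nodal_monic
  have hQdeg : Q.natDegree = S.card := Lagrange.natDegree_nodal
  -- The nodal polynomial and the Legendre combination have the same zeros and the same degree, so
  -- they differ by a nonzero constant and `Q` inherits the orthogonality.
  have hdvd : Q ∣ P.kind.poly k := by
    refine Finset.prod_dvd_of_coprime ?_ ?_
    · intro i hi j hj hij
      exact (pairwise_coprime_X_sub_C P.strictMono.injective hij)
    · intro i hi
      exact dvd_iff_isRoot.2 (P.root i hi)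
  obtain ⟨c, hc⟩ := hdvd
  have hk0 : P.kind.poly k ≠ 0 := by
    intro h0
    have h3 := P.kind.card_active k
    rw [h0, natDegree_zero] at h3
    omega
  have hcdeg : c.natDegree = 0 := by
    have := congrArg natDegree hc
    rw [hQm.natDegree_mul' (by rintro rfl; simp at hc; exact hk0 hc), hQdeg] at this
    omega
  obtain ⟨c₀, rfl⟩ := natDegree_eq_zero.1 hcdeg
  have hc₀ : c₀ ≠ 0 := by rintro rfl; simp at hc; exact hk0 hc
  have horth : ∀ q : ℝ[X], q.degree < k → ∫ x in (-1 : ℝ)..1, (Q * q).eval x = 0 := by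
    intro q hq
    have h := P.kind.integral_poly_mul_eq_zero q hq
    rw [hc] at h
    have : ∀ x : ℝ, (Q * C c₀ * q).eval x = c₀ * (Q * q).eval x := by
      intro x; simp; ring
    simp only [this] at h
    rw [intervalIntegral.integral_const_mul] at h
    exact (mul_eq_zero.1 h).resolve_left hc₀
  -- The remainder has the same nodal values as `f`, and the same integral since the quotient has
  -- degree less than `k`.
  have hdecomp : f %ₘ Q + Q * (f /ₘ Q) = f := modByMonic_add_div f Q
  have hq : (f /ₘ Q).degree < k := by
    rcases eq_or_ne (f /ₘ Q) 0 with h0 | h0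
    · rw [h0, degree_zero]; exact WithBot.bot_lt_coe _
    · by_cases hle : Q.degree ≤ f.degree
      · have := degree_add_divByMonic hQm hle
        rw [← this, degree_eq_natDegree hQm.ne_zero, hQdeg, degree_eq_natDegree h0] at hf
        rw [degree_eq_natDegree h0]
        norm_cast at hf ⊢
        omega
      · exact absurd ((divByMonic_eq_zero_iff hQm).2 (not_le.1 hle)) h0
  have hr : (f %ₘ Q).degree < S.card := by
    refine (degree_modByMonic_lt f hQm).trans_le ?_
    rw [degree_eq_natDegree hQm.ne_zero, hQdeg]
  have hval : ∀ j ∈ S, (f %ₘ Q).eval (P.s j) = f.eval (P.s j) := by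
    intro j hj
    conv_rhs => rw [← hdecomp]
    rw [eval_add, eval_mul, Lagrange.eval_nodal_at_node hj, zero_mul, add_zero]
  have hint : f %ₘ Q = ∑ j ∈ S, C (f.eval (P.s j)) * Lagrange.basis S P.s j := by
    rw [Lagrange.eq_interpolate_of_eval_eq (r := fun j => f.eval (P.s j)) hinj hr hval,
      Lagrange.interpolate_apply]
  calc ∫ x in (-1 : ℝ)..1, f.eval x
      = ∫ x in (-1 : ℝ)..1, ((f %ₘ Q).eval x + (Q * (f /ₘ Q)).eval x) := by
        simp only [← eval_add, hdecomp]
    _ = ∫ x in (-1 : ℝ)..1, (f %ₘ Q).eval x := by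
        rw [intervalIntegral.integral_add (intervalIntegrable_eval _ _ _)
          (intervalIntegrable_eval _ _ _), horth _ hq, add_zero]
    _ = ∑ j ∈ S, f.eval (P.s j) * ∫ x in (-1 : ℝ)..1, (Lagrange.basis S P.s j).eval x := by
        rw [hint]
        simp only [eval_finsetSum, eval_mul, eval_C]
        rw [intervalIntegral.integral_finsetSum]
        · simp only [intervalIntegral.integral_const_mul]
        · intro j _
          exact (intervalIntegrable_eval _ _ _).const_mul _
    _ = ∑ j, P.weight j * f.eval (P.s j) := by
        rw [← Finset.sum_filter_add_sum_filter_not Finset.univ (fun j => j ∈ S)]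
        have : ∑ x with x ∉ S, P.weight x * f.eval (P.s x) = 0 := by
          refine Finset.sum_eq_zero fun j hj => ?_
          simp only [Finset.mem_filter, Finset.mem_univ, true_and] at hj
          rw [weight, if_neg hj, zero_mul]
        rw [this, add_zero]
        refine Finset.sum_congr (by ext; simp) fun j hj => ?_
        rw [weight, if_pos (by simpa using hj), mul_comm]

lemma weight_eq_zero {j : Fin (k + 2)} (hj : j ∉ P.kind.active k) : P.weight j = 0 := if_neg hj

/-- The square of a Lagrange basis polynomial lies within the degree of exactness, as there are at
most `k + 1` points, and the rule applied to it returns exactly the weight. -/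
lemma weight_nonneg (hk : 1 ≤ k) (j : Fin (k + 2)) : 0 ≤ P.weight j := by
  classical
  by_cases hj : j ∈ P.kind.active k
  · obtain ⟨-, -, hcard⟩ := P.kind.card_active k
    have hinj : Set.InjOn P.s (P.kind.active k) := P.strictMono.injective.injOn
    set S := P.kind.active k with hS
    set l := Lagrange.basis S P.s j
    have hne : l ≠ 0 := Lagrange.basis_ne_zero hinj hj
    have hl : l.natDegree = S.card - 1 := Lagrange.natDegree_basis hinj hj
    have hpos : 0 < S.card := Finset.card_pos.2 ⟨j, hj⟩
    have h := P.integral_eq_sum_weight hk (l * l) (by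
      rw [degree_mul, degree_eq_natDegree hne, hl, ← hS]
      norm_cast
      omega)
    have h2 : ∑ i, P.weight i * (l * l).eval (P.s i) = P.weight j := by
      rw [Finset.sum_eq_single j]
      · rw [eval_mul, Lagrange.eval_basis_self hinj hj]; ring
      · intro i _ hij
        by_cases hi : i ∈ S
        · rw [eval_mul, Lagrange.eval_basis_of_ne hij.symm hi]; ring
        · rw [P.weight_eq_zero hi, zero_mul]
      · simp
    rw [← h2, ← h]
    refine intervalIntegral.integral_nonneg (by norm_num) fun x _ => ?_
    rw [eval_mul]
    exact mul_self_nonneg _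
  · exact (P.weight_eq_zero hj).ge

lemma sum_weight (hk : 1 ≤ k) : ∑ j, P.weight j = 2 := by
  have h := P.integral_eq_sum_weight hk 1 (by
    rw [degree_one]
    have := (P.kind.card_active k).2.1
    norm_cast
    omega)
  simp only [eval_one, mul_one] at h
  rw [← h]
  norm_num

end RefPartition

/-! ### Inverse inequalities and representation of polynomials -/

/-- Compactness of the unit sphere gives a positive minimum, and homogeneity does the rest. The
sphere is empty for `n = 0`, which is why that case is separate. -/
lemma exists_forall_norm_sq_le {n : ℕ} (Q : (Fin n → ℝ) → ℝ) (hQ : Continuous Q)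
    (hsmul : ∀ (c : ℝ) x, Q (c • x) = c ^ 2 * Q x) (hpos : ∀ x, x ≠ 0 → 0 < Q x) :
    ∃ C, 0 < C ∧ ∀ x, ‖x‖ ^ 2 ≤ C * Q x := by
  have hQ0 : Q 0 = 0 := by simpa using hsmul 0 0
  rcases (Metric.sphere (0 : Fin n → ℝ) 1).eq_empty_or_nonempty with he | hne
  · refine ⟨1, one_pos, fun x => ?_⟩
    have hx : x = 0 := by
      by_contra hx
      have : ‖x‖⁻¹ • x ∈ Metric.sphere (0 : Fin n → ℝ) 1 := by
        simp [norm_smul, hx]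
      simp [he] at this
    simp [hx, hQ0]
  · obtain ⟨x₀, hx₀, hmin⟩ := (isCompact_sphere (0 : Fin n → ℝ) 1).exists_isMinOn hne
      hQ.continuousOn
    have hx₀' : x₀ ≠ 0 := by
      rintro rfl; simp at hx₀
    have hc := hpos x₀ hx₀'
    refine ⟨(Q x₀)⁻¹, inv_pos.2 hc, fun x => ?_⟩
    rcases eq_or_ne x 0 with rfl | hx
    · simp [hQ0]
    have hxn : 0 < ‖x‖ := norm_pos_iff.2 hx
    have h1 : Q x₀ ≤ Q (‖x‖⁻¹ • x) := hmin (by simp [norm_smul, hx])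
    rw [hsmul] at h1
    rw [inv_pow, inv_mul_eq_div, le_div_iff₀ (by positivity)] at h1
    rw [inv_mul_eq_div, le_div_iff₀ hc]
    linarith

/-- Equivalence of norms on coefficient vectors. The weight `1 - x` is the one produced by factoring
out a zero at an end point; it vanishes only at one point, so definiteness is kept. -/
lemma exists_eval_sq_le_integral_unit (k : ℕ) : ∃ C, 0 < C ∧ ∀ p : ℝ[X], p.natDegree ≤ k →
    ∀ s ∈ Icc (0 : ℝ) 1,
      p.eval s ^ 2 ≤ C * ∫ x in (0 : ℝ)..1, (1 - x) * p.eval x ^ 2 ∧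
      (derivative p).eval s ^ 2 ≤ C * ∫ x in (0 : ℝ)..1, (1 - x) * p.eval x ^ 2 := by
  set Q : (Fin (k + 1) → ℝ) → ℝ := fun c =>
    ∫ x in (0 : ℝ)..1, (1 - x) * (∑ i, c i * x ^ (i : ℕ)) ^ 2 with hQdef
  have hQc : Continuous Q := by
    apply intervalIntegral.continuous_parametric_intervalIntegral_of_continuous'
    fun_prop
  have hQs : ∀ (c : ℝ) x, Q (c • x) = c ^ 2 * Q x := by
    intro c x
    simp only [hQdef, Pi.smul_apply, smul_eq_mul, mul_assoc, ← Finset.mul_sum, mul_pow]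
    rw [← intervalIntegral.integral_const_mul]
    refine intervalIntegral.integral_congr fun y _ => ?_
    ring
  have hQp : ∀ x, x ≠ 0 → 0 < Q x := by
    intro c hc
    have hcont : Continuous fun x : ℝ => (1 - x) * (∑ i, c i * x ^ (i : ℕ)) ^ 2 := by fun_prop
    refine intervalIntegral.integral_pos (by norm_num) hcont.continuousOn ?_ ?_
    · intro x hx
      exact mul_nonneg (by linarith [hx.2]) (sq_nonneg _)
    · by_contra! hcon
      set P : ℝ[X] := ∑ i : Fin (k + 1), monomial (i : ℕ) (c i) with hP
      have hPe : ∀ x, P.eval x = ∑ i, c i * x ^ (i : ℕ) := by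
        intro x; simp [hP, eval_finsetSum]
      have hP0 : P = 0 := by
        refine eq_zero_of_infinite_isRoot _ ((Ioo_infinite (zero_lt_one' ℝ)).mono fun x hx => ?_)
        have h1 := hcon x ⟨hx.1.le, hx.2.le⟩
        have h2 : (∑ i, c i * x ^ (i : ℕ)) ^ 2 ≤ 0 := by
          have : 0 < 1 - x := by linarith [hx.2]
          by_contra! h
          exact absurd h1 (not_le.2 (mul_pos this h))
        show P.eval x = 0
        rw [hPe]
        nlinarith
      apply hc
      ext j
      have := congrArg (fun p : ℝ[X] => p.coeff j) hP0
      simpa [hP, coeff_monomial, Fin.val_inj] using this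
  obtain ⟨C, hC, hQle⟩ := exists_forall_norm_sq_le Q hQc hQs hQp
  -- Values and derivatives are linear in the `k + 1` coefficients, with factors at most `k + 1`;
  -- this gives `(k + 1)²`, squared once more by the square of the sum.
  refine ⟨((k + 1 : ℝ) ^ 2) ^ 2 * C, by positivity, fun p hp s hs => ?_⟩
  set c : Fin (k + 1) → ℝ := fun i => p.coeff i with hcdef
  have hpe : ∀ x, p.eval x = ∑ i, c i * x ^ (i : ℕ) := by
    intro x
    rw [eval_eq_sum_range' (Nat.lt_succ_of_le hp), Finset.sum_range]
  have hpd : (derivative p).eval s = ∑ i : Fin (k + 1), c i * (i * s ^ ((i : ℕ) - 1)) := by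
    have h : p = ∑ i : Fin (k + 1), monomial (i : ℕ) (c i) := by
      conv_lhs => rw [p.as_sum_range' (k + 1) (Nat.lt_succ_of_le hp), Finset.sum_range]
    rw [h, derivative_sum, eval_finsetSum]
    refine Finset.sum_congr rfl fun i _ => ?_
    rw [derivative_monomial, eval_monomial]
    ring
  have hQp : (∫ x in (0 : ℝ)..1, (1 - x) * p.eval x ^ 2) = Q c := by simp only [hpe, hQdef]
  have hkey : ∀ d : Fin (k + 1) → ℝ, (∀ i, |d i| ≤ k + 1) →
      (∑ i, c i * d i) ^ 2 ≤ ((k + 1 : ℝ) ^ 2) ^ 2 * C * Q c := by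
    intro d hd
    have h1 : |∑ i, c i * d i| ≤ (k + 1 : ℝ) ^ 2 * ‖c‖ := by
      refine (Finset.abs_sum_le_sum_abs _ _).trans ?_
      have : ∀ i ∈ (Finset.univ : Finset (Fin (k + 1))), |c i * d i| ≤ ‖c‖ * (k + 1) := by
        intro i _
        rw [abs_mul]
        exact mul_le_mul (norm_le_pi_norm c i) (hd i) (abs_nonneg _) (norm_nonneg _)
      refine (Finset.sum_le_card_nsmul _ _ _ this).trans (le_of_eq ?_)
      simp
      ring
    rw [← sq_abs]
    calc |∑ i, c i * d i| ^ 2 ≤ ((k + 1 : ℝ) ^ 2 * ‖c‖) ^ 2 :=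
          pow_le_pow_left₀ (abs_nonneg _) h1 2
      _ = ((k + 1 : ℝ) ^ 2) ^ 2 * ‖c‖ ^ 2 := by ring
      _ ≤ ((k + 1 : ℝ) ^ 2) ^ 2 * (C * Q c) := by gcongr; exact hQle c
      _ = _ := by ring
  have hpw : ∀ n : ℕ, |s ^ n| ≤ 1 := fun n => by
    rw [abs_of_nonneg (pow_nonneg hs.1 _)]; exact pow_le_one₀ hs.1 hs.2
  rw [hQp, hpe, hpd]
  refine ⟨hkey _ fun i => (hpw i).trans (by linarith [(Nat.cast_nonneg k : (0 : ℝ) ≤ k)]),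
    hkey _ fun i => ?_⟩
  rw [abs_mul, Nat.abs_cast]
  have hi : ((i : ℕ) : ℝ) ≤ k + 1 := by exact_mod_cast i.2.le
  calc ((i : ℕ) : ℝ) * |s ^ ((i : ℕ) - 1)| ≤ (k + 1) * 1 := by
        gcongr; exact hpw _
    _ = _ := mul_one _

lemma integral_sub_mul_sq_eq (a b : ℝ) (p : ℝ[X]) :
    ∫ y in a..b, (b - y) * p.eval y ^ 2 = (b - a) ^ 2 *
      ∫ s in (0 : ℝ)..1, (1 - s) * (p.comp (C (b - a) * X + C a)).eval s ^ 2 := by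
  have h := intervalIntegral.smul_integral_comp_add_mul
    (f := fun y => (b - y) * p.eval y ^ 2) (a := 0) (b := 1) (b - a) a
  simp only [mul_zero, add_zero, mul_one, add_sub_cancel, smul_eq_mul] at h
  rw [← h, sq, mul_assoc, ← intervalIntegral.integral_const_mul (b - a) (fun s => (1 - s) * _)]
  congr 1
  refine intervalIntegral.integral_congr fun s _ => ?_
  simp only [eval_comp, eval_add, eval_mul, eval_C, eval_X]
  rw [add_comm a]
  ring

/-- Affine rescaling. The order of `a` and `b` is free: for `b < a` the sign of `b - y` and the
orientation of the integral cancel. Thus an element run backwards covers corrections that vanish at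
the left end. -/
lemma exists_eval_sq_le_integral (k : ℕ) : ∃ C, 0 < C ∧ ∀ a b : ℝ, a ≠ b → ∀ p : ℝ[X],
    p.natDegree ≤ k → ∀ x ∈ uIcc a b,
      (b - a) ^ 2 * p.eval x ^ 2 ≤ C * ∫ y in a..b, (b - y) * p.eval y ^ 2 ∧
      (b - a) ^ 4 * (derivative p).eval x ^ 2 ≤ C * ∫ y in a..b, (b - y) * p.eval y ^ 2 := by
  obtain ⟨C, hC, h⟩ := exists_eval_sq_le_integral_unit k
  refine ⟨C, hC, fun a b hab p hp x hx => ?_⟩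
  have hba : b - a ≠ 0 := sub_ne_zero.2 hab.symm
  set q := p.comp (Polynomial.C (b - a) * X + Polynomial.C a) with hq
  have hqd : q.natDegree ≤ k := by
    refine natDegree_comp_le.trans ?_
    refine (Nat.mul_le_mul hp (natDegree_linear_le)).trans (by simp)
  set s := (x - a) / (b - a) with hs
  have hxs : (b - a) * s + a = x := by rw [hs]; field_simp; ring
  have hs01 : s ∈ Icc (0 : ℝ) 1 := by
    rcases lt_or_gt_of_ne hab with hlt | hlt
    · rw [uIcc_of_le hlt.le] at hx
      exact ⟨div_nonneg (by linarith [hx.1]) (by linarith),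
        (div_le_one (by linarith)).2 (by linarith [hx.2])⟩
    · rw [uIcc_of_ge hlt.le] at hx
      exact ⟨div_nonneg_of_nonpos (by linarith [hx.2]) (by linarith),
        (div_le_one_of_neg (by linarith)).2 (by linarith [hx.1])⟩
  obtain ⟨h1, h2⟩ := h q hqd s hs01
  have e1 : q.eval s = p.eval x := by simp [hq, hxs]
  have e2 : (derivative q).eval s = (b - a) * (derivative p).eval x := by
    simp [hq, derivative_comp, hxs]
  rw [e1] at h1
  rw [e2] at h2
  rw [integral_sub_mul_sq_eq]
  have hsq : 0 < (b - a) ^ 2 := by positivity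
  constructor
  · calc (b - a) ^ 2 * p.eval x ^ 2 ≤ (b - a) ^ 2 * _ := mul_le_mul_of_nonneg_left h1 hsq.le
      _ = _ := by ring
  · calc (b - a) ^ 4 * (derivative p).eval x ^ 2
        = (b - a) ^ 2 * ((b - a) * (derivative p).eval x) ^ 2 := by ring
      _ ≤ (b - a) ^ 2 * _ := mul_le_mul_of_nonneg_left h2 hsq.le
      _ = _ := by ring

/-- Inverse inequalities for polynomials on an interval. -/
lemma exists_eval_sq_le_integral_sq (k : ℕ) : ∃ C, 0 < C ∧ ∀ a b : ℝ, a < b → ∀ p : ℝ[X],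
    p.natDegree ≤ k → ∀ x ∈ Icc a b,
      (b - a) * p.eval x ^ 2 ≤ C * ∫ y in a..b, p.eval y ^ 2 ∧
      (b - a) * ((b - a) * (derivative p).eval x) ^ 2 ≤ C * ∫ y in a..b, p.eval y ^ 2 := by
  obtain ⟨C, hC, h⟩ := exists_eval_sq_le_integral k
  refine ⟨C, hC, fun a b hab p hp x hx => ?_⟩
  have hpos : 0 < b - a := sub_pos.2 hab
  obtain ⟨h1, h2⟩ := h a b hab.ne p hp x (by rwa [uIcc_of_le hab.le])
  have hle : ∫ y in a..b, (b - y) * p.eval y ^ 2 ≤ (b - a) * ∫ y in a..b, p.eval y ^ 2 := by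
    rw [← intervalIntegral.integral_const_mul]
    refine intervalIntegral.integral_mono_on hab.le
      (Continuous.intervalIntegrable (by fun_prop) _ _)
      (Continuous.intervalIntegrable (by fun_prop) _ _) fun y hy => ?_
    gcongr
    exact hy.1
  have hle' := mul_le_mul_of_nonneg_left hle hC.le
  constructor
  · refine le_of_mul_le_mul_left ?_ hpos
    calc (b - a) * ((b - a) * p.eval x ^ 2) = (b - a) ^ 2 * p.eval x ^ 2 := by ring
      _ ≤ _ := h1.trans hle'
      _ = _ := by ring
  · refine le_of_mul_le_mul_left ?_ hpos
    calc (b - a) * ((b - a) * ((b - a) * (derivative p).eval x) ^ 2)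
        = (b - a) ^ 4 * (derivative p).eval x ^ 2 := by ring
      _ ≤ _ := h2.trans hle'
      _ = _ := by ring

lemma mem_degreeLT_iff_natDegree {k : ℕ} (hk : 1 ≤ k) (q : ℝ[X]) :
    q ∈ degreeLT ℝ k ↔ q.natDegree < k := by
  rw [mem_degreeLT]
  rcases eq_or_ne q 0 with rfl | hq
  · simpa using Nat.pos_of_ne_zero (by omega)
  · exact (natDegree_lt_iff_degree_lt hq).symm

/-- Every linear functional on the polynomials of degree less than `k` is given by integration
against a polynomial of degree at most `k` that vanishes at `b`. -/
lemma exists_integral_mul_eq {k : ℕ} (hk : 1 ≤ k) {a b : ℝ} (hab : a ≠ b)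
    (l : degreeLT ℝ k →ₗ[ℝ] ℝ) :
    ∃ q : ℝ[X], q.natDegree < k ∧
      ∀ r : degreeLT ℝ k, ∫ y in a..b, (b - y) * q.eval y * (r : ℝ[X]).eval y = l r := by
  have hi : ∀ q r : ℝ[X], IntervalIntegrable (fun y => (b - y) * q.eval y * r.eval y) volume a b :=
    fun q r => Continuous.intervalIntegrable (by fun_prop) _ _
  let Φ : degreeLT ℝ k →ₗ[ℝ] degreeLT ℝ k →ₗ[ℝ] ℝ := LinearMap.mk₂ ℝ
    (fun q r => ∫ y in a..b, (b - y) * (q : ℝ[X]).eval y * (r : ℝ[X]).eval y)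
    (by
      intro q q' r
      rw [← intervalIntegral.integral_add (hi _ _) (hi _ _)]
      refine intervalIntegral.integral_congr fun y _ => ?_
      simp only [Submodule.coe_add, eval_add]
      ring)
    (by
      intro c q r
      rw [smul_eq_mul, ← intervalIntegral.integral_const_mul]
      refine intervalIntegral.integral_congr fun y _ => ?_
      simp only [Submodule.coe_smul, eval_smul, smul_eq_mul]
      ring)
    (by
      intro q r r'
      rw [← intervalIntegral.integral_add (hi _ _) (hi _ _)]
      refine intervalIntegral.integral_congr fun y _ => ?_
      simp only [Submodule.coe_add, eval_add]
      ring)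
    (by
      intro c q r
      rw [smul_eq_mul, ← intervalIntegral.integral_const_mul]
      refine intervalIntegral.integral_congr fun y _ => ?_
      simp only [Submodule.coe_smul, eval_smul, smul_eq_mul]
      ring)
  have hΦ : ∀ q r, Φ q r = ∫ y in a..b, (b - y) * (q : ℝ[X]).eval y * (r : ℝ[X]).eval y :=
    fun q r => rfl
  have : FiniteDimensional ℝ (degreeLT ℝ k) :=
    LinearEquiv.finiteDimensional (degreeLTEquiv ℝ k).symm
  -- The form is definite, hence injective into the dual, and equality of dimensions gives
  -- surjectivity.
  have hinj : Function.Injective Φ := by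
    rw [← LinearMap.ker_eq_bot, LinearMap.ker_eq_bot']
    intro q hq
    obtain ⟨C, -, hC⟩ := exists_eval_sq_le_integral k
    have h0 : ∫ y in a..b, (b - y) * (q : ℝ[X]).eval y ^ 2 = 0 := by
      have := LinearMap.congr_fun hq q
      rw [hΦ, LinearMap.zero_apply] at this
      rw [← this]
      refine intervalIntegral.integral_congr fun y _ => ?_
      ring
    have hqd := ((mem_degreeLT_iff_natDegree hk _).1 q.2).le
    ext1
    have hinf : (uIcc a b).Infinite := Icc_infinite (inf_lt_sup.2 hab)
    refine eq_zero_of_infinite_isRoot _ (hinf.mono fun x hx => ?_)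
    have h1 := (hC a b hab q hqd x hx).1
    rw [h0, mul_zero] at h1
    have hba : 0 < (b - a) ^ 2 := by
      have := sub_ne_zero.2 hab.symm
      positivity
    have : (q : ℝ[X]).eval x ^ 2 ≤ 0 := by
      by_contra! h
      exact absurd h1 (not_le.2 (mul_pos hba h))
    show (q : ℝ[X]).eval x = 0
    nlinarith
  have hsurj : Function.Surjective Φ :=
    (LinearMap.injective_iff_surjective_of_finrank_eq_finrank
      (Subspace.dual_finrank_eq (K := ℝ) (V := degreeLT ℝ k)).symm).1 hinj
  obtain ⟨q, hq⟩ := hsurj l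
  refine ⟨q, (mem_degreeLT_iff_natDegree hk _).1 q.2, fun r => ?_⟩
  rw [← hΦ, hq]

/-- Point values of polynomials vanishing at `b` are integrals against polynomials. -/
lemma exists_representer {k : ℕ} (hk : 1 ≤ k) : ∃ C, 0 < C ∧ ∀ a b : ℝ, a ≠ b → ∀ x : ℝ,
    ∃ r : ℝ[X], r.natDegree < k ∧
      (∀ w : ℝ[X], w.natDegree ≤ k → w.eval b = 0 →
        w.eval x = ∫ y in a..b, w.eval y * r.eval y) ∧
      (x ∈ uIcc a b → ∀ y ∈ uIcc a b, |b - a| * |r.eval y| ≤ C) := by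
  obtain ⟨C, hC, hCle⟩ := exists_eval_sq_le_integral k
  refine ⟨C, hC, fun a b hab x => ?_⟩
  obtain ⟨r, hrd, hr⟩ := exists_integral_mul_eq hk hab ((leval x).comp (degreeLT ℝ k).subtype)
  -- Write `w = (X - b) q`. Then `r` represents `q ↦ q(x)` for the weight `b - y`, and the factor `b
  -- - x` turns this into a representation of `w(x)`.
  refine ⟨Polynomial.C (b - x) * r, ?_, ?_, ?_⟩
  · exact (natDegree_C_mul_le _ _).trans_lt hrd
  · intro w hw hwb
    obtain ⟨q, rfl⟩ := dvd_iff_isRoot.2 hwb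
    have hqd : q.natDegree < k := by
      rcases eq_or_ne q 0 with rfl | hq
      · simpa using Nat.pos_of_ne_zero (by omega)
      · rw [natDegree_mul (X_sub_C_ne_zero b) hq, natDegree_X_sub_C] at hw
        omega
    have h := hr ⟨q, (mem_degreeLT_iff_natDegree hk _).2 hqd⟩
    simp only [LinearMap.coe_comp, Function.comp_apply, Submodule.coe_subtype, leval_apply] at h
    simp only [eval_mul, eval_sub, eval_X, eval_C]
    rw [← h]
    rw [← intervalIntegral.integral_const_mul]
    refine intervalIntegral.integral_congr fun y _ => ?_
    ring
  · intro hx y hy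
    have hba : b - a ≠ 0 := sub_ne_zero.2 hab.symm
    have hB : 0 < |b - a| := abs_pos.2 hba
    -- Reproducing property: the weighted norm of `r` is its own value at `x`. The inverse
    -- inequality at `x` bounds that value, and the inverse inequality at `y` then bounds `r`
    -- everywhere.
    have hrr : ∫ y in a..b, (b - y) * r.eval y ^ 2 = r.eval x := by
      have h := hr ⟨r, (mem_degreeLT_iff_natDegree hk _).2 hrd⟩
      simp only [LinearMap.coe_comp, Function.comp_apply, Submodule.coe_subtype, leval_apply] at h
      rw [← h]
      refine intervalIntegral.integral_congr fun y _ => ?_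
      ring
    have h1 := (hCle a b hab r hrd.le x hx).1
    have h2 := (hCle a b hab r hrd.le y hy).1
    rw [hrr] at h1 h2
    have hbx : |b - x| ≤ |b - a| := by
      rw [abs_sub_comm b a, abs_sub_comm b x]
      exact abs_sub_right_of_mem_uIcc hx |>.trans_eq' (abs_sub_comm _ _) |>.trans (abs_sub_comm _ _).le
    have h3 : (b - a) ^ 2 * r.eval x ≤ C := by
      rcases le_or_gt (r.eval x) 0 with hn | hp
      · exact (mul_nonpos_of_nonneg_of_nonpos (sq_nonneg _) hn).trans hC.le
      · refine le_of_mul_le_mul_right ?_ hp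
        calc (b - a) ^ 2 * r.eval x * r.eval x = (b - a) ^ 2 * r.eval x ^ 2 := by ring
          _ ≤ _ := h1
    have h4 : ((b - a) ^ 2 * r.eval y) ^ 2 ≤ C ^ 2 := by
      calc ((b - a) ^ 2 * r.eval y) ^ 2 = (b - a) ^ 2 * ((b - a) ^ 2 * r.eval y ^ 2) := by ring
        _ ≤ (b - a) ^ 2 * (C * r.eval x) := mul_le_mul_of_nonneg_left h2 (sq_nonneg _)
        _ = C * ((b - a) ^ 2 * r.eval x) := by ring
        _ ≤ C * C := mul_le_mul_of_nonneg_left h3 hC.le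
        _ = C ^ 2 := by ring
    have h5 : |(b - a) ^ 2 * r.eval y| ≤ C := abs_le_of_sq_le_sq h4 hC.le
    rw [eval_mul, eval_C, abs_mul]
    calc |b - a| * (|b - x| * |r.eval y|) ≤ |b - a| * (|b - a| * |r.eval y|) := by gcongr
      _ = |(b - a) ^ 2 * r.eval y| := by rw [abs_mul, abs_pow]; ring
      _ ≤ C := h5

/-! ### Functions with Lipschitz continuous derivatives -/

lemma two_pi_pos : 0 < 2 * Real.pi := by positivity

lemma uniqueDiffOn_Icc_two_pi : UniqueDiffOn ℝ (Icc 0 (2 * Real.pi)) :=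
  uniqueDiffOn_Icc two_pi_pos

/-- `f` has derivatives up to order `n` on `[0, 2π]`, which are bounded by `M`, and the last one is
Lipschitz continuous with constant `M`. -/
def LipBall : ℕ → ℝ → (ℝ → ℝ) → Prop
  | 0, M, f => (∀ x ∈ Icc 0 (2 * Real.pi), |f x| ≤ M) ∧
      ∀ x ∈ Icc 0 (2 * Real.pi), ∀ y ∈ Icc 0 (2 * Real.pi), |f x - f y| ≤ M * |x - y|
  | n + 1, M, f => (∀ x ∈ Icc 0 (2 * Real.pi), |f x| ≤ M) ∧
      ∃ f' : ℝ → ℝ, (∀ x ∈ Icc 0 (2 * Real.pi),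
        HasDerivWithinAt f (f' x) (Icc 0 (2 * Real.pi)) x) ∧ LipBall n M f'

namespace LipBall

variable {n : ℕ} {M K : ℝ} {f g : ℝ → ℝ}

lemma bound (h : LipBall n M f) : ∀ x ∈ Icc 0 (2 * Real.pi), |f x| ≤ M := by
  cases n <;> exact h.1

lemma nonneg (h : LipBall n M f) : 0 ≤ M :=
  (abs_nonneg _).trans (h.bound 0 ⟨le_rfl, two_pi_pos.le⟩)

lemma lipschitz (h : LipBall n M f) :
    ∀ x ∈ Icc 0 (2 * Real.pi), ∀ y ∈ Icc 0 (2 * Real.pi), |f x - f y| ≤ M * |x - y| := by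
  cases n with
  | zero => exact h.2
  | succ n =>
    obtain ⟨-, f', hf', h'⟩ := h
    intro x hx y hy
    exact (convex_Icc _ _).norm_image_sub_le_of_norm_hasDerivWithin_le (f := f) (f' := f')
      hf' (fun z hz => h'.bound z hz) hy hx

lemma continuousOn (h : LipBall n M f) : ContinuousOn f (Icc 0 (2 * Real.pi)) := by
  have : LipschitzOnWith (Real.toNNReal M) f (Icc 0 (2 * Real.pi)) := by
    refine LipschitzOnWith.of_dist_le_mul fun x hx y hy => ?_
    rw [Real.coe_toNNReal _ h.nonneg]
    exact h.lipschitz x hx y hy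
  exact this.continuousOn

lemma of_succ : ∀ {n : ℕ} {f : ℝ → ℝ}, LipBall (n + 1) M f → LipBall n M f
  | 0, _, h => ⟨h.bound, h.lipschitz⟩
  | _ + 1, _, ⟨hb, f', hf', h'⟩ => ⟨hb, f', hf', h'.of_succ⟩

lemma of_le {m : ℕ} (h : LipBall m M f) (hnm : n ≤ m) : LipBall n M f := by
  induction m, hnm using Nat.le_induction with
  | base => exact h
  | succ m _ ih => exact ih h.of_succ

lemma mono : ∀ {n : ℕ} {f : ℝ → ℝ}, LipBall n M f → M ≤ K → LipBall n K f
  | 0, _, ⟨hb, hl⟩, hMK => ⟨fun x hx => (hb x hx).trans hMK, fun x hx y hy =>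
      (hl x hx y hy).trans (mul_le_mul_of_nonneg_right hMK (abs_nonneg _))⟩
  | _ + 1, _, ⟨hb, f', hf', h'⟩, hMK =>
      ⟨fun x hx => (hb x hx).trans hMK, f', hf', h'.mono hMK⟩

lemma congr (h : LipBall n M f) (hfg : EqOn f g (Icc 0 (2 * Real.pi))) : LipBall n M g := by
  cases n with
  | zero =>
    refine ⟨fun x hx => hfg hx ▸ h.1 x hx, fun x hx y hy => ?_⟩
    rw [← hfg hx, ← hfg hy]
    exact h.2 x hx y hy
  | succ n =>
    obtain ⟨hb, f', hf', h'⟩ := h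
    exact ⟨fun x hx => hfg hx ▸ hb x hx, f',
      fun x hx => (hf' x hx).congr (fun y hy => (hfg hy).symm) (hfg hx).symm, h'⟩

lemma hasDerivWithinAt (h : LipBall (n + 1) M f) : ∀ x ∈ Icc 0 (2 * Real.pi),
    HasDerivWithinAt f (derivWithin f (Icc 0 (2 * Real.pi)) x) (Icc 0 (2 * Real.pi)) x := by
  obtain ⟨-, f', hf', -⟩ := h
  exact fun x hx => (hf' x hx).differentiableWithinAt.hasDerivWithinAt

lemma lipBall_derivWithin (h : LipBall (n + 1) M f) :
    LipBall n M (derivWithin f (Icc 0 (2 * Real.pi))) := by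
  obtain ⟨-, f', hf', h'⟩ := h
  exact h'.congr fun x hx => ((hf' x hx).derivWithin (uniqueDiffOn_Icc_two_pi x hx)).symm

lemma add : ∀ {n : ℕ} {f g : ℝ → ℝ}, LipBall n M f → LipBall n K g →
    LipBall n (M + K) (fun x => f x + g x)
  | 0, f, g, ⟨hb, hl⟩, ⟨hb', hl'⟩ => by
    refine ⟨fun x hx => (abs_add_le _ _).trans (add_le_add (hb x hx) (hb' x hx)),
      fun x hx y hy => ?_⟩
    rw [add_sub_add_comm, add_mul]
    exact (abs_add_le _ _).trans (add_le_add (hl x hx y hy) (hl' x hx y hy))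
  | _ + 1, f, g, ⟨hb, f', hf', h⟩, ⟨hb', g', hg', h'⟩ =>
    ⟨fun x hx => (abs_add_le _ _).trans (add_le_add (hb x hx) (hb' x hx)), _,
      fun x hx => (hf' x hx).add (hg' x hx), h.add h'⟩

lemma neg : ∀ {n : ℕ} {f : ℝ → ℝ}, LipBall n M f → LipBall n M (fun x => -f x)
  | 0, f, ⟨hb, hl⟩ => by
    refine ⟨fun x hx => by rw [abs_neg]; exact hb x hx, fun x hx y hy => ?_⟩
    rw [← neg_add', abs_neg, ← sub_eq_add_neg]
    exact hl x hx y hy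
  | _ + 1, f, ⟨hb, f', hf', h⟩ =>
    ⟨fun x hx => by rw [abs_neg]; exact hb x hx, _, fun x hx => (hf' x hx).neg, h.neg⟩

lemma sub (hf : LipBall n M f) (hg : LipBall n K g) :
    LipBall n (M + K) (fun x => f x - g x) := by
  simpa only [sub_eq_add_neg] using hf.add hg.neg

/-- Each application of the product rule doubles the number of terms; the remaining factor two comes
from the Lipschitz bound of a product. -/
lemma mul : ∀ {n : ℕ} {f g : ℝ → ℝ}, LipBall n M f → LipBall n K g →
    LipBall n (2 ^ (n + 1) * (M * K)) (fun x => f x * g x)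
  | 0, f, g, hf, hg => by
    have hM := hf.nonneg
    have hK := hg.nonneg
    have hMK := mul_nonneg hM hK
    refine ⟨fun x hx => ?_, fun x hx y hy => ?_⟩
    · rw [abs_mul]
      refine (mul_le_mul (hf.bound x hx) (hg.bound x hx) (abs_nonneg _) hM).trans ?_
      norm_num
      linarith
    · calc |f x * g x - f y * g y| = |(f x - f y) * g x + f y * (g x - g y)| := by ring_nf
        _ ≤ |f x - f y| * |g x| + |f y| * |g x - g y| := by
          rw [← abs_mul, ← abs_mul]; exact abs_add_le _ _
        _ ≤ (M * |x - y|) * K + M * (K * |x - y|) := by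
          have h1 := hf.lipschitz x hx y hy
          have h2 := hg.lipschitz x hx y hy
          have h3 := hf.bound y hy
          have h4 := hg.bound x hx
          gcongr
        _ = _ := by ring
  | n + 1, f, g, hf, hg => by
    have hMK := mul_nonneg hf.nonneg hg.nonneg
    obtain ⟨hb, f', hf', h⟩ := hf
    obtain ⟨hb', g', hg', h'⟩ := hg
    have hf₀ : LipBall (n + 1) M f := ⟨hb, f', hf', h⟩
    have hg₀ : LipBall (n + 1) K g := ⟨hb', g', hg', h'⟩
    refine ⟨fun x hx => ?_, _, fun x hx => (hf' x hx).mul (hg' x hx), ?_⟩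
    · rw [abs_mul]
      refine (mul_le_mul (hb x hx) (hb' x hx) (abs_nonneg _) hf₀.nonneg).trans ?_
      have : (1 : ℝ) ≤ 2 ^ (n + 1 + 1) := one_le_pow₀ (by norm_num)
      nlinarith
    · refine ((h.mul hg₀.of_succ).add (hf₀.of_succ.mul h')).mono (le_of_eq ?_)
      ring

end LipBall

/-- Partial derivatives of a smooth function on a rectangle. -/
lemma exists_partial_derivatives {T : ℝ} (hT : 0 < T) {G : ℝ × ℝ → ℝ}
    (hG : ContDiffOn ℝ ∞ G (Icc 0 T ×ˢ Icc 0 (2 * Real.pi))) :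
    ∃ Gt Gx : ℝ × ℝ → ℝ,
      ContDiffOn ℝ ∞ Gt (Icc 0 T ×ˢ Icc 0 (2 * Real.pi)) ∧
      ContDiffOn ℝ ∞ Gx (Icc 0 T ×ˢ Icc 0 (2 * Real.pi)) ∧
      ∀ t ∈ Icc 0 T, ∀ x ∈ Icc 0 (2 * Real.pi),
        HasDerivWithinAt (fun s => G (s, x)) (Gt (t, x)) (Icc 0 T) t ∧
        HasDerivWithinAt (fun y => G (t, y)) (Gx (t, x)) (Icc 0 (2 * Real.pi)) x := by
  set R := Icc 0 T ×ˢ Icc 0 (2 * Real.pi)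
  have hR : UniqueDiffOn ℝ R := (uniqueDiffOn_Icc hT).prod uniqueDiffOn_Icc_two_pi
  have hd : ContDiffOn ℝ ∞ (fderivWithin ℝ G R) R := hG.fderivWithin hR (by simp)
  refine ⟨fun p => fderivWithin ℝ G R p (1, 0), fun p => fderivWithin ℝ G R p (0, 1),
    hd.clm_apply contDiffOn_const, hd.clm_apply contDiffOn_const, fun t ht x hx => ?_⟩
  have h := (hG.differentiableOn (by simp) (t, x) ⟨ht, hx⟩).hasFDerivWithinAt
  constructor
  · have h1 : HasDerivWithinAt (fun s : ℝ => (s, x)) ((1 : ℝ), (0 : ℝ)) (Icc 0 T) t :=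
      (hasDerivWithinAt_id _ _).prodMk (hasDerivWithinAt_const _ _ _)
    exact h.comp_hasDerivWithinAt (t := R) t h1 fun s hs => Set.mk_mem_prod hs hx
  · have h1 : HasDerivWithinAt (fun y : ℝ => (t, y)) ((0 : ℝ), (1 : ℝ)) (Icc 0 (2 * Real.pi)) x :=
      (hasDerivWithinAt_const _ _ _).prodMk (hasDerivWithinAt_id _ _)
    exact h.comp_hasDerivWithinAt (t := R) x h1 fun s hs => Set.mk_mem_prod ht hs

/-- Compactness of the rectangle makes the constant independent of time. -/
lemma exists_lipBall_of_contDiffOn_prod {T : ℝ} (hT : 0 < T) (n : ℕ) : ∀ {G : ℝ × ℝ → ℝ},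
    ContDiffOn ℝ ∞ G (Icc 0 T ×ˢ Icc 0 (2 * Real.pi)) →
    ∃ K, ∀ t ∈ Icc 0 T, LipBall n K fun x => G (t, x) := by
  have hb : ∀ {G : ℝ × ℝ → ℝ}, ContDiffOn ℝ ∞ G (Icc 0 T ×ˢ Icc 0 (2 * Real.pi)) →
      ∃ K, ∀ t ∈ Icc 0 T, ∀ x ∈ Icc 0 (2 * Real.pi), |G (t, x)| ≤ K := by
    intro G hG
    obtain ⟨K, hK⟩ := (isCompact_Icc.prod isCompact_Icc).exists_bound_of_continuousOn
      hG.continuousOn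
    exact ⟨K, fun t ht x hx => hK (t, x) ⟨ht, hx⟩⟩
  induction n with
  | zero =>
    intro G hG
    obtain ⟨_, Gx, -, hGx, hd⟩ := exists_partial_derivatives hT hG
    obtain ⟨K, hK⟩ := hb hG
    obtain ⟨K', hK'⟩ := hb hGx
    refine ⟨max K K', fun t ht => ⟨fun x hx => (hK t ht x hx).trans (le_max_left _ _), ?_⟩⟩
    intro x hx y hy
    exact (convex_Icc _ _).norm_image_sub_le_of_norm_hasDerivWithin_le
      (f := fun x => G (t, x)) (fun z hz => (hd t ht z hz).2)
      (fun z hz => (hK' t ht z hz).trans (le_max_right _ _)) hy hx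
  | succ n ih =>
    intro G hG
    obtain ⟨_, Gx, -, hGx, hd⟩ := exists_partial_derivatives hT hG
    obtain ⟨K, hK⟩ := hb hG
    obtain ⟨K', hK'⟩ := ih hGx
    exact ⟨max K K', fun t ht => ⟨fun x hx => (hK t ht x hx).trans (le_max_left _ _), _,
      fun x hx => (hd t ht x hx).2, (hK' t ht).mono (le_max_right _ _)⟩⟩

lemma exists_lipBall_of_contDiffOn (n : ℕ) {f : ℝ → ℝ}
    (hf : ContDiffOn ℝ ∞ f (Icc 0 (2 * Real.pi))) : ∃ K, LipBall n K f := by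
  -- A function of `x` alone is viewed as constant in time on a rectangle of unit height.
  obtain ⟨K, hK⟩ := exists_lipBall_of_contDiffOn_prod one_pos n (G := fun p => f p.2)
    (hf.comp contDiffOn_snd fun p hp => hp.2)
  exact ⟨K, hK 0 ⟨le_rfl, zero_le_one⟩⟩

/-! ### Lagrange interpolation -/

/-- If `f - R` has `n + 2` zeros, where `R` has degree at most `n + 1`, then the leading coefficient
of `R` is bounded by the Lipschitz constant of the `n`-th derivative of `f`. -/
lemma LipBall.abs_coeff_le {M : ℝ} : ∀ {n : ℕ} {f : ℝ → ℝ} (_ : LipBall n M f) {R : ℝ[X]}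
    (_ : R.natDegree ≤ n + 1) {z : ℕ → ℝ} (_ : ∀ i ≤ n, z i < z (i + 1))
    (_ : ∀ i ≤ n + 1, z i ∈ Icc 0 (2 * Real.pi) ∧ f (z i) = R.eval (z i)),
    |R.coeff (n + 1)| ≤ M
  | 0, f, h, R, hR, z, hz, hf => by
    have h0 := hf 0 (Nat.zero_le _)
    have h1 := hf 1 le_rfl
    have hlt : z 0 < z 1 := hz 0 le_rfl
    have hl := h.lipschitz _ h1.1 _ h0.1
    have hRe : ∀ x, R.eval x = R.coeff 0 + R.coeff 1 * x := by
      intro x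
      rw [eval_eq_sum_range' (Nat.lt_succ_of_le hR)]
      simp [Finset.sum_range_succ]
    rw [h0.2, h1.2, hRe, hRe, add_sub_add_left_eq_sub, ← mul_sub, abs_mul] at hl
    exact le_of_mul_le_mul_right hl (abs_pos.2 (sub_ne_zero.2 hlt.ne'))
  | n + 1, f, h, R, hR, z, hz, hf => by
    obtain ⟨f', hf', h'⟩ := h.2
    -- Rolle's theorem between consecutive zeros. The value 0 for large `i` only makes the sequence
    -- total.
    have hroll : ∀ i, ∃ ξ, i ≤ n + 1 → ξ ∈ Ioo (z i) (z (i + 1)) ∧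
        ξ ∈ Icc 0 (2 * Real.pi) ∧ f' ξ = (derivative R).eval ξ := by
      intro i
      by_cases hi : i ≤ n + 1
      · have ha := hf i (by omega)
        have hb := hf (i + 1) (by omega)
        have hsub : Icc (z i) (z (i + 1)) ⊆ Icc 0 (2 * Real.pi) :=
          Icc_subset_Icc ha.1.1 hb.1.2
        obtain ⟨ξ, hξ, hξ'⟩ := exists_hasDerivAt_eq_zero (f := fun x => f x - R.eval x)
          (f' := fun x => f' x - (derivative R).eval x) (hz i hi)
          ((h.continuousOn.mono hsub).sub R.continuous.continuousOn)
          (by simp only [ha.2, hb.2, sub_self])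
          (fun x hx => ((hf' x (hsub (Ioo_subset_Icc_self hx))).hasDerivAt
            (Icc_mem_nhds (ha.1.1.trans_lt hx.1) (hx.2.trans_le hb.1.2))).sub (R.hasDerivAt x))
        exact ⟨ξ, fun _ => ⟨hξ, hsub (Ioo_subset_Icc_self hξ), sub_eq_zero.1 hξ'⟩⟩
      · exact ⟨0, fun h => absurd h hi⟩
    choose ξ hξ using hroll
    have hR' : (derivative R).natDegree ≤ n + 1 :=
      (natDegree_derivative_le R).trans (by omega)
    have key := h'.abs_coeff_le hR' (z := ξ)
      (fun i hi => (hξ i (by omega)).1.2.trans (hξ (i + 1) (by omega)).1.1)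
      (fun i hi => (hξ i hi).2)
    -- Differentiation multiplies the leading coefficient by `n + 2`; this factor is only needed to
    -- be at least one.
    rw [coeff_derivative, abs_mul] at key
    refine le_trans ?_ key
    have : (1 : ℝ) ≤ |((n + 1 : ℕ) : ℝ) + 1| := by
      rw [abs_of_nonneg (by positivity)]
      have : (0 : ℝ) ≤ ((n + 1 : ℕ) : ℝ) := by positivity
      linarith
    nlinarith [abs_nonneg (R.coeff (n + 1 + 1))]

/-- The error of Lagrange interpolation. -/
lemma LipBall.abs_sub_interpolate_le {ι : Type*} [DecidableEq ι] {n : ℕ} {M : ℝ} {f : ℝ → ℝ}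
    (h : LipBall n M f) {s : Finset ι} (hs : s.card = n + 1) {v : ι → ℝ} (hv : Set.InjOn v s)
    {a b : ℝ} (ha : 0 ≤ a) (hb : b ≤ 2 * Real.pi)
    (hvI : ∀ i ∈ s, v i ∈ Icc a b) {x : ℝ} (hx : x ∈ Icc a b) :
    |f x - (Lagrange.interpolate s v fun i => f (v i)).eval x| ≤ M * (b - a) ^ (n + 1) := by
  have hsub : Icc a b ⊆ Icc 0 (2 * Real.pi) := Icc_subset_Icc ha hb
  have hab : 0 ≤ b - a := by linarith [hx.1, hx.2]
  by_cases hmem : ∃ i ∈ s, v i = x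
  · obtain ⟨i, hi, rfl⟩ := hmem
    rw [Lagrange.eval_interpolate_at_node _ hv hi, sub_self, abs_zero]
    exact mul_nonneg h.nonneg (pow_nonneg hab _)
  push Not at hmem
  set P := Lagrange.interpolate s v fun i => f (v i) with hP
  set W := Lagrange.nodal s v with hW
  have hWx : W.eval x ≠ 0 := by
    rw [hW, Lagrange.eval_nodal, Finset.prod_ne_zero_iff]
    exact fun i hi => sub_ne_zero.2 (hmem i hi).symm
  -- With this multiple of the nodal polynomial added, the interpolant also meets `f` at `x`. There
  -- are then `n + 2` points of agreement, and `c` is the leading coefficient.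
  set c := (f x - P.eval x) / W.eval x with hc
  have hPd : P.degree < (n + 1 : ℕ) := by
    have := Lagrange.degree_interpolate_lt (fun i => f (v i)) hv
    rwa [hs] at this
  have hWd : W.natDegree = n + 1 := by rw [hW, Lagrange.natDegree_nodal, hs]
  have hWm : W.Monic := Lagrange.nodal_monic
  set R := P + C c * W with hR
  have hRd : R.natDegree ≤ n + 1 := by
    refine (natDegree_add_le _ _).trans (max_le ?_ ?_)
    · exact natDegree_le_of_degree_le hPd.le
    · exact (natDegree_C_mul_le _ _).trans hWd.le
  have hRc : R.coeff (n + 1) = c := by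
    have h1 : W.coeff (n + 1) = 1 := by rw [← hWd]; exact hWm
    rw [hR, coeff_add, coeff_C_mul, h1, coeff_eq_zero_of_degree_lt hPd]
    ring
  set Z : Finset ℝ := insert x (s.image v) with hZ
  have hxn : x ∉ s.image v := by simpa using hmem
  have hZc : Z.card = n + 2 := by
    rw [hZ, Finset.card_insert_of_notMem hxn, Finset.card_image_of_injOn hv, hs]
  have hZz : ∀ y ∈ Z, y ∈ Icc 0 (2 * Real.pi) ∧ f y = R.eval y := by
    intro y hy
    rcases Finset.mem_insert.1 hy with rfl | hy
    · refine ⟨hsub hx, ?_⟩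
      rw [hR, eval_add, eval_C_mul, hc, div_mul_cancel₀ _ hWx]
      ring
    · obtain ⟨i, hi, rfl⟩ := Finset.mem_image.1 hy
      refine ⟨hsub (hvI i hi), ?_⟩
      rw [hR, eval_add, eval_C_mul, hW, Lagrange.eval_nodal_at_node hi, hP,
        Lagrange.eval_interpolate_at_node _ hv hi]
      ring
  let e := Z.orderEmbOfFin hZc
  have hcle : |c| ≤ M := by
    rw [← hRc]
    refine h.abs_coeff_le hRd
      (z := fun i => if hi : i < n + 2 then e ⟨i, hi⟩ else 0) ?_ ?_
    · intro i hi
      rw [dif_pos (by omega), dif_pos (by omega)]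
      exact e.strictMono (Fin.mk_lt_mk.2 i.lt_succ_self)
    · intro i hi
      rw [dif_pos (by omega)]
      exact hZz _ (Z.orderEmbOfFin_mem hZc _)
  have hWle : |W.eval x| ≤ (b - a) ^ (n + 1) := by
    rw [hW, Lagrange.eval_nodal, Finset.abs_prod, ← hs, ← Finset.prod_const]
    refine Finset.prod_le_prod (fun i _ => abs_nonneg _) fun i hi => ?_
    have := hvI i hi
    rw [abs_le]
    constructor <;> linarith [this.1, this.2, hx.1, hx.2]
  have : f x - P.eval x = c * W.eval x := by rw [hc, div_mul_cancel₀ _ hWx]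
  rw [this, abs_mul]
  exact mul_le_mul hcle hWle (abs_nonneg _) h.nonneg

/-! ### Weak derivatives -/

/-- Test functions on `(0, 2π)`. -/
structure IsTest (φ : ℝ → ℝ) : Prop where
  contDiff : ContDiff ℝ ∞ φ
  compact : HasCompactSupport φ
  support : tsupport φ ⊆ Ioo 0 (2 * Real.pi)

namespace IsTest

variable {φ ψ : ℝ → ℝ}

lemma deriv (h : IsTest φ) : IsTest (deriv φ) :=
  ⟨(contDiff_infty_iff_deriv.1 h.contDiff).2, h.compact.deriv,
    (tsupport_deriv_subset (f := φ)).trans h.support⟩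

lemma iteratedDeriv (h : IsTest φ) : ∀ n, IsTest (iteratedDeriv n φ)
  | 0 => by rw [iteratedDeriv_zero]; exact h
  | n + 1 => by rw [iteratedDeriv_succ]; exact (h.iteratedDeriv n).deriv

lemma eq_zero (h : IsTest φ) {x : ℝ} (hx : x ∉ Ioo 0 (2 * Real.pi)) : φ x = 0 :=
  image_eq_zero_of_notMem_tsupport fun hx' => hx (h.support hx')

lemma integral_mul (h : IsTest φ) (F : ℝ → ℝ) :
    ∫ x, F x * φ x = ∫ x in 0..2 * Real.pi, F x * φ x := by
  rw [intervalIntegral.integral_of_le two_pi_pos.le, integral_Ioc_eq_integral_Ioo]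
  refine (setIntegral_eq_integral_of_forall_compl_eq_zero fun x hx => ?_).symm
  rw [h.eq_zero hx, mul_zero]

lemma hasDerivAt (h : IsTest φ) (x : ℝ) : HasDerivAt φ (_root_.deriv φ x) x :=
  (h.contDiff.differentiable (by simp) x).hasDerivAt

lemma sub_const_mul (h : IsTest φ) (h' : IsTest ψ) (c : ℝ) : IsTest (fun x => φ x - c * ψ x) := by
  have hs : Function.support (fun x => φ x - c * ψ x) ⊆ tsupport φ ∪ tsupport ψ := by
    intro x hx
    by_contra hcon
    rw [mem_union, not_or] at hcon
    apply hx
    simp [image_eq_zero_of_notMem_tsupport hcon.1, image_eq_zero_of_notMem_tsupport hcon.2]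
  have hs' : tsupport (fun x => φ x - c * ψ x) ⊆ tsupport φ ∪ tsupport ψ :=
    closure_minimal hs ((isClosed_tsupport _).union (isClosed_tsupport _))
  exact ⟨h.contDiff.sub (contDiff_const.mul h'.contDiff),
    (h.compact.isCompact.union h'.compact.isCompact).of_isClosed_subset (isClosed_tsupport _) hs',
    hs'.trans (union_subset h.support h'.support)⟩

/-- A test function with vanishing integral is the derivative of a test function. -/
lemma exists_deriv_eq (h : IsTest φ) (h0 : ∫ x in 0..2 * Real.pi, φ x = 0) :
    ∃ ψ, IsTest ψ ∧ _root_.deriv ψ = φ := by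
  obtain ⟨a, b, ha, hb, hab⟩ : ∃ a b, 0 < a ∧ b < 2 * Real.pi ∧ tsupport φ ⊆ Icc a b := by
    rcases (tsupport φ).eq_empty_or_nonempty with he | hne
    · exact ⟨Real.pi, Real.pi, Real.pi_pos, by linarith [Real.pi_pos], by simp [he]⟩
    · obtain ⟨a, ha, ha'⟩ := h.compact.isCompact.exists_isLeast hne
      obtain ⟨b, hb, hb'⟩ := h.compact.isCompact.exists_isGreatest hne
      exact ⟨a, b, (h.support ha).1, (h.support hb).2, fun x hx => ⟨ha' hx, hb' hx⟩⟩
  have hφ0 : ∀ x, x ∉ Icc a b → φ x = 0 := fun x hx =>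
    image_eq_zero_of_notMem_tsupport fun hx' => hx (hab hx')
  have hφc : Continuous φ := h.contDiff.continuous
  set ψ : ℝ → ℝ := fun x => ∫ y in 0..x, φ y with hψ
  have hψd : ∀ x, HasDerivAt ψ (φ x) x := fun x =>
    intervalIntegral.integral_hasDerivAt_right (hφc.intervalIntegrable _ _)
      hφc.stronglyMeasurable.stronglyMeasurableAtFilter hφc.continuousAt
  have hψe : _root_.deriv ψ = φ := funext fun x => (hψd x).deriv
  have hψ0 : ∀ x, x ∉ Icc a b → ψ x = 0 := by
    intro x hx
    rw [mem_Icc, not_and_or, not_le, not_le] at hx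
    rcases hx with hx | hx
    · refine (intervalIntegral.integral_congr (g := fun _ => 0) fun y hy => ?_).trans (by simp)
      refine hφ0 y fun hy' => ?_
      have := hy.2
      rcases le_total 0 x with h0x | h0x
      · rw [sup_of_le_right h0x] at this
        linarith [hy'.1]
      · rw [sup_of_le_left h0x] at this
        linarith [hy'.1]
    -- To the right of the support the primitive vanishes because the total integral does.
    · have h1 : ψ x = -∫ y in x..2 * Real.pi, φ y := by
        have := intervalIntegral.integral_add_adjacent_intervals
          (hφc.intervalIntegrable (μ := volume) 0 x) (hφc.intervalIntegrable x (2 * Real.pi))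
        rw [h0] at this
        show ∫ y in 0..x, φ y = _
        linarith
      rw [h1, neg_eq_zero]
      refine (intervalIntegral.integral_congr (g := fun _ => 0) fun y hy => ?_).trans (by simp)
      refine hφ0 y fun hy' => ?_
      have := hy.1
      rcases le_total x (2 * Real.pi) with h0x | h0x
      · rw [inf_of_le_left h0x] at this
        linarith [hy'.2]
      · rw [inf_of_le_right h0x] at this
        linarith [hy'.2]
  have hts : tsupport ψ ⊆ Icc a b := by
    refine closure_minimal (fun x hx => ?_) isClosed_Icc
    by_contra hcon
    exact hx (hψ0 x hcon)
  refine ⟨ψ, ⟨?_, isCompact_Icc.of_isClosed_subset (isClosed_tsupport _) hts,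
    hts.trans fun x hx => ⟨ha.trans_le hx.1, hx.2.trans_lt hb⟩⟩, hψe⟩
  rw [contDiff_infty_iff_deriv, hψe]
  exact ⟨fun x => (hψd x).differentiableAt, h.contDiff⟩

end IsTest

lemma exists_isTest_integral_eq_one :
    ∃ ρ, IsTest ρ ∧ ∫ x in 0..2 * Real.pi, ρ x = 1 := by
  let β : ContDiffBump Real.pi := ⟨1, 2, one_pos, one_lt_two⟩
  have hβ : IsTest (β.normed volume) := by
    refine ⟨β.contDiff_normed, β.hasCompactSupport_normed, ?_⟩
    rw [β.tsupport_normed_eq, Real.closedBall_eq_Icc]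
    intro x hx
    have h1 := Real.pi_gt_three
    have h2 : Real.pi - 2 ≤ x := hx.1
    have h3 : x ≤ Real.pi + 2 := hx.2
    exact ⟨by linarith, by linarith⟩
  refine ⟨_, hβ, ?_⟩
  have h1 := hβ.integral_mul (fun _ => 1)
  simp only [one_mul] at h1
  rw [← h1, β.integral_normed]

lemma intervalIntegrable_of_integrableOn {f : ℝ → ℝ}
    (hf : IntegrableOn f (Ioo 0 (2 * Real.pi))) : IntervalIntegrable f volume 0 (2 * Real.pi) :=
  (intervalIntegrable_iff_integrableOn_Ioo_of_le two_pi_pos.le).2 hf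

lemma ae_eq_zero_of_integral_test_eq_zero {f : ℝ → ℝ}
    (hf : LocallyIntegrableOn f (Ioo 0 (2 * Real.pi)))
    (h : ∀ φ, IsTest φ → ∫ x, f x * φ x = 0) :
    ∀ᵐ x, x ∈ Ioo 0 (2 * Real.pi) → f x = 0 := by
  refine isOpen_Ioo.ae_eq_zero_of_integral_contDiff_smul_eq_zero hf fun φ h1 h2 h3 => ?_
  rw [← h φ ⟨h1, h2, h3⟩]
  simp only [smul_eq_mul, mul_comm]

/-- The lemma of du Bois-Reymond. -/
lemma exists_ae_eq_const {f : ℝ → ℝ} (hf : IntegrableOn f (Ioo 0 (2 * Real.pi)))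
    (h : ∀ φ, IsTest φ → ∫ x in 0..2 * Real.pi, f x * deriv φ x = 0) :
    ∃ c, ∀ᵐ x, x ∈ Ioo 0 (2 * Real.pi) → f x = c := by
  obtain ⟨ρ, hρ, hρ1⟩ := exists_isTest_integral_eq_one
  have hi : ∀ φ, IsTest φ → IntervalIntegrable (fun x => f x * φ x) volume 0 (2 * Real.pi) :=
    fun φ hφ => (intervalIntegrable_of_integrableOn hf).mul_continuousOn
      hφ.contDiff.continuous.continuousOn
  have hi' : ∀ φ, IsTest φ → IntervalIntegrable φ volume 0 (2 * Real.pi) :=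
    fun φ hφ => hφ.contDiff.continuous.intervalIntegrable _ _
  set c := ∫ x in 0..2 * Real.pi, f x * ρ x with hc
  refine ⟨c, ?_⟩
  have hconst : IntegrableOn (fun _ : ℝ => c) (Ioo 0 (2 * Real.pi)) :=
    integrableOn_const measure_Ioo_lt_top.ne
  have h0 : ∀ φ, IsTest φ → ∫ x, (f x - c) * φ x = 0 := by
    intro φ hφ
    set m := ∫ x in 0..2 * Real.pi, φ x with hm
    -- Subtracting the right multiple of a bump of unit mass makes the integral vanish, so the
    -- difference is an admissible derivative.
    obtain ⟨ψ, hψ, hψe⟩ := (hφ.sub_const_mul hρ m).exists_deriv_eq (by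
      rw [intervalIntegral.integral_sub (hi' φ hφ) ((hi' ρ hρ).const_mul m),
        intervalIntegral.integral_const_mul, hρ1, ← hm]
      ring)
    have h1 := h ψ hψ
    rw [hψe] at h1
    have h2 : ∫ x in 0..2 * Real.pi, f x * (φ x - m * ρ x) =
        (∫ x in 0..2 * Real.pi, f x * φ x) - m * c := by
      rw [hc, ← intervalIntegral.integral_const_mul, ← intervalIntegral.integral_sub (hi φ hφ)
        ((hi ρ hρ).const_mul m)]
      refine intervalIntegral.integral_congr fun x _ => ?_
      ring
    rw [hφ.integral_mul]
    have h3 : ∫ x in 0..2 * Real.pi, (f x - c) * φ x =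
        (∫ x in 0..2 * Real.pi, f x * φ x) - c * m := by
      rw [hm, ← intervalIntegral.integral_const_mul, ← intervalIntegral.integral_sub (hi φ hφ)
        ((hi' φ hφ).const_mul c)]
      refine intervalIntegral.integral_congr fun x _ => ?_
      ring
    rw [h3]
    linarith
  filter_upwards [ae_eq_zero_of_integral_test_eq_zero (hf.sub hconst).locallyIntegrableOn h0]
    with x hx hxI
  exact sub_eq_zero.1 (hx hxI)

/-- A function with an integrable weak derivative is an indefinite integral. -/
lemma exists_ae_eq_integral {f v : ℝ → ℝ} (hf : IntegrableOn f (Ioo 0 (2 * Real.pi)))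
    (hv : IntegrableOn v (Ioo 0 (2 * Real.pi)))
    (h : ∀ φ, IsTest φ → ∫ x, f x * deriv φ x = -∫ x, v x * φ x) :
    ∃ c, ∀ᵐ x, x ∈ Ioo 0 (2 * Real.pi) → f x = c + ∫ y in 0..x, v y := by
  set V : ℝ → ℝ := fun x => ∫ y in 0..x, v y with hV
  have hvi := intervalIntegrable_of_integrableOn hv
  have hVac : AbsolutelyContinuousOnInterval V 0 (2 * Real.pi) :=
    hvi.absolutelyContinuousOnInterval_intervalIntegral left_mem_uIcc
  have hVi : IntegrableOn V (Ioo 0 (2 * Real.pi)) := by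
    have := hVac.continuousOn
    rw [uIcc_of_le two_pi_pos.le] at this
    exact this.integrableOn_Icc.mono_set Ioo_subset_Icc_self
  -- The indefinite integral is absolutely continuous, so it has weak derivative `v`. Its difference
  -- from `f` is then covered by the lemma of du Bois-Reymond.
  have hparts : ∀ φ, IsTest φ → ∫ x in 0..2 * Real.pi, V x * deriv φ x =
      -∫ x in 0..2 * Real.pi, v x * φ x := by
    intro φ hφ
    have hφac : AbsolutelyContinuousOnInterval φ 0 (2 * Real.pi) :=
      (hφ.contDiff.of_le (by simp)).contDiffOn.absolutelyContinuousOnInterval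
    rw [hVac.integral_mul_deriv_eq_deriv_mul hφac, hφ.eq_zero (x := 0) (by simp),
      hφ.eq_zero (x := 2 * Real.pi) (by simp)]
    simp only [mul_zero, sub_zero, zero_sub, neg_inj]
    refine intervalIntegral.integral_congr_ae ?_
    filter_upwards [hvi.ae_hasDerivAt_integral] with x hx hxI
    rw [(hx (uIoc_subset_uIcc hxI) 0 left_mem_uIcc).deriv]
  obtain ⟨c, hc⟩ := exists_ae_eq_const (hf.sub hVi) (by
    intro φ hφ
    have h1 := h φ hφ
    rw [hφ.deriv.integral_mul, hφ.integral_mul] at h1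
    have h2 := hparts φ hφ
    have hd : ContinuousOn (deriv φ) (uIcc 0 (2 * Real.pi)) :=
      hφ.deriv.contDiff.continuous.continuousOn
    simp only [Pi.sub_apply, sub_mul]
    rw [intervalIntegral.integral_sub ((intervalIntegrable_of_integrableOn hf).mul_continuousOn hd)
      ((intervalIntegrable_of_integrableOn hVi).mul_continuousOn hd), h1, h2]
    ring)
  refine ⟨c, ?_⟩
  filter_upwards [hc] with x hx hxI
  have := hx hxI
  simp only [Pi.sub_apply] at this
  linarith

/-- Weak derivatives are unique. -/
lemma HasWeakDeriv.ae_eq {j : ℕ} {f v v' : ℝ → ℝ} (h : HasWeakDeriv j f v)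
    (h' : HasWeakDeriv j f v') : ∀ᵐ x, x ∈ Ioo 0 (2 * Real.pi) → v x = v' x := by
  have hint : ∀ w : ℝ → ℝ, LocallyIntegrableOn w (Ioo 0 (2 * Real.pi)) → ∀ φ, IsTest φ →
      Integrable (fun x => w x * φ x) := by
    intro w hw φ hφ
    have h1 : IntegrableOn (fun x => w x * φ x) (tsupport φ) :=
      (hw.integrableOn_compact_subset hφ.support hφ.compact).mul_continuousOn
        hφ.contDiff.continuous.continuousOn hφ.compact
    refine (integrableOn_iff_integrable_of_support_subset fun x hx => ?_).1 h1
    by_contra hcon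
    exact hx (by simp [image_eq_zero_of_notMem_tsupport hcon])
  have := ae_eq_zero_of_integral_test_eq_zero (h.2.1.sub h'.2.1) (by
    intro φ hφ
    have e1 := h.2.2 φ hφ.1 hφ.2 hφ.3
    have e2 := h'.2.2 φ hφ.1 hφ.2 hφ.3
    rw [e1] at e2
    have e3 := mul_left_cancel₀ (pow_ne_zero j (by norm_num)) e2
    simp only [Pi.sub_apply, sub_mul]
    rw [integral_sub (hint _ h.2.1 φ hφ) (hint _ h'.2.1 φ hφ), e3, sub_self])
  filter_upwards [this] with x hx hxI
  exact sub_eq_zero.1 (hx hxI)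

lemma HasWeakDeriv.iInf_eq {j : ℕ} {f v : ℝ → ℝ} (h : HasWeakDeriv j f v) :
    (⨅ (v : ℝ → ℝ) (_ : HasWeakDeriv j f v),
      eLpNorm v ⊤ (volume.restrict (Ioo 0 (2 * Real.pi)))) =
    eLpNorm v ⊤ (volume.restrict (Ioo 0 (2 * Real.pi))) := by
  refine le_antisymm (iInf₂_le v h) (le_iInf₂ fun v' hv' => le_of_eq ?_)
  refine eLpNorm_congr_ae ?_
  rw [Filter.EventuallyEq, ae_restrict_iff' measurableSet_Ioo]
  exact h.ae_eq hv'

/-- A chain of weak derivatives that are bounded by `M`. -/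
lemma exists_lipBall_of_weak_derivatives {M : ℝ} : ∀ (n : ℕ) (v : ℕ → ℝ → ℝ),
    (∀ j ≤ n + 1, IntegrableOn (v j) (Ioo 0 (2 * Real.pi)) ∧
      ∀ᵐ x, x ∈ Ioo 0 (2 * Real.pi) → |v j x| ≤ M) →
    (∀ j ≤ n, ∀ φ, IsTest φ → ∫ x, v j x * deriv φ x = -∫ x, v (j + 1) x * φ x) →
    ∃ F, LipBall n M F ∧ ∀ᵐ x, x ∈ Ioo 0 (2 * Real.pi) → v 0 x = F x := by
  -- An almost everywhere bound holds everywhere for the continuous representative, end points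
  -- included. Writing it as `|F| ⊔ M = M` makes it an equality of continuous functions.
  have hbound : ∀ {F w : ℝ → ℝ}, ContinuousOn F (Icc 0 (2 * Real.pi)) →
      (∀ᵐ x, x ∈ Ioo 0 (2 * Real.pi) → w x = F x) →
      (∀ᵐ x, x ∈ Ioo 0 (2 * Real.pi) → |w x| ≤ M) → ∀ x ∈ Icc 0 (2 * Real.pi), |F x| ≤ M := by
    intro F w hF hwF hw
    have h1 : ∀ᵐ x ∂(volume.restrict (Ioo 0 (2 * Real.pi))), |F x| ⊔ M = M := by
      rw [ae_restrict_iff' measurableSet_Ioo]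
      filter_upwards [hwF, hw] with x h1 h2 h3
      rw [← h1 h3]
      exact sup_of_le_right (h2 h3)
    have h2 : EqOn (fun x => |F x| ⊔ M) (fun _ => M) (Ioo 0 (2 * Real.pi)) :=
      Measure.eqOn_open_of_ae_eq h1 isOpen_Ioo
        ((hF.mono Ioo_subset_Icc_self).abs.sup continuousOn_const) continuousOn_const
    intro x hx
    have h3 : Icc 0 (2 * Real.pi) ⊆ closure (Ioo 0 (2 * Real.pi)) := by
      rw [closure_Ioo two_pi_pos.ne]
    have := (h2.of_subset_closure (hF.abs.sup continuousOn_const) continuousOn_const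
      Ioo_subset_Icc_self h3) hx
    exact le_of_sup_eq (by simpa using this)
  intro n
  induction n with
  | zero =>
    intro v hv hd
    obtain ⟨c, hc⟩ := exists_ae_eq_integral (hv 0 (by omega)).1 (hv 1 le_rfl).1 (hd 0 le_rfl)
    have hvi := intervalIntegrable_of_integrableOn (hv 1 le_rfl).1
    have hlip : ∀ x ∈ Icc 0 (2 * Real.pi), ∀ y ∈ Icc 0 (2 * Real.pi),
        |(c + ∫ z in 0..x, v 1 z) - (c + ∫ z in 0..y, v 1 z)| ≤ M * |x - y| := by
      intro x hx y hy
      have hsub : ∀ z ∈ Icc 0 (2 * Real.pi), IntervalIntegrable (v 1) volume 0 z := fun z hz =>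
        hvi.mono_set (uIcc_subset_uIcc left_mem_uIcc (by rwa [uIcc_of_le two_pi_pos.le]))
      rw [add_sub_add_left_eq_sub, intervalIntegral.integral_interval_sub_left (hsub x hx)
        (hsub y hy)]
      refine intervalIntegral.norm_integral_le_of_norm_le_const_ae (f := v 1) ?_
      have hne : ∀ᵐ z : ℝ, z ≠ 2 * Real.pi := by simp [ae_iff]
      filter_upwards [(hv 1 le_rfl).2, hne] with z hz hzne hzI
      have h1 := hzI.1
      have h2 := hzI.2
      refine hz ⟨lt_of_le_of_lt (le_inf hy.1 hx.1) h1, lt_of_le_of_ne (h2.trans ?_) hzne⟩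
      exact sup_le hy.2 hx.2
    have hcont : ContinuousOn (fun x => c + ∫ z in 0..x, v 1 z) (Icc 0 (2 * Real.pi)) := by
      have := (hvi.absolutelyContinuousOnInterval_intervalIntegral left_mem_uIcc).continuousOn
      rw [uIcc_of_le two_pi_pos.le] at this
      exact continuousOn_const.add this
    exact ⟨_, ⟨hbound hcont hc (hv 0 (by omega)).2, hlip⟩, hc⟩
  | succ n ih =>
    intro v hv hd
    obtain ⟨F', hF', hvF'⟩ := ih (fun j => v (j + 1)) (fun j hj => hv (j + 1) (by omega))
      (fun j hj => hd (j + 1) (by omega))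
    obtain ⟨c, hc⟩ := exists_ae_eq_integral (hv 0 (by omega)).1 (hv 1 (by omega)).1
      (hd 0 (by omega))
    -- Constant continuation beyond the end points gives a continuous integrand on the whole line,
    -- so the fundamental theorem of calculus applies at the end points too.
    set E : ℝ → ℝ := IccExtend two_pi_pos.le (domRestrict (Icc 0 (2 * Real.pi)) F') with hE
    have hEc : Continuous E := (continuousOn_iff_continuous_domRestrict.1 hF'.continuousOn).Icc_extend'
    have hEe : ∀ x ∈ Icc 0 (2 * Real.pi), E x = F' x := fun x hx => by
      rw [hE, IccExtend_of_mem _ _ hx]; rfl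
    have hFe : ∀ x ∈ Icc 0 (2 * Real.pi), ∫ z in 0..x, v 1 z = ∫ z in 0..x, E z := by
      intro x hx
      refine intervalIntegral.integral_congr_ae ?_
      have hne : ∀ᵐ z : ℝ, z ≠ 2 * Real.pi := by simp [ae_iff]
      filter_upwards [hvF', hne] with z hz hzne hzI
      rw [uIoc_of_le hx.1] at hzI
      have hz1 : z ≤ 2 * Real.pi := hzI.2.trans hx.2
      rw [hEe z ⟨hzI.1.le, hz1⟩]
      exact hz ⟨hzI.1, lt_of_le_of_ne hz1 hzne⟩
    have hFd : ∀ x, HasDerivAt (fun x => c + ∫ z in 0..x, E z) (E x) x := fun x =>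
      (intervalIntegral.integral_hasDerivAt_right (hEc.intervalIntegrable _ _)
        hEc.stronglyMeasurable.stronglyMeasurableAtFilter hEc.continuousAt).const_add c
    have hae : ∀ᵐ x, x ∈ Ioo 0 (2 * Real.pi) → v 0 x = c + ∫ z in 0..x, E z := by
      filter_upwards [hc] with x hx hxI
      rw [hx hxI, hFe x (Ioo_subset_Icc_self hxI)]
    refine ⟨fun x => c + ∫ z in 0..x, E z, ⟨hbound (fun x _ => (hFd x).continuousAt.continuousWithinAt)
      hae (hv 0 (by omega)).2, F', fun x hx => ?_, hF'⟩, hae⟩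
    rw [← hEe x hx]
    exact (hFd x).hasDerivWithinAt

/-- Sobolev regularity of continuous functions. -/
lemma lipBall_of_sobolevNorm_lt_top {n : ℕ} {f : ℝ → ℝ}
    (hf : ContinuousOn f (Icc 0 (2 * Real.pi))) (hfin : sobolevNorm (n + 1) f < ⊤) :
    LipBall n (sobolevNorm (n + 1) f).toReal f := by
  set M := (sobolevNorm (n + 1) f).toReal with hM
  have hle : ∀ j ≤ n + 1, (⨅ (v : ℝ → ℝ) (_ : HasWeakDeriv j f v),
      eLpNorm v ⊤ (volume.restrict (Ioo 0 (2 * Real.pi)))) ≤ sobolevNorm (n + 1) f := by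
    intro j hj
    unfold sobolevNorm
    exact Finset.single_le_sum (f := fun j => ⨅ (v : ℝ → ℝ) (_ : HasWeakDeriv j f v),
      eLpNorm v ⊤ (volume.restrict (Ioo 0 (2 * Real.pi)))) (fun _ _ => zero_le)
      (Finset.mem_range.2 (by omega))
  have hex : ∀ j, ∃ v : ℝ → ℝ, j ≤ n + 1 → HasWeakDeriv j f v := by
    intro j
    by_cases hj : j ≤ n + 1
    -- Without a weak derivative the infimum would be over the empty set, hence infinite.
    · by_contra! hcon
      have h1 := (hle j hj).trans_lt hfin
      rw [iInf_lt_iff] at h1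
      obtain ⟨v, hv⟩ := h1
      rw [iInf_lt_iff] at hv
      obtain ⟨hv, -⟩ := hv
      exact (hcon v).2 hv
    · exact ⟨0, fun h => absurd h hj⟩
  choose w hw using hex
  -- At order zero the chosen weak derivative need only equal `f` almost everywhere; `f` itself is
  -- used so that the chain starts from it.
  set v : ℕ → ℝ → ℝ := fun j => if j = 0 then f else w j with hvdef
  have hv : ∀ j ≤ n + 1, HasWeakDeriv j f (v j) := by
    intro j hj
    rcases eq_or_ne j 0 with rfl | hj0
    · have h0 := hw 0 hj
      refine ⟨h0.1, h0.1, fun φ _ _ _ => ?_⟩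
      simp [hvdef]
    · simp only [hvdef, if_neg hj0]
      exact hw j hj
  have hvb : ∀ j ≤ n + 1, IntegrableOn (v j) (Ioo 0 (2 * Real.pi)) ∧
      ∀ᵐ x, x ∈ Ioo 0 (2 * Real.pi) → |v j x| ≤ M := by
    intro j hj
    have h1 := hle j hj
    rw [(hv j hj).iInf_eq] at h1
    have hsm : AEStronglyMeasurable (v j) (volume.restrict (Ioo 0 (2 * Real.pi))) :=
      (hv j hj).2.1.aestronglyMeasurable
    have hmem : MemLp (v j) ⊤ (volume.restrict (Ioo 0 (2 * Real.pi))) :=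
      ⟨hsm, h1.trans_lt hfin⟩
    refine ⟨hmem.integrable le_top, ?_⟩
    rw [← ae_restrict_iff' measurableSet_Ioo]
    have h2 := enorm_ae_le_eLpNormEssSup (v j) (volume.restrict (Ioo 0 (2 * Real.pi)))
    filter_upwards [h2] with x hx
    rw [← eLpNorm_exponent_top] at hx
    have h3 := ENNReal.toReal_mono hfin.ne (hx.trans h1)
    simpa using h3
  obtain ⟨F, hF, hvF⟩ := exists_lipBall_of_weak_derivatives n v hvb (by
    intro j hj φ hφ
    have e1 := (hv j (by omega)).2.2 (deriv φ) hφ.deriv.1 hφ.deriv.2 hφ.deriv.3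
    have e2 := (hv (j + 1) (by omega)).2.2 φ hφ.1 hφ.2 hφ.3
    rw [← iteratedDeriv_succ', e2, pow_succ] at e1
    have hp : ((-1 : ℝ) ^ j) ≠ 0 := pow_ne_zero j (by norm_num)
    rw [mul_assoc] at e1
    have := mul_left_cancel₀ hp e1
    linarith)
  refine hF.congr ?_
  have h1 : f =ᵐ[volume.restrict (Ioo 0 (2 * Real.pi))] F := by
    rw [Filter.EventuallyEq, ae_restrict_iff' measurableSet_Ioo]
    exact hvF
  have h2 : EqOn f F (Ioo 0 (2 * Real.pi)) := Measure.eqOn_open_of_ae_eq h1 isOpen_Ioo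
    (hf.mono Ioo_subset_Icc_self) (hF.continuousOn.mono Ioo_subset_Icc_self)
  exact (h2.of_subset_closure hf hF.continuousOn Ioo_subset_Icc_self
    (by rw [closure_Ioo two_pi_pos.ne])).symm

/-- One integration by parts moves a derivative from the test function to `f`; the induction treats
the others. -/
lemma LipBall.exists_hasWeakDeriv {M : ℝ} : ∀ {j : ℕ} {f : ℝ → ℝ}, LipBall j M f →
    ∃ v : ℝ → ℝ, HasWeakDeriv j f v ∧ ∀ x ∈ Icc 0 (2 * Real.pi), |v x| ≤ M
  | 0, f, h => by
    have hl : LocallyIntegrableOn f (Ioo 0 (2 * Real.pi)) :=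
      (h.continuousOn.mono Ioo_subset_Icc_self).locallyIntegrableOn measurableSet_Ioo
    exact ⟨f, ⟨hl, hl, fun φ _ _ _ => by simp⟩, h.bound⟩
  | j + 1, f, h => by
    obtain ⟨-, f', hf', h'⟩ := id h
    obtain ⟨v, hv, hvb⟩ := h'.exists_hasWeakDeriv
    refine ⟨v, ⟨(h.continuousOn.mono Ioo_subset_Icc_self).locallyIntegrableOn measurableSet_Ioo,
      hv.2.1, fun φ h1 h2 h3 => ?_⟩, hvb⟩
    have hφ : IsTest φ := ⟨h1, h2, h3⟩
    have hψ := hφ.iteratedDeriv j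
    have e := hv.2.2 φ h1 h2 h3
    rw [hψ.integral_mul] at e
    rw [(hφ.iteratedDeriv (j + 1)).integral_mul, iteratedDeriv_succ]
    have hu : uIcc 0 (2 * Real.pi) = Icc 0 (2 * Real.pi) := uIcc_of_le two_pi_pos.le
    rw [intervalIntegral.integral_mul_deriv_eq_deriv_mul_of_hasDerivWithinAt (u' := f')
      (by rw [hu]; exact hf') (fun x _ => (hψ.hasDerivAt x).hasDerivWithinAt)
      (ContinuousOn.intervalIntegrable (by rw [hu]; exact h'.continuousOn))
      (hψ.deriv.contDiff.continuous.intervalIntegrable _ _),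
      hψ.eq_zero (x := 0) (by simp), hψ.eq_zero (x := 2 * Real.pi) (by simp), e, pow_succ]
    ring

/-- There are `m + 1` summands. The bound shows that the norms of a smooth source are finite, so
that their real values carry information. -/
lemma LipBall.sobolevNorm_le {m : ℕ} {M : ℝ} {f : ℝ → ℝ} (h : LipBall m M f) :
    sobolevNorm m f ≤ ENNReal.ofReal ((m + 1) * M) := by
  have : ∀ j ∈ Finset.range (m + 1), (⨅ (v : ℝ → ℝ) (_ : HasWeakDeriv j f v),
      eLpNorm v ⊤ (volume.restrict (Ioo 0 (2 * Real.pi)))) ≤ ENNReal.ofReal M := by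
    intro j hj
    obtain ⟨v, hv, hvb⟩ := (h.of_le (Nat.lt_succ_iff.1 (Finset.mem_range.1 hj))).exists_hasWeakDeriv
    refine (iInf₂_le v hv).trans ?_
    rw [eLpNorm_exponent_top]
    refine eLpNormEssSup_le_of_ae_bound ?_
    rw [ae_restrict_iff' measurableSet_Ioo]
    exact Filter.Eventually.of_forall fun x hx => hvb x (Ioo_subset_Icc_self hx)
  refine (Finset.sum_le_card_nsmul _ _ _ this).trans (le_of_eq ?_)
  rw [Finset.card_range, nsmul_eq_mul, ENNReal.ofReal_mul (by positivity)]
  congr 1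
  rw [← Nat.cast_succ, ENNReal.ofReal_natCast]

/-! ### Differentiation in time -/

/-- Mean value inequality for `f` minus its linear part at `x`. The rate depends only on `M`, so it
is uniform in time when applied to a family. -/
lemma LipBall.abs_slope_sub_le {M : ℝ} {f : ℝ → ℝ} (h : LipBall 1 M f) {x y : ℝ}
    (hx : x ∈ Icc 0 (2 * Real.pi)) (hy : y ∈ Icc 0 (2 * Real.pi)) (hxy : y ≠ x) :
    |slope f x y - derivWithin f (Icc 0 (2 * Real.pi)) x| ≤ M * |y - x| := by
  set f' := derivWithin f (Icc 0 (2 * Real.pi))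
  have hsub : uIcc x y ⊆ Icc 0 (2 * Real.pi) := by
    intro z hz
    exact ⟨(le_inf hx.1 hy.1).trans hz.1, hz.2.trans (sup_le hx.2 hy.2)⟩
  have key := (convex_uIcc x y).norm_image_sub_le_of_norm_hasDerivWithin_le
    (f := fun z => f z - f' x * z) (f' := fun z => f' z - f' x) (C := M * |y - x|)
    (fun z hz => (((h.hasDerivWithinAt z (hsub hz)).mono hsub).sub
      (((hasDerivWithinAt_id z _).const_mul (f' x)).congr_deriv (mul_one _))))
    (fun z hz => by
      refine (h.lipBall_derivWithin.lipschitz z (hsub hz) x hx).trans ?_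
      exact mul_le_mul_of_nonneg_left (abs_sub_left_of_mem_uIcc hz) h.nonneg)
    left_mem_uIcc right_mem_uIcc
  have hpos : 0 < |y - x| := abs_pos.2 (sub_ne_zero.2 hxy)
  refine le_of_mul_le_mul_right ?_ hpos
  have e : (slope f x y - f' x) * (y - x) = f y - f' x * y - (f x - f' x * x) := by
    rw [slope_def_field]
    have := sub_ne_zero.2 hxy
    field_simp
    ring
  rw [← abs_mul, e]
  exact key

/-- Derivatives in time and in space commute. -/
lemma hasDerivWithinAt_derivWithin {T M M' : ℝ} {u p : ℝ → ℝ → ℝ}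
    (hu : ∀ s ∈ Icc 0 T, LipBall 1 M' (u s)) (hp : ∀ s ∈ Icc 0 T, LipBall 1 M (p s))
    (hd : ∀ s ∈ Icc 0 T, ∀ x ∈ Icc 0 (2 * Real.pi),
      HasDerivWithinAt (fun r => u r x) (p s x) (Icc 0 T) s)
    {t : ℝ} (ht : t ∈ Icc 0 T) {x : ℝ} (hx : x ∈ Icc 0 (2 * Real.pi)) :
    HasDerivWithinAt (fun s => derivWithin (u s) (Icc 0 (2 * Real.pi)) x)
      (derivWithin (p t) (Icc 0 (2 * Real.pi)) x) (Icc 0 T) t := by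
  have hM := (hp t ht).nonneg
  have hne : (nhdsWithin x (Icc 0 (2 * Real.pi) \ {x})).NeBot :=
    accPt_principal_iff_nhdsWithin.1
      (uniqueDiffWithinAt_iff_accPt.1 (uniqueDiffOn_Icc_two_pi x hx))
  have hslope : ∀ y ∈ Icc 0 (2 * Real.pi), ∀ s ∈ Icc 0 T,
      HasDerivWithinAt (fun r => slope (u r) x y) (slope (p s) x y) (Icc 0 T) s := by
    intro y hy s hs
    simp only [slope_def_field]
    exact ((hd s hs y hy).sub (hd s hs x hx)).div_const _
  -- The gap between derivative and difference quotient is Lipschitz in time with a constant that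
  -- tends to zero with `y - x`. It is the limit, as `z` tends to `x`, of gaps between two
  -- quotients, whose time derivatives are controlled.
  have claim : ∀ y ∈ Icc 0 (2 * Real.pi), y ≠ x → ∀ s ∈ Icc 0 T,
      |(derivWithin (u s) (Icc 0 (2 * Real.pi)) x - slope (u s) x y) -
        (derivWithin (u t) (Icc 0 (2 * Real.pi)) x - slope (u t) x y)|
        ≤ M * |y - x| * |s - t| := by
    intro y hy hyx s hs
    have hlim : ∀ r ∈ Icc 0 T, Filter.Tendsto (fun z => slope (u r) x z)
        (nhdsWithin x (Icc 0 (2 * Real.pi) \ {x}))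
        (nhds (derivWithin (u r) (Icc 0 (2 * Real.pi)) x)) := fun r hr =>
      hasDerivWithinAt_iff_tendsto_slope.1 ((hu r hr).hasDerivWithinAt x hx)
    have hl := (((hlim s hs).sub_const (slope (u s) x y)).sub
      ((hlim t ht).sub_const (slope (u t) x y))).abs
    have hr : Filter.Tendsto (fun z => M * (|y - x| + |z - x|) * |s - t|)
        (nhdsWithin x (Icc 0 (2 * Real.pi) \ {x})) (nhds (M * (|y - x| + |x - x|) * |s - t|)) :=
      (Continuous.tendsto (by fun_prop) x).mono_left nhdsWithin_le_nhds
    rw [sub_self, abs_zero, add_zero] at hr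
    refine le_of_tendsto_of_tendsto hl hr ?_
    filter_upwards [self_mem_nhdsWithin] with z hz
    refine (convex_Icc 0 T).norm_image_sub_le_of_norm_hasDerivWithin_le
      (f := fun r => slope (u r) x z - slope (u r) x y)
      (fun r hr => (hslope z hz.1 r hr).sub (hslope y hy r hr)) (fun r hr => ?_) ht hs
    have h1 := (hp r hr).abs_slope_sub_le hx hy hyx
    have h2 := (hp r hr).abs_slope_sub_le hx hz.1 hz.2
    rw [Real.norm_eq_abs, abs_le]
    rw [abs_le] at h1 h2
    constructor <;> linarith
  rw [hasDerivWithinAt_iff_isLittleO, Asymptotics.isLittleO_iff]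
  intro c hc
  -- Three errors of size `c / 3`: the gap above, the differentiability in time of one fixed
  -- quotient, and the distance from the quotient of `p` to its derivative.
  obtain ⟨y, hy, hyx, hyc⟩ : ∃ y ∈ Icc 0 (2 * Real.pi), y ≠ x ∧ M * |y - x| < c / 3 := by
    have h1 : ∀ᶠ y in nhdsWithin x (Icc 0 (2 * Real.pi) \ {x}), M * |y - x| < c / 3 := by
      have : Filter.Tendsto (fun y => M * |y - x|) (nhdsWithin x (Icc 0 (2 * Real.pi) \ {x}))
          (nhds (M * |x - x|)) :=
        (Continuous.tendsto (by fun_prop) x).mono_left nhdsWithin_le_nhds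
      refine this.eventually_lt_const ?_
      rw [sub_self, abs_zero, mul_zero]
      positivity
    obtain ⟨y, hy1, hy2⟩ := (h1.and self_mem_nhdsWithin).exists
    exact ⟨y, hy2.1, hy2.2, hy1⟩
  have h1 := (hasDerivWithinAt_iff_isLittleO.1 (hslope y hy t ht))
  rw [Asymptotics.isLittleO_iff] at h1
  filter_upwards [h1 (show 0 < c / 3 by positivity), self_mem_nhdsWithin] with s hs hsI
  have h2 := claim y hy hyx s hsI
  have h3 := (hp t ht).abs_slope_sub_le hx hy hyx
  rw [Real.norm_eq_abs, Real.norm_eq_abs, smul_eq_mul] at hs ⊢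
  set A := |s - t|
  have hA : 0 ≤ A := abs_nonneg _
  have h3' : |(s - t) * (slope (p t) x y - derivWithin (p t) (Icc 0 (2 * Real.pi)) x)| ≤
      A * (M * |y - x|) := by
    rw [abs_mul]; exact mul_le_mul_of_nonneg_left h3 hA
  have h4 : A * (M * |y - x|) ≤ A * (c / 3) := mul_le_mul_of_nonneg_left hyc.le hA
  rw [abs_le] at *
  constructor <;> nlinarith

/-- Differentiation under the integral sign. -/
lemma hasDerivWithinAt_integral {T M a b : ℝ} (hab : a ≤ b) {f f' : ℝ → ℝ → ℝ}
    (hc : ∀ s ∈ Icc 0 T, ContinuousOn (f s) (Icc a b))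
    (hd : ∀ s ∈ Icc 0 T, ∀ x ∈ Icc a b,
      HasDerivWithinAt (fun r => f r x) (f' s x) (Icc 0 T) s)
    (hM : ∀ s ∈ Icc 0 T, ∀ x ∈ Icc a b, |f' s x| ≤ M) {t : ℝ} (ht : t ∈ Icc 0 T) :
    HasDerivWithinAt (fun s => ∫ x in a..b, f s x) (∫ x in a..b, f' t x) (Icc 0 T) t := by
  have hi : ∀ s ∈ Icc 0 T, IntervalIntegrable (f s) volume a b := fun s hs =>
    (by rw [uIcc_of_le hab]; exact hc s hs : ContinuousOn (f s) (uIcc a b)).intervalIntegrable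
  rw [hasDerivWithinAt_iff_tendsto_slope]
  have hsub : uIoc a b ⊆ Icc a b := by
    rw [uIoc_of_le hab]; exact Ioc_subset_Icc_self
  have key : Filter.Tendsto (fun s => ∫ x in a..b, slope (fun r => f r x) t s)
      (nhdsWithin t (Icc 0 T \ {t})) (nhds (∫ x in a..b, f' t x)) := by
    refine intervalIntegral.tendsto_integral_filter_of_dominated_convergence (fun _ => M)
      ?_ ?_ (by simp) ?_
    · filter_upwards [self_mem_nhdsWithin] with s hs
      simp only [slope_def_field]
      rw [uIoc_of_le hab]
      exact (((hi s hs.1).sub (hi t ht)).div_const _).1.aestronglyMeasurable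
    · filter_upwards [self_mem_nhdsWithin] with s hs
      refine Filter.Eventually.of_forall fun x hx => ?_
      have h1 := (convex_Icc 0 T).norm_image_sub_le_of_norm_hasDerivWithin_le
        (f := fun r => f r x) (fun r hr => hd r hr x (hsub hx)) (fun r hr => hM r hr x (hsub hx))
        ht hs.1
      have hpos : 0 < ‖s - t‖ := norm_pos_iff.2 (sub_ne_zero.2 hs.2)
      rw [slope_def_field, norm_div, div_le_iff₀ hpos]
      exact h1
    · refine Filter.Eventually.of_forall fun x hx => ?_
      exact hasDerivWithinAt_iff_tendsto_slope.1 (hd t ht x (hsub hx))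
  refine key.congr' ?_
  filter_upwards [self_mem_nhdsWithin] with s hs
  simp only [slope_def_field]
  rw [intervalIntegral.integral_div, intervalIntegral.integral_sub (hi s hs.1) (hi t ht)]

/-! ### Regularity of the solution -/

/-- The norms on the right hand side of the estimates. -/
noncomputable def dataNorm (k : ℕ) (T : ℝ) (g u : ℝ → ℝ → ℝ) (t : ℝ) : ℝ :=
  (sobolevNorm (k + 3) (u t)).toReal + (sobolevNorm (k + 2) (g t)).toReal +
    (sobolevNorm (k + 1) (fun x => derivWithin (fun s => g s x) (Icc 0 T) t)).toReal

/-- Smoothness on the compact rectangle makes all norms finite, so they can serve as Lipschitz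
constants. The uniform bound is needed where constants must not depend on time. -/
lemma exists_bound_source {k : ℕ} {T : ℝ} (hT : 0 < T) {g : ℝ → ℝ → ℝ}
    (hg : ContDiffOn ℝ ∞ (fun p : ℝ × ℝ => g p.1 p.2) (Icc 0 T ×ˢ Icc 0 (2 * Real.pi))) :
    (∀ t ∈ Icc 0 T, LipBall (k + 1) (sobolevNorm (k + 2) (g t)).toReal (g t) ∧
      LipBall k (sobolevNorm (k + 1)
        (fun x => derivWithin (fun s => g s x) (Icc 0 T) t)).toReal
        (fun x => derivWithin (fun s => g s x) (Icc 0 T) t) ∧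
      ∀ x ∈ Icc 0 (2 * Real.pi),
        HasDerivWithinAt (fun s => g s x) (derivWithin (fun s => g s x) (Icc 0 T) t)
          (Icc 0 T) t) ∧
    ∃ K, ∀ t ∈ Icc 0 T, (sobolevNorm (k + 2) (g t)).toReal + (sobolevNorm (k + 1)
        (fun x => derivWithin (fun s => g s x) (Icc 0 T) t)).toReal ≤ K := by
  obtain ⟨Gt, _, hGt, -, hd⟩ := exists_partial_derivatives hT hg
  obtain ⟨K, hK⟩ := exists_lipBall_of_contDiffOn_prod hT (k + 2) hg
  obtain ⟨K', hK'⟩ := exists_lipBall_of_contDiffOn_prod hT (k + 1) hGt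
  have hgt : ∀ t ∈ Icc 0 T, LipBall (k + 1) K'
      (fun x => derivWithin (fun s => g s x) (Icc 0 T) t) := fun t ht =>
    (hK' t ht).congr fun x hx =>
      ((hd t ht x hx).1.derivWithin (uniqueDiffOn_Icc hT t ht)).symm
  refine ⟨fun t ht => ⟨?_, ?_, fun x hx => (hd t ht x hx).1.differentiableWithinAt.hasDerivWithinAt⟩,
    ((k + 2 : ℕ) + 1) * K + ((k + 1 : ℕ) + 1) * K', fun t ht => add_le_add ?_ ?_⟩
  · exact lipBall_of_sobolevNorm_lt_top (hK t ht).continuousOn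
      ((hK t ht).sobolevNorm_le.trans_lt ENNReal.ofReal_lt_top)
  · exact lipBall_of_sobolevNorm_lt_top (hgt t ht).continuousOn
      ((hgt t ht).sobolevNorm_le.trans_lt ENNReal.ofReal_lt_top)
  · have h0 := (hK t ht).nonneg
    exact ENNReal.toReal_le_of_le_ofReal (by positivity) (hK t ht).sobolevNorm_le
  · have h0 := (hgt t ht).nonneg
    exact ENNReal.toReal_le_of_le_ofReal (by positivity) (hgt t ht).sobolevNorm_le

namespace IsSolution

variable {m k : ℕ} {α : ℝ → ℝ} {T : ℝ} {g u : ℝ → ℝ → ℝ}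

lemma sobolevNorm_le (h : IsSolution m α T g u) {t : ℝ} (ht : t ∈ Icc 0 T) :
    (sobolevNorm m (u t)).toReal ≤ (sobolevSupNorm m T u).toReal :=
  ENNReal.toReal_mono h.bounded.ne
    (le_iSup₂ (f := fun t (_ : t ∈ Icc 0 T) => sobolevNorm m (u t)) t ht)

lemma lipBall (h : IsSolution (k + 1) α T g u) {t : ℝ} (ht : t ∈ Icc 0 T) :
    LipBall k (sobolevNorm (k + 1) (u t)).toReal (u t) :=
  lipBall_of_sobolevNorm_lt_top (h.continuousOn t ht)
    ((le_iSup₂ (f := fun t (_ : t ∈ Icc 0 T) => sobolevNorm (k + 1) (u t)) t ht).trans_lt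
      h.bounded)

end IsSolution

/-- The first two time derivatives of the solution and their regularity in space. -/
lemma exists_time_derivatives {k : ℕ} {α : ℝ → ℝ}
    (hα : ContDiffOn ℝ ∞ α (Icc 0 (2 * Real.pi))) :
    ∃ C, 0 < C ∧ ∀ (T : ℝ) (_ : 0 < T) (g u : ℝ → ℝ → ℝ)
      (_ : ContDiffOn ℝ ∞ (fun p : ℝ × ℝ => g p.1 p.2) (Icc 0 T ×ˢ Icc 0 (2 * Real.pi)))
      (_ : IsSolution (k + 3) α T g u),
      ∃ p p' : ℝ → ℝ → ℝ, (∀ t ∈ Icc 0 T, ∀ x ∈ Icc 0 (2 * Real.pi),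
          HasDerivWithinAt (fun s => u s x) (p t x) (Icc 0 T) t ∧
          HasDerivWithinAt (fun s => p s x) (p' t x) (Icc 0 T) t) ∧
        (∀ t ∈ Icc 0 T, LipBall (k + 2) (C * dataNorm k T g u t) (u t) ∧
          LipBall (k + 1) (C * dataNorm k T g u t) (p t) ∧
          LipBall k (C * dataNorm k T g u t) (p' t)) ∧
        ∃ M, ∀ t ∈ Icc 0 T, dataNorm k T g u t ≤ M := by
  obtain ⟨K, hK⟩ := exists_lipBall_of_contDiffOn (k + 2) hα
  have hK0 := hK.nonneg
  -- Cost of one use of the equation: 1 for the source and the product constant for `α u`. Two uses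
  -- give `C₁ ^ 2`.
  set C₁ : ℝ := 1 + 2 ^ (k + 3) * K with hC₁
  have hC₁1 : 1 ≤ C₁ := by
    have : 0 ≤ 2 ^ (k + 3) * K := by positivity
    linarith
  refine ⟨C₁ ^ 2, by positivity, fun T hT g u hg hu => ?_⟩
  obtain ⟨hgs, G, hG⟩ := exists_bound_source (k := k) hT hg
  set D := dataNorm k T g u with hD
  set I := Icc 0 (2 * Real.pi) with hI
  have hDdef : ∀ t, D t = (sobolevNorm (k + 3) (u t)).toReal + (sobolevNorm (k + 2) (g t)).toReal +
    (sobolevNorm (k + 1) (fun x => derivWithin (fun s => g s x) (Icc 0 T) t)).toReal := fun t => rfl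
  have hDM : ∀ t ∈ Icc 0 T, D t ≤ (sobolevSupNorm (k + 3) T u).toReal + G := by
    intro t ht
    rw [hDdef, add_assoc]
    exact add_le_add (hu.sobolevNorm_le ht) (hG t ht)
  set M := (sobolevSupNorm (k + 3) T u).toReal + G
  have hul : ∀ t ∈ Icc 0 T, LipBall (k + 2) (sobolevNorm (k + 3) (u t)).toReal (u t) :=
    fun t ht => hu.lipBall ht
  have hD0 : ∀ t, 0 ≤ D t := fun t => by rw [hDdef]; positivity
  set p : ℝ → ℝ → ℝ := fun t x => g t x - derivWithin (fun y => α y * u t y) I x with hp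
  have hq : ∀ t ∈ Icc 0 T, LipBall (k + 2)
      (2 ^ (k + 3) * (K * (sobolevNorm (k + 3) (u t)).toReal)) (fun y => α y * u t y) :=
    fun t ht => hK.mul (hul t ht)
  have hpl : ∀ t ∈ Icc 0 T, LipBall (k + 1) (C₁ * D t) (p t) := by
    intro t ht
    refine ((hgs t ht).1.sub (hq t ht).lipBall_derivWithin).mono ?_
    have h1 : 0 ≤ (sobolevNorm (k + 3) (u t)).toReal := ENNReal.toReal_nonneg
    have h2 : 0 ≤ (sobolevNorm (k + 2) (g t)).toReal := ENNReal.toReal_nonneg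
    have h3 : 0 ≤ (sobolevNorm (k + 1)
      (fun x => derivWithin (fun s => g s x) (Icc 0 T) t)).toReal := ENNReal.toReal_nonneg
    have h4 : (sobolevNorm (k + 2) (g t)).toReal ≤ D t := by rw [hDdef]; linarith
    have h5 : (sobolevNorm (k + 3) (u t)).toReal ≤ D t := by rw [hDdef]; linarith
    calc (sobolevNorm (k + 2) (g t)).toReal +
          2 ^ (k + 3) * (K * (sobolevNorm (k + 3) (u t)).toReal)
        ≤ D t + 2 ^ (k + 3) * (K * D t) := by gcongr
      _ = C₁ * D t := by rw [hC₁]; ring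
  have hqp : ∀ t ∈ Icc 0 T, LipBall (k + 1) (2 ^ (k + 2) * (K * (C₁ * D t)))
      (fun y => α y * p t y) := fun t ht => hK.of_succ.mul (hpl t ht)
  have hup : ∀ t ∈ Icc 0 T, ∀ x ∈ I, HasDerivWithinAt (fun s => u s x) (p t x) (Icc 0 T) t :=
    fun t ht x hx => hu.equation t ht x hx
  -- The equation differentiated in time, with `u_t` in place of `u` under the space derivative.
  set p' : ℝ → ℝ → ℝ := fun t x => derivWithin (fun s => g s x) (Icc 0 T) t -
    derivWithin (fun y => α y * p t y) I x with hp'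
  have hp'l : ∀ t ∈ Icc 0 T, LipBall k (C₁ ^ 2 * D t) (p' t) := by
    intro t ht
    refine ((hgs t ht).2.1.sub (hqp t ht).lipBall_derivWithin).mono ?_
    have h1 : 0 ≤ (sobolevNorm (k + 3) (u t)).toReal := ENNReal.toReal_nonneg
    have h2 : 0 ≤ (sobolevNorm (k + 2) (g t)).toReal := ENNReal.toReal_nonneg
    have h4 : (sobolevNorm (k + 1)
      (fun x => derivWithin (fun s => g s x) (Icc 0 T) t)).toReal ≤ D t := by
      rw [hDdef]; linarith
    have h6 : D t ≤ C₁ * D t := le_mul_of_one_le_left (hD0 t) hC₁1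
    have h7 : (2 : ℝ) ^ (k + 2) ≤ 2 ^ (k + 3) := pow_le_pow_right₀ (by norm_num) (by omega)
    have h8 : 0 ≤ K * (C₁ * D t) := mul_nonneg hK0 (mul_nonneg (by linarith) (hD0 t))
    calc _ ≤ C₁ * D t + 2 ^ (k + 3) * (K * (C₁ * D t)) :=
          add_le_add (h4.trans h6) (mul_le_mul_of_nonneg_right h7 h8)
      _ = C₁ ^ 2 * D t := by rw [hC₁]; ring
  refine ⟨p, p', fun t ht x hx => ⟨hup t ht x hx, ?_⟩, fun t ht => ⟨?_, ?_, hp'l t ht⟩, M, hDM⟩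
  · refine ((hgs t ht).2.2 x hx).sub ?_
    -- Exchanging the derivatives requires constants uniform in time, hence suprema here instead of
    -- the norms at time `t`.
    refine hasDerivWithinAt_derivWithin
      (M' := 2 ^ (k + 3) * (K * (sobolevSupNorm (k + 3) T u).toReal))
      (M := 2 ^ (k + 2) * (K * (C₁ * M)))
      (u := fun s y => α y * u s y) (p := fun s y => α y * p s y) (fun s hs => ?_) (fun s hs => ?_)
      (fun s hs y hy => (hup s hs y hy).const_mul (α y)) ht hx
    · refine ((hq s hs).of_le (by omega)).mono ?_
      have := hu.sobolevNorm_le hs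
      gcongr
    · refine ((hqp s hs).of_le (by omega)).mono ?_
      have := hDM s hs
      gcongr
  · refine (hul t ht).mono ?_
    have h2 : 0 ≤ (sobolevNorm (k + 2) (g t)).toReal := ENNReal.toReal_nonneg
    have h3 : 0 ≤ (sobolevNorm (k + 1)
      (fun x => derivWithin (fun s => g s x) (Icc 0 T) t)).toReal := ENNReal.toReal_nonneg
    have h5 : (sobolevNorm (k + 3) (u t)).toReal ≤ D t := by rw [hDdef]; linarith
    have : 1 ≤ C₁ ^ 2 := one_le_pow₀ hC₁1
    exact h5.trans (le_mul_of_one_le_left (hD0 t) this)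
  · refine (hpl t ht).mono (mul_le_mul_of_nonneg_right ?_ (hD0 t))
    nlinarith

/-! ### Geometry of the grid -/

lemma sum_fin_succ_sub {n : ℕ} (F : Fin (n + 1) → ℝ) :
    ∑ j : Fin n, (F j.succ - F j.castSucc) = F (Fin.last n) - F 0 := by
  induction n with
  | zero => simp
  | succ n ih =>
    rw [Fin.sum_univ_castSucc]
    have := ih fun j => F j.castSucc
    simp only [← Fin.succ_castSucc] at this ⊢
    rw [this, Fin.succ_last, Fin.castSucc_zero]
    ring

/-- Summation by parts for a discrete primitive. -/
lemma sum_primitive_mul_sub {n : ℕ} (c : ℝ) (a F : Fin (n + 1) → ℝ) (h0 : F 0 = 0)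
    (hl : F (Fin.last n) = 0) :
    ∑ j : Fin n, (c + ∑ l ∈ Finset.univ.filter (fun l : Fin (n + 1) => l ≤ j.castSucc), a l) *
      (F j.succ - F j.castSucc) = -∑ l, a l * F l := by
  -- Abel summation. The telescoping part vanishes because `F` is zero at both ends.
  have h1 : ∀ j : Fin n,
      (c + ∑ l ∈ Finset.univ.filter (fun l : Fin (n + 1) => l ≤ j.castSucc), a l) *
        (F j.succ - F j.castSucc) =
      ((c + ∑ l ∈ Finset.univ.filter (fun l : Fin (n + 1) => l ≤ j.succ), a l) * F j.succ -
        (c + ∑ l ∈ Finset.univ.filter (fun l : Fin (n + 1) => l ≤ j.castSucc), a l) *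
          F j.castSucc) - a j.succ * F j.succ := by
    intro j
    have : Finset.univ.filter (fun l : Fin (n + 1) => l ≤ j.succ) =
        insert j.succ (Finset.univ.filter (fun l : Fin (n + 1) => l ≤ j.castSucc)) := by
      ext l
      simp only [Finset.mem_filter, Finset.mem_univ, true_and, Finset.mem_insert, Fin.le_def,
        Fin.ext_iff, Fin.val_succ, Fin.val_castSucc]
      omega
    rw [this, Finset.sum_insert (by simp [Fin.le_def])]
    ring
  rw [Finset.sum_congr rfl fun j _ => h1 j, Finset.sum_sub_distrib,
    sum_fin_succ_sub fun j => (c + ∑ l ∈ Finset.univ.filter (fun l : Fin (n + 1) => l ≤ j), a l) *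
      F j, h0, hl, Fin.sum_univ_succ, h0]
  simp

namespace Grid

variable {k N : ℕ} (G : Grid k N) (i : Fin N)

lemma left_lt_right : G.left i < G.right i := G.strictMono Fin.castSucc_lt_succ

lemma len_pos : 0 < G.len i := sub_pos.2 (G.left_lt_right i)

lemma left_nonneg : 0 ≤ G.left i := by
  rw [← G.first]; exact G.strictMono.monotone (Fin.zero_le _)

lemma right_le : G.right i ≤ 2 * Real.pi := by
  rw [← G.last]; exact G.strictMono.monotone (Fin.le_last _)

lemma Icc_subset : Icc (G.left i) (G.right i) ⊆ Icc 0 (2 * Real.pi) :=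
  Icc_subset_Icc (G.left_nonneg i) (G.right_le i)

lemma left_mem : G.left i ∈ Icc (G.left i) (G.right i) := left_mem_Icc.2 (G.left_lt_right i).le

lemma right_mem : G.right i ∈ Icc (G.left i) (G.right i) := right_mem_Icc.2 (G.left_lt_right i).le

lemma len_le_meshSize : G.len i ≤ G.meshSize := le_ciSup (finite_range G.len).bddAbove i

lemma sum_len : ∑ i, G.len i = 2 * Real.pi := by
  have := sum_fin_succ_sub G.x
  rw [G.first, G.last, sub_zero] at this
  exact this

lemma node_strictMono : StrictMono (G.node i) := by
  intro a b hab
  have := (G.part i).strictMono hab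
  have := G.len_pos i
  unfold node
  gcongr

lemma node_zero : G.node i 0 = G.left i := by
  rw [node, (G.part i).first, len]; ring

lemma node_last : G.node i (Fin.last (k + 1)) = G.right i := by
  rw [node, (G.part i).last, len]; ring

lemma node_mem (j : Fin (k + 2)) : G.node i j ∈ Icc (G.left i) (G.right i) := by
  rw [← G.node_zero, ← G.node_last]
  exact ⟨(G.node_strictMono i).monotone (Fin.zero_le _),
    (G.node_strictMono i).monotone (Fin.le_last _)⟩

lemma weight_nonneg (hk : 1 ≤ k) (j : Fin (k + 2)) : 0 ≤ G.weight i j :=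
  mul_nonneg (half_pos (G.len_pos i)).le ((G.part i).weight_nonneg hk j)

lemma sum_weight (hk : 1 ≤ k) : ∑ j, G.weight i j = G.len i := by
  unfold weight
  rw [← Finset.mul_sum, (G.part i).sum_weight hk]
  ring

lemma weight_eq_zero {j : Fin (k + 2)} (hj : j ∉ (G.part i).kind.active k) : G.weight i j = 0 := by
  rw [weight, (G.part i).weight_eq_zero hj, mul_zero]

/-- The quadrature on an element. -/
lemma integral_eq_sum_weight (hk : 1 ≤ k) (f : ℝ[X])
    (hf : f.natDegree < ((G.part i).kind.active k).card + k) :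
    ∫ x in (G.left i)..(G.right i), f.eval x = ∑ j, G.weight i j * f.eval (G.node i j) := by
  set q := f.comp (C (G.len i / 2) * X + C ((G.left i + G.right i) / 2)) with hq
  have hqd : q.degree < (((G.part i).kind.active k).card + k : ℕ) := by
    refine degree_le_natDegree.trans_lt ?_
    refine Nat.cast_lt.2 (lt_of_le_of_lt ?_ hf)
    refine natDegree_comp_le.trans ?_
    exact (Nat.mul_le_mul le_rfl natDegree_linear_le).trans (by simp)
  have h1 := (G.part i).integral_eq_sum_weight hk q hqd
  have hqe : ∀ s, q.eval s = f.eval (G.len i / 2 * s + (G.left i + G.right i) / 2) := by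
    intro s; simp [hq]
  have h2 := intervalIntegral.smul_integral_comp_mul_add
    (f := fun y => f.eval y) (a := -1) (b := 1) (G.len i / 2) ((G.left i + G.right i) / 2)
  have e1 : G.len i / 2 * -1 + (G.left i + G.right i) / 2 = G.left i := by rw [len]; ring
  have e2 : G.len i / 2 * 1 + (G.left i + G.right i) / 2 = G.right i := by rw [len]; ring
  rw [e1, e2] at h2
  rw [← h2, smul_eq_mul]
  simp only [← hqe]
  rw [h1, Finset.mul_sum]
  refine Finset.sum_congr rfl fun j _ => ?_
  rw [hqe, weight, node]
  ring

variable [NeZero N]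

lemma meshSize_pos : 0 < G.meshSize := (G.len_pos 0).trans_le (G.len_le_meshSize 0)

/-- Neighbouring elements have the same periodic end point. -/
lemma apply_left_add_one {α : ℝ → ℝ} (hper : α 0 = α (2 * Real.pi)) :
    α (G.left (i + 1)) = α (G.right i) := by
  obtain ⟨n, rfl⟩ : ∃ n, N = n + 1 := ⟨N - 1, by have := NeZero.pos N; omega⟩
  rcases eq_or_ne i (Fin.last n) with rfl | hi
  · rw [Fin.last_add_one, left, right, Fin.succ_last, G.last, Fin.castSucc_zero, G.first, hper]
  · have h : (i + 1).castSucc = i.succ := by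
      ext
      have hlt : i < Fin.last n := lt_of_le_of_ne (Fin.le_last i) hi
      rw [Fin.val_castSucc, Fin.val_add_one_of_lt hlt, Fin.val_succ]
    rw [left, right, h]

end Grid

/-! ### The pairing -/

section Pairing

variable {k N : ℕ} (G : Grid k N) (i : Fin N)

/-- The weights are nonnegative and add up to the length, so every partial quadrature sum is at most
length times bound. -/
lemma abs_star_sub_le (hk : 1 ≤ k) {p : ℝ[X]} {B : ℝ}
    (hB : ∀ x ∈ Icc (G.left i) (G.right i), |(derivative p).eval x| ≤ B) (j : Fin (k + 1)) :
    |star G i p j - p.eval (G.left i)| ≤ G.len i * B := by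
  rw [star, add_sub_cancel_left]
  refine (Finset.abs_sum_le_sum_abs _ _).trans ?_
  have hB0 : 0 ≤ B := (abs_nonneg _).trans (hB _ (G.left_mem i))
  calc ∑ l ∈ Finset.univ.filter (fun l : Fin (k + 2) => l ≤ j.castSucc),
        |G.weight i l * (derivative p).eval (G.node i l)|
      ≤ ∑ l, |G.weight i l * (derivative p).eval (G.node i l)| :=
        Finset.sum_le_univ_sum_of_nonneg fun _ => abs_nonneg _
    _ ≤ ∑ l, G.weight i l * B := by
        refine Finset.sum_le_sum fun l _ => ?_
        rw [abs_mul, abs_of_nonneg (G.weight_nonneg i hk l)]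
        exact mul_le_mul_of_nonneg_left (hB _ (G.node_mem i l)) (G.weight_nonneg i hk l)
    _ = G.len i * B := by rw [← Finset.sum_mul, G.sum_weight i hk]

lemma abs_pairing_le {f : ℝ → ℝ} {p : ℝ[X]} {S E : ℝ} (hS : ∀ j, |star G i p j| ≤ S)
    (hE : ∀ x ∈ Icc (G.left i) (G.right i), |f x| ≤ E) :
    |pairing G i f p| ≤ S * (G.len i * E) := by
  have hS0 : 0 ≤ S := (abs_nonneg _).trans (hS 0)
  have hlen : G.len i = ∑ j : Fin (k + 1), (G.node i j.succ - G.node i j.castSucc) := by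
    rw [sum_fin_succ_sub, G.node_last, G.node_zero, Grid.len]
  rw [pairing, hlen, Finset.sum_mul, Finset.mul_sum]
  refine (Finset.abs_sum_le_sum_abs _ _).trans (Finset.sum_le_sum fun j _ => ?_)
  rw [abs_mul]
  have hlt : G.node i j.castSucc < G.node i j.succ := G.node_strictMono i Fin.castSucc_lt_succ
  refine mul_le_mul (hS j) ?_ (abs_nonneg _) hS0
  have h := intervalIntegral.norm_integral_le_of_norm_le_const (C := E) (f := f)
    (a := G.node i j.castSucc) (b := G.node i j.succ) (fun x hx => by
      rw [uIoc_of_le hlt.le] at hx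
      exact hE x ⟨(G.node_mem i _).1.trans hx.1.le, hx.2.trans (G.node_mem i _).2⟩)
  rw [abs_of_pos (sub_pos.2 hlt), mul_comm] at h
  exact h

lemma intervalIntegrable_node {f : ℝ → ℝ} (hf : ContinuousOn f (Icc (G.left i) (G.right i)))
    (a b : Fin (k + 2)) : IntervalIntegrable f volume (G.node i a) (G.node i b) := by
  refine (hf.mono fun x hx => ?_).intervalIntegrable
  exact ⟨(le_inf (G.node_mem i _).1 (G.node_mem i _).1).trans hx.1,
    hx.2.trans (sup_le (G.node_mem i _).2 (G.node_mem i _).2)⟩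

lemma pairing_add {f g : ℝ → ℝ} (hf : ContinuousOn f (Icc (G.left i) (G.right i)))
    (hg : ContinuousOn g (Icc (G.left i) (G.right i))) (p : ℝ[X]) :
    pairing G i (fun x => f x + g x) p = pairing G i f p + pairing G i g p := by
  unfold pairing
  rw [← Finset.sum_add_distrib]
  refine Finset.sum_congr rfl fun j _ => ?_
  rw [intervalIntegral.integral_add (intervalIntegrable_node G i hf _ _)
    (intervalIntegrable_node G i hg _ _), mul_add]

lemma pairing_congr {f g : ℝ → ℝ} (h : EqOn f g (Icc (G.left i) (G.right i))) (p : ℝ[X]) :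
    pairing G i f p = pairing G i g p := by
  unfold pairing
  refine Finset.sum_congr rfl fun j _ => ?_
  congr 1
  refine intervalIntegral.integral_congr fun x hx => h ?_
  exact ⟨(le_inf (G.node_mem i _).1 (G.node_mem i _).1).trans hx.1,
    hx.2.trans (sup_le (G.node_mem i _).2 (G.node_mem i _).2)⟩

lemma star_add (p q : ℝ[X]) (j : Fin (k + 1)) :
    star G i (p + q) j = star G i p j + star G i q j := by
  simp only [star, eval_add, derivative_add, mul_add, Finset.sum_add_distrib]
  ring

lemma star_C (c : ℝ) (j : Fin (k + 1)) : star G i (C c) j = c := by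
  simp [star]

lemma pairing_add_right (f : ℝ → ℝ) (p q : ℝ[X]) :
    pairing G i f (p + q) = pairing G i f p + pairing G i f q := by
  simp only [pairing, star_add, add_mul, Finset.sum_add_distrib]

lemma pairing_C {f : ℝ → ℝ} (hf : ContinuousOn f (Icc (G.left i) (G.right i))) (c : ℝ) :
    pairing G i f (C c) = c * ∫ x in (G.left i)..(G.right i), f x := by
  have h : ∀ a b, IntervalIntegrable f volume (G.node i a) (G.node i b) :=
    intervalIntegrable_node G i hf
  have key := sum_fin_succ_sub fun j => ∫ x in (G.node i 0)..(G.node i j), f x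
  rw [intervalIntegral.integral_same, sub_zero] at key
  simp only [pairing, star_C, ← Finset.mul_sum]
  rw [← G.node_zero, ← G.node_last, ← key]
  congr 1
  refine Finset.sum_congr rfl fun j _ => ?_
  rw [intervalIntegral.integral_interval_sub_left (h _ _) (h _ _)]

/-- The correction equation is available only for test polynomials vanishing at the left end. The
constant part of `p` sees just the mean value of `f`. -/
lemma pairing_eq_add {f : ℝ → ℝ} (hf : ContinuousOn f (Icc (G.left i) (G.right i))) (p : ℝ[X]) :
    pairing G i f p = p.eval (G.left i) * (∫ x in (G.left i)..(G.right i), f x) +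
      pairing G i f (p - C (p.eval (G.left i))) := by
  rw [← pairing_C G i hf, ← pairing_add_right, add_sub_cancel]

end Pairing

/-! ### The correction function on one element -/

section LocalCorrection

variable {k N : ℕ}

/-- The equations of the correction function on the element `i`, with coefficient `c`, zero `z` and
right hand side `f`. -/
structure IsLocalCorrection (G : Grid k N) (i : Fin N) (c z : ℝ) (f : ℝ → ℝ) (W : ℝ[X]) :
    Prop where
  degree : W.natDegree ≤ k
  zero : W.eval z = 0
  equation : ∀ v : ℝ[X], v.natDegree ≤ k → v.eval (G.left i) = 0 →
    ∫ x in (G.left i)..(G.right i), c * W.eval x * (derivative v).eval x = pairing G i f v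

lemma IsLocalCorrection.congr {G : Grid k N} {i : Fin N} {c z : ℝ} {f g : ℝ → ℝ} {W : ℝ[X]}
    (h : IsLocalCorrection G i c z f W) (hfg : EqOn f g (Icc (G.left i) (G.right i))) :
    IsLocalCorrection G i c z g W :=
  ⟨h.degree, h.zero, fun v hv hv0 => by rw [h.equation v hv hv0, pairing_congr G i hfg]⟩

/-- Point values of the correction function in terms of the right hand side. -/
lemma exists_eval_eq_pairing (hk : 1 ≤ k) : ∃ C, 0 < C ∧ ∀ {N : ℕ} (G : Grid k N) (i : Fin N)
    (z : ℝ) (_ : z = G.left i ∨ z = G.right i) (x : ℝ), ∃ v : ℝ[X], v.natDegree ≤ k ∧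
      v.eval (G.left i) = 0 ∧
      (∀ (c : ℝ) (f : ℝ → ℝ) (W : ℝ[X]), c ≠ 0 → IsLocalCorrection G i c z f W →
        W.eval x = c⁻¹ * pairing G i f v) ∧
      (x ∈ Icc (G.left i) (G.right i) → ∀ y ∈ Icc (G.left i) (G.right i),
        G.len i * |(derivative v).eval y| ≤ C) := by
  obtain ⟨C, hC, h⟩ := exists_representer hk
  have hfin : ∀ {N : ℕ} (G : Grid k N) (i : Fin N) (z x : ℝ) (r : ℝ[X]), r.natDegree < k →
      (∀ w : ℝ[X], w.natDegree ≤ k → w.eval z = 0 →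
        w.eval x = ∫ y in (G.left i)..(G.right i), w.eval y * r.eval y) →
      (x ∈ Icc (G.left i) (G.right i) → ∀ y ∈ Icc (G.left i) (G.right i),
        G.len i * |r.eval y| ≤ C) →
      ∃ v : ℝ[X], v.natDegree ≤ k ∧
      v.eval (G.left i) = 0 ∧
      (∀ (c : ℝ) (f : ℝ → ℝ) (W : ℝ[X]), c ≠ 0 → IsLocalCorrection G i c z f W →
        W.eval x = c⁻¹ * pairing G i f v) ∧
      (x ∈ Icc (G.left i) (G.right i) → ∀ y ∈ Icc (G.left i) (G.right i),
        G.len i * |(derivative v).eval y| ≤ C) := by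
    intro N G i z x r hr hw hb
    -- The test polynomial is the primitive of the representer of the point value.
    obtain ⟨v, rfl, hv0, hvd⟩ := exists_antiderivative (G.left i) r hr
    refine ⟨v, hvd, hv0, fun c f W hc hW => ?_, hb⟩
    have h1 := hW.equation v hvd hv0
    simp only [mul_assoc] at h1
    rw [intervalIntegral.integral_const_mul, ← hw W hW.degree hW.zero] at h1
    rw [← h1, inv_mul_cancel_left₀ hc]
  refine ⟨C, hC, fun {N} G i z hz x => ?_⟩
  have hle := (G.left_lt_right i).le
  rcases hz with rfl | rfl
  -- A zero at the left end is handled on the reversed interval, whose orientation changes the sign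
  -- of the representer.
  · obtain ⟨r, hr, hw, hb⟩ := h (G.right i) (G.left i) (G.left_lt_right i).ne' x
    refine hfin G i _ x (-r) (by rwa [natDegree_neg]) (fun w hwd hw0 => ?_) ?_
    · rw [hw w hwd hw0, intervalIntegral.integral_symm, ← intervalIntegral.integral_neg]
      simp only [eval_neg, mul_neg]
    · rw [uIcc_of_ge hle, abs_sub_comm, abs_of_pos (sub_pos.2 (G.left_lt_right i))] at hb
      simp only [eval_neg, abs_neg]
      exact hb
  · obtain ⟨r, hr, hw, hb⟩ := h (G.left i) (G.right i) (G.left_lt_right i).ne x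
    rw [uIcc_of_le hle, abs_of_pos (sub_pos.2 (G.left_lt_right i))] at hb
    exact hfin G i _ x r hr hw hb

lemma IsLocalCorrection.eq (hk : 1 ≤ k) {G : Grid k N} {i : Fin N} {c z : ℝ} {f : ℝ → ℝ}
    {W W' : ℝ[X]} (h : IsLocalCorrection G i c z f W) (h' : IsLocalCorrection G i c z f W')
    (hc : c ≠ 0) (hz : z = G.left i ∨ z = G.right i) : W = W' := by
  obtain ⟨C, -, hC⟩ := exists_eval_eq_pairing hk
  refine Polynomial.funext fun x => ?_
  obtain ⟨v, -, -, hv, -⟩ := hC G i z hz x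
  rw [hv c f W hc h, hv c f W' hc h']

/-- For `v` vanishing at the left end the pairing depends only on `v'`, which may be any polynomial
of degree less than `k`. Its representer for the weight `z - y`, multiplied by that weight, has the
required zero. -/
lemma exists_isLocalCorrection (hk : 1 ≤ k) (G : Grid k N) (i : Fin N) {c z : ℝ} (hc : c ≠ 0)
    (hz : z = G.left i ∨ z = G.right i) (f : ℝ → ℝ) : ∃ W, IsLocalCorrection G i c z f W := by
  -- The pairing as a functional of `r = v'`, where the term `v(x_{i-1/2}) = 0` has been dropped.
  let l : degreeLT ℝ k →ₗ[ℝ] ℝ :=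
    { toFun := fun r => ∑ j : Fin (k + 1),
        (∑ l ∈ Finset.univ.filter (fun l : Fin (k + 2) => l ≤ j.castSucc),
          G.weight i l * (r : ℝ[X]).eval (G.node i l)) *
          ∫ x in (G.node i j.castSucc)..(G.node i j.succ), f x
      map_add' := by
        intro r s
        simp only [Submodule.coe_add, eval_add, mul_add, Finset.sum_add_distrib, add_mul]
      map_smul' := by
        intro a r
        simp only [Submodule.coe_smul, eval_smul, smul_eq_mul, RingHom.id_apply, Finset.mul_sum,
          Finset.sum_mul]
        refine Finset.sum_congr rfl fun j _ => Finset.sum_congr rfl fun l _ => ?_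
        ring }
  have hl : ∀ (v : ℝ[X]) (hv : derivative v ∈ degreeLT ℝ k), v.eval (G.left i) = 0 →
      l ⟨derivative v, hv⟩ = pairing G i f v := by
    intro v hv hv0
    simp only [l, LinearMap.coe_mk, AddHom.coe_mk, pairing, star, hv0, zero_add]
  have hdv : ∀ v : ℝ[X], v.natDegree ≤ k → derivative v ∈ degreeLT ℝ k := fun v hv => by
    rw [mem_degreeLT_iff_natDegree hk]
    have := natDegree_derivative_le v
    omega
  have hqd : ∀ (b : ℝ) (q : ℝ[X]), q.natDegree < k → ((C b - X) * q).natDegree ≤ k := by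
    intro b q hq
    refine natDegree_mul_le.trans ?_
    have : (C b - X : ℝ[X]).natDegree ≤ 1 :=
      (natDegree_sub_le _ _).trans (by simp)
    omega
  rcases hz with rfl | rfl
  · obtain ⟨q, hq, hql⟩ := exists_integral_mul_eq hk (G.left_lt_right i).ne' (-l)
    refine ⟨C c⁻¹ * ((C (G.left i) - X) * q), (natDegree_C_mul_le _ _).trans (hqd _ _ hq), by simp,
      fun v hv hv0 => ?_⟩
    have h1 := hql ⟨derivative v, hdv v hv⟩
    rw [LinearMap.neg_apply, hl v (hdv v hv) hv0, intervalIntegral.integral_symm, neg_inj] at h1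
    rw [← h1]
    refine intervalIntegral.integral_congr fun y _ => ?_
    simp only [eval_mul, eval_C, eval_sub, eval_X]
    field_simp
  · obtain ⟨q, hq, hql⟩ := exists_integral_mul_eq hk (G.left_lt_right i).ne l
    refine ⟨C c⁻¹ * ((C (G.right i) - X) * q), (natDegree_C_mul_le _ _).trans (hqd _ _ hq),
      by simp, fun v hv hv0 => ?_⟩
    have h1 := hql ⟨derivative v, hdv v hv⟩
    rw [hl v (hdv v hv) hv0] at h1
    rw [← h1]
    refine intervalIntegral.integral_congr fun y _ => ?_
    simp only [eval_mul, eval_C, eval_sub, eval_X]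
    field_simp

/-- The test polynomial that produces the point value has a derivative of size `C / d` on an element
of length `d`, so its star values are at most `C`. Only the product with `c` is controlled,
uniformly as `c` tends to zero. -/
lemma exists_localCorrection_bound (hk : 1 ≤ k) : ∃ C, 0 < C ∧ ∀ {N : ℕ} (G : Grid k N) (i : Fin N)
    {c z E : ℝ} {f : ℝ → ℝ} {W : ℝ[X]} (_ : c ≠ 0) (_ : z = G.left i ∨ z = G.right i)
    (_ : IsLocalCorrection G i c z f W) (_ : ∀ x ∈ Icc (G.left i) (G.right i), |f x| ≤ E),
    ∀ x ∈ Icc (G.left i) (G.right i), |c| * |W.eval x| ≤ C * (G.len i * E) := by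
  obtain ⟨C, hC, h⟩ := exists_eval_eq_pairing hk
  refine ⟨C, hC, fun {N} G i {c z E f W} hc hz hW hE x hx => ?_⟩
  obtain ⟨v, -, hv0, hv, hvb⟩ := h G i z hz x
  have hlen := G.len_pos i
  rw [hv c f W hc hW, abs_mul, abs_inv, mul_inv_cancel_left₀ (abs_pos.2 hc).ne']
  refine abs_pairing_le G i (fun j => ?_) hE
  have h1 := abs_star_sub_le G i hk (p := v) (B := C / G.len i) (fun y hy => by
    rw [le_div_iff₀ hlen, mul_comm]; exact hvb hx y hy) j
  rwa [hv0, sub_zero, mul_div_cancel₀ _ hlen.ne'] at h1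

/-- Differentiability of the correction function in a parameter. -/
lemma IsLocalCorrection.hasDerivWithinAt (hk : 1 ≤ k) {G : Grid k N} {i : Fin N} {c z T M : ℝ}
    {f f' : ℝ → ℝ → ℝ} {W : ℝ → ℝ[X]} {W' : ℝ[X]} {t : ℝ}
    (h : ∀ s ∈ Icc 0 T, IsLocalCorrection G i c z (f s) (W s)) (ht : t ∈ Icc 0 T)
    (h' : IsLocalCorrection G i c z (f' t) W') (hc : c ≠ 0) (hz : z = G.left i ∨ z = G.right i)
    (hf : ∀ s ∈ Icc 0 T, ContinuousOn (f s) (Icc (G.left i) (G.right i)))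
    (hd : ∀ s ∈ Icc 0 T, ∀ x ∈ Icc (G.left i) (G.right i),
      HasDerivWithinAt (fun r => f r x) (f' s x) (Icc 0 T) s)
    (hM : ∀ s ∈ Icc 0 T, ∀ x ∈ Icc (G.left i) (G.right i), |f' s x| ≤ M) (x : ℝ) :
    HasDerivWithinAt (fun s => (W s).eval x) (W'.eval x) (Icc 0 T) t := by
  obtain ⟨C, -, hC⟩ := exists_eval_eq_pairing hk
  -- `v` depends on neither the right hand side nor time, so only the integrals of `f s` have to be
  -- differentiated.
  obtain ⟨v, -, -, hv, -⟩ := hC G i z hz x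
  rw [hv c (f' t) W' hc h']
  refine HasDerivWithinAt.congr (f := fun s => c⁻¹ * pairing G i (f s) v) ?_
    (fun s hs => hv c (f s) (W s) hc (h s hs)) (hv c (f t) (W t) hc (h t ht))
  refine HasDerivWithinAt.const_mul _ ?_
  unfold pairing
  refine HasDerivWithinAt.fun_sum fun j _ => HasDerivWithinAt.const_mul _ ?_
  have hsub : Icc (G.node i j.castSucc) (G.node i j.succ) ⊆ Icc (G.left i) (G.right i) :=
    Icc_subset_Icc (G.node_mem i _).1 (G.node_mem i _).2
  exact hasDerivWithinAt_integral (G.node_strictMono i Fin.castSucc_lt_succ).le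
    (fun s hs => (hf s hs).mono hsub) (fun s hs y hy => hd s hs y (hsub hy))
    (fun s hs y hy => hM s hs y (hsub hy)) ht

end LocalCorrection

/-! ### The three kinds of elements -/

section Cases

variable {k N : ℕ} (α : ℝ → ℝ) (G : Grid k N) (i : Fin N)

lemma elemCase_positive_iff :
    elemCase α G i = .positive ↔ 0 ≤ α (G.left i) ∧ 0 < α (G.right i) := by
  unfold elemCase
  split_ifs <;> simp_all

lemma elemCase_negative_iff :
    elemCase α G i = .negative ↔ α (G.left i) ≤ 0 ∧ α (G.right i) < 0 := by
  unfold elemCase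
  split_ifs with h1 h2
  · simp only [false_iff, not_and, not_lt]
    exact fun _ => h1.2.le
  · simp [h2]
  · simp only [false_iff]
    exact h2

lemma ElemCase.card_stencil (c : ElemCase) : (c.stencil k).card = k + 1 := by
  cases c
  · have : (ElemCase.stencil k .positive) = (Finset.univ : Finset (Fin (k + 2))).erase 0 := by
      ext j; simp [ElemCase.stencil]
    rw [this, Finset.card_erase_of_mem] <;> simp
  · have : (ElemCase.stencil k .negative) =
        (Finset.univ : Finset (Fin (k + 2))).erase (Fin.last (k + 1)) := by
      ext j; simp [ElemCase.stencil]
    rw [this, Finset.card_erase_of_mem] <;> simp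
  · have : (ElemCase.stencil k .mixed) =
        (Finset.univ : Finset (Fin (k + 2))).erase ⟨k, by omega⟩ := by
      ext j; simp [ElemCase.stencil, Fin.ext_iff]
    rw [this, Finset.card_erase_of_mem] <;> simp

variable {α}

lemma le_alphaMax (hα : ContinuousOn α (Icc 0 (2 * Real.pi)))
    {x : ℝ} (hx : x ∈ Icc (G.left i) (G.right i)) : |α x| ≤ alphaMax α G i := by
  refine le_csSup ?_ ⟨x, hx, rfl⟩
  exact (isCompact_Icc.image_of_continuousOn
    ((hα.mono (G.Icc_subset i)).abs)).bddAbove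

lemma alphaMax_nonneg (hα : ContinuousOn α (Icc 0 (2 * Real.pi))) :
     0 ≤ alphaMax α G i :=
  (abs_nonneg _).trans (le_alphaMax G i hα (G.left_mem i))

lemma exists_alphaMax_eq (hα : ContinuousOn α (Icc 0 (2 * Real.pi))) :
     ∃ x ∈ Icc (G.left i) (G.right i), alphaMax α G i = |α x| := by
  obtain ⟨x, hx, h⟩ := isCompact_Icc.exists_sSup_image_eq
    ⟨_, G.left_mem i⟩ ((hα.mono (G.Icc_subset i)).abs)
  exact ⟨x, hx, h⟩

/-- This factor of the weight compensates the division by `ᾱ` in the correction. -/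
lemma sqrt_alphaSq_le (hα : ContinuousOn α (Icc 0 (2 * Real.pi))) :
     √(alphaSq α G i) ≤ 2 * alphaMax α G i := by
  have h0 := alphaMax_nonneg G i hα
  refine Real.sqrt_le_iff.2 ⟨by linarith, ?_⟩
  have h1 := sq_le_sq' (by linarith [abs_nonneg (α (G.left i))]) (le_alphaMax G i hα (G.left_mem i))
  have h2 := sq_le_sq' (by linarith [abs_nonneg (α (G.right i))])
    (le_alphaMax G i hα (G.right_mem i))
  rw [sq_abs] at h1 h2
  unfold alphaSq
  nlinarith

end Cases

/-- The equations of the correction function on the element `i` with right hand side `f`. -/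
def CorrectionOn {k N : ℕ} (α : ℝ → ℝ) (G : Grid k N) (i : Fin N) (f : ℝ → ℝ) (W : ℝ[X]) : Prop :=
  (elemCase α G i = .positive → IsLocalCorrection G i (alphaMax α G i) (G.right i) f W) ∧
  (elemCase α G i = .negative → IsLocalCorrection G i (-alphaMax α G i) (G.left i) f W) ∧
  (elemCase α G i = .mixed → W = 0)

namespace CorrectionOn

variable {k N : ℕ} {α : ℝ → ℝ} {G : Grid k N} {i : Fin N} {f : ℝ → ℝ} {W : ℝ[X]}

lemma congr {g : ℝ → ℝ} (h : CorrectionOn α G i f W)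
    (hfg : EqOn f g (Icc (G.left i) (G.right i))) : CorrectionOn α G i g W :=
  ⟨fun hc => (h.1 hc).congr hfg, fun hc => (h.2.1 hc).congr hfg, h.2.2⟩

/-- On positive and negative elements `α` is nonzero at the right end, so the coefficient `±ᾱ` is
nonzero. -/
lemma cases (h : CorrectionOn α G i f W) (hα : ContinuousOn α (Icc 0 (2 * Real.pi))) :
    W = 0 ∨ ∃ c z, |c| = alphaMax α G i ∧ c ≠ 0 ∧ (z = G.left i ∨ z = G.right i) ∧
      IsLocalCorrection G i c z f W := by
  have h0 := alphaMax_nonneg G i hα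
  cases hc : elemCase α G i with
  | positive =>
    have h1 := ((elemCase_positive_iff α G i).1 hc).2
    have h2 := le_alphaMax G i hα (G.right_mem i)
    exact Or.inr ⟨_, _, abs_of_nonneg h0, ((abs_pos.2 h1.ne').trans_le h2).ne', Or.inr rfl,
      h.1 hc⟩
  | negative =>
    have h1 := ((elemCase_negative_iff α G i).1 hc).2
    have h2 := le_alphaMax G i hα (G.right_mem i)
    exact Or.inr ⟨_, _, by rw [abs_neg, abs_of_nonneg h0],
      neg_ne_zero.2 ((abs_pos.2 h1.ne).trans_le h2).ne', Or.inl rfl, h.2.1 hc⟩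
  | mixed => exact Or.inl (h.2.2 hc)

end CorrectionOn

lemma exists_correctionOn {k N : ℕ} (hk : 1 ≤ k) {α : ℝ → ℝ}
    (hα : ContinuousOn α (Icc 0 (2 * Real.pi))) (G : Grid k N) (i : Fin N) (f : ℝ → ℝ) :
    ∃! W, CorrectionOn α G i f W := by
  cases hc : elemCase α G i with
  | positive =>
    have h1 := ((elemCase_positive_iff α G i).1 hc).2
    have h2 := le_alphaMax G i hα (G.right_mem i)
    have h3 := ((abs_pos.2 h1.ne').trans_le h2).ne'
    obtain ⟨W, hW⟩ := exists_isLocalCorrection hk G i h3 (Or.inr rfl) f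
    exact ⟨W, ⟨fun _ => hW, by simp [hc], by simp [hc]⟩,
      fun W' hW' => (hW'.1 hc).eq hk hW h3 (Or.inr rfl)⟩
  | negative =>
    have h1 := ((elemCase_negative_iff α G i).1 hc).2
    have h2 := le_alphaMax G i hα (G.right_mem i)
    have h3 := neg_ne_zero.2 ((abs_pos.2 h1.ne).trans_le h2).ne'
    obtain ⟨W, hW⟩ := exists_isLocalCorrection hk G i h3 (Or.inl rfl) f
    exact ⟨W, ⟨by simp [hc], fun _ => hW, by simp [hc]⟩,
      fun W' hW' => (hW'.2.1 hc).eq hk hW h3 (Or.inl rfl)⟩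
  | mixed =>
    exact ⟨0, ⟨by simp [hc], by simp [hc], fun _ => rfl⟩, fun W' hW' => hW'.2.2 hc⟩

lemma exists_correctionOn_bound {k : ℕ} (hk : 1 ≤ k) {α : ℝ → ℝ}
    (hα : ContinuousOn α (Icc 0 (2 * Real.pi))) :
    ∃ C, 0 < C ∧ ∀ {N : ℕ} (G : Grid k N) (i : Fin N)
    {E : ℝ} {f : ℝ → ℝ} {W : ℝ[X]} (_ : CorrectionOn α G i f W)
    (_ : ∀ x ∈ Icc (G.left i) (G.right i), |f x| ≤ E),
    ∀ x ∈ Icc (G.left i) (G.right i), alphaMax α G i * |W.eval x| ≤ C * (G.len i * E) := by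
  obtain ⟨C, hC, h⟩ := exists_localCorrection_bound hk
  refine ⟨C, hC, fun {N} G i {E f W} hW hE x hx => ?_⟩
  have hlen := G.len_pos i
  rcases hW.cases hα with rfl | ⟨c, z, hcα, hc, hz, hloc⟩
  · have : 0 ≤ E := (abs_nonneg _).trans (hE x hx)
    simp only [eval_zero, abs_zero, mul_zero]
    positivity
  · rw [← hcα]
    exact h G i hc hz hloc hE x hx

lemma isCorrection_iff {k N : ℕ} [NeZero N] {α : ℝ → ℝ} {G : Grid k N} {T : ℝ} {u : ℝ → ℝ → ℝ}
    {t : ℝ} {W : Fin N → ℝ[X]} : IsCorrection α G T u t W ↔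
      ∀ i, CorrectionOn α G i (timeDeriv T (interpError α G u) t i) (W i) := by
  constructor
  · intro h i
    exact ⟨fun hc => ⟨h.degree i, (h.positive i hc).1, (h.positive i hc).2⟩,
      fun hc => ⟨h.degree i, (h.negative i hc).1, (h.negative i hc).2⟩, h.mixed i⟩
  · intro h
    refine ⟨fun i => ?_, fun i hc => ⟨((h i).1 hc).zero, ((h i).1 hc).equation⟩,
      fun i hc => ⟨((h i).2.1 hc).zero, ((h i).2.1 hc).equation⟩, fun i hc => (h i).2.2 hc⟩
    cases hc : elemCase α G i with
    | positive => exact ((h i).1 hc).degree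
    | negative => exact ((h i).2.1 hc).degree
    | mixed => rw [(h i).2.2 hc]; simp

/-! ### The interpolation error -/

section InterpolationError

lemma natDegree_interpolate_le {ι : Type*} [DecidableEq ι] {s : Finset ι} {n : ℕ}
    (hs : s.card = n + 1) {v : ι → ℝ} (hv : Set.InjOn v s) (r : ι → ℝ) :
    (Lagrange.interpolate s v r).natDegree ≤ n := by
  have h := Lagrange.degree_interpolate_lt r hv
  rw [hs] at h
  exact natDegree_le_iff_coeff_eq_zero.2 fun m hm =>
    coeff_eq_zero_of_degree_lt (h.trans_le (by exact_mod_cast hm))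

variable {k N : ℕ} (α : ℝ → ℝ) (G : Grid k N) (i : Fin N)

/-- The interpolation error of `f` on the element `i`. -/
noncomputable def interpErr (f : ℝ → ℝ) (x : ℝ) : ℝ := f x - (interp α G f i).eval x

lemma natDegree_interp_le (f : ℝ → ℝ) : (interp α G f i).natDegree ≤ k :=
  natDegree_interpolate_le (ElemCase.card_stencil _) (G.node_strictMono i).injective.injOn _

lemma interpErr_node (f : ℝ → ℝ) {j : Fin (k + 2)} (hj : j ∈ (elemCase α G i).stencil k) :
    interpErr α G i f (G.node i j) = 0 := by
  rw [interpErr, interp, Lagrange.eval_interpolate_at_node _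
    (G.node_strictMono i).injective.injOn hj, sub_self]

variable {M : ℝ} {f : ℝ → ℝ}

lemma abs_interpErr_le (hf : LipBall k M f) {x : ℝ} (hx : x ∈ Icc (G.left i) (G.right i)) :
    |interpErr α G i f x| ≤ M * G.len i ^ (k + 1) :=
  hf.abs_sub_interpolate_le (ElemCase.card_stencil _) (G.node_strictMono i).injective.injOn
    (G.left_nonneg i) (G.right_le i) (fun j _ => G.node_mem i j) hx

lemma continuousOn_interpErr (hf : ContinuousOn f (Icc 0 (2 * Real.pi))) :
    ContinuousOn (interpErr α G i f) (Icc (G.left i) (G.right i)) :=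
  (hf.mono (G.Icc_subset i)).sub (interp α G f i).continuous.continuousOn

lemma hasDerivWithinAt_interpErr {T t x : ℝ} {p p' : ℝ → ℝ → ℝ}
    (h : ∀ x ∈ Icc 0 (2 * Real.pi), HasDerivWithinAt (fun s => p s x) (p' t x) (Icc 0 T) t)
    (hx : x ∈ Icc (G.left i) (G.right i)) :
    HasDerivWithinAt (fun s => interpErr α G i (p s) x) (interpErr α G i (p' t) x) (Icc 0 T) t := by
  unfold interpErr interp
  simp only [Lagrange.interpolate_apply, eval_finsetSum, eval_mul, eval_C]
  exact (h x (G.Icc_subset i hx)).sub (HasDerivWithinAt.fun_sum fun j _ =>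
    (h _ (G.Icc_subset i (G.node_mem i j))).mul_const _)

/-- Superconvergence of the mean value of the interpolation error. -/
lemma abs_integral_interpErr_le (hk : 1 ≤ k) (hf : LipBall (k + 1) M f)
    (hact : (G.part i).kind.active k ⊆ (elemCase α G i).stencil k)
    (hcard : 2 ≤ ((G.part i).kind.active k).card) :
    |∫ x in (G.left i)..(G.right i), interpErr α G i f x| ≤ M * G.len i ^ (k + 3) := by
  classical
  have hinj : Function.Injective (G.node i) := (G.node_strictMono i).injective
  -- Interpolation at all `k + 2` nodes has one more order of accuracy. The quadrature cannot
  -- distinguish it from `I_h f`, since they agree at the quadrature points, and two such points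
  -- make the rule exact in degree `k + 1`.
  set τ := Lagrange.interpolate Finset.univ (G.node i) fun j => f (G.node i j) with hτ
  have hτd : τ.natDegree ≤ k + 1 := natDegree_interpolate_le (by simp) hinj.injOn _
  have hle := (G.left_lt_right i).le
  have hfi : IntervalIntegrable f volume (G.left i) (G.right i) := by
    refine ContinuousOn.intervalIntegrable ?_
    rw [uIcc_of_le hle]
    exact hf.continuousOn.mono (G.Icc_subset i)
  have e1 := G.integral_eq_sum_weight i hk τ (by omega)
  have e2 := G.integral_eq_sum_weight i hk (interp α G f i)
    (lt_of_le_of_lt (natDegree_interp_le α G i f) (by omega))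
  have e3 : ∑ j, G.weight i j * τ.eval (G.node i j) =
      ∑ j, G.weight i j * (interp α G f i).eval (G.node i j) := by
    refine Finset.sum_congr rfl fun j _ => ?_
    by_cases hj : j ∈ (G.part i).kind.active k
    · rw [hτ, Lagrange.eval_interpolate_at_node _ hinj.injOn (Finset.mem_univ j)]
      have := interpErr_node α G i f (hact hj)
      rw [interpErr, sub_eq_zero] at this
      rw [← this]
    · rw [G.weight_eq_zero i hj, zero_mul, zero_mul]
  have e4 : ∫ x in (G.left i)..(G.right i), interpErr α G i f x =
      ∫ x in (G.left i)..(G.right i), (f x - τ.eval x) := by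
    unfold interpErr
    rw [intervalIntegral.integral_sub hfi (intervalIntegrable_eval _ _ _),
      intervalIntegral.integral_sub hfi (intervalIntegrable_eval _ _ _), e1, e2, e3]
  rw [e4]
  have h := intervalIntegral.norm_integral_le_of_norm_le_const (C := M * G.len i ^ (k + 2))
    (f := fun x => f x - τ.eval x) (a := G.left i) (b := G.right i) (fun x hx => by
      rw [uIoc_of_le hle] at hx
      exact hf.abs_sub_interpolate_le (s := Finset.univ) (by simp) hinj.injOn (G.left_nonneg i)
        (G.right_le i) (fun j _ => G.node_mem i j) (Ioc_subset_Icc_self hx))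
  rw [abs_of_pos (sub_pos.2 (G.left_lt_right i))] at h
  refine h.trans (le_of_eq ?_)
  rw [← Grid.len]
  ring

end InterpolationError

/-! ### Estimates on one element -/

section Element

variable {k N : ℕ} {α : ℝ → ℝ} (G : Grid k N) (i : Fin N)

lemma pairing_const_mul (c : ℝ) (f : ℝ → ℝ) (p : ℝ[X]) :
    pairing G i (fun x => c * f x) p = c * pairing G i f p := by
  simp only [pairing, intervalIntegral.integral_const_mul, Finset.mul_sum, mul_left_comm]

lemma abs_star_le (hk : 1 ≤ k) {p : ℝ[X]} {P : ℝ}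
    (hP : ∀ x ∈ Icc (G.left i) (G.right i), |p.eval x| ≤ P)
    (hP' : ∀ x ∈ Icc (G.left i) (G.right i), G.len i * |(derivative p).eval x| ≤ P)
    (j : Fin (k + 1)) : |star G i p j| ≤ 2 * P := by
  have hlen := G.len_pos i
  have h1 := abs_star_sub_le G i hk (p := p) (B := P / G.len i) (fun y hy => by
    rw [le_div_iff₀ hlen, mul_comm]; exact hP' y hy) j
  rw [mul_div_cancel₀ _ hlen.ne'] at h1
  have h2 := hP _ (G.left_mem i)
  rw [abs_le] at *
  constructor <;> linarith

lemma abs_sum_weight_le (hk : 1 ≤ k) {p : ℝ[X]} {P B : ℝ} {b : Fin (k + 2) → ℝ}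
    (hP' : ∀ x ∈ Icc (G.left i) (G.right i), G.len i * |(derivative p).eval x| ≤ P)
    (hb : ∀ j, |b j| ≤ B) :
    |∑ j, G.weight i j * (derivative p).eval (G.node i j) * b j| ≤ P * B := by
  have hlen := G.len_pos i
  have hB : 0 ≤ B := (abs_nonneg _).trans (hb 0)
  calc _ ≤ ∑ j, G.weight i j * (P / G.len i) * B := by
        refine (Finset.abs_sum_le_sum_abs _ _).trans (Finset.sum_le_sum fun j _ => ?_)
        have hw := G.weight_nonneg i hk j
        have h1 : |(derivative p).eval (G.node i j)| ≤ P / G.len i := by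
          rw [le_div_iff₀ hlen, mul_comm]; exact hP' _ (G.node_mem i j)
        rw [abs_mul, abs_mul, abs_of_nonneg hw]
        have h2 := mul_nonneg hw ((abs_nonneg _).trans h1)
        have := hb j
        gcongr
    _ = P * B := by
        rw [← Finset.sum_mul, ← Finset.sum_mul, G.sum_weight i hk, mul_div_cancel₀ _ hlen.ne']

/-- The estimate on elements where `|α|` is at most of the order of the mesh size. -/
lemma abs_form_le_of_small (hk : 1 ≤ k) (hα : ContinuousOn α (Icc 0 (2 * Real.pi)))
    {Λ C₁ E P : ℝ} (hΛ0 : 0 ≤ Λ) (hC₁ : 0 ≤ C₁)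
    (hΛ : alphaMax α G i ≤ Λ * G.len i) {e₀ e₁ : ℝ → ℝ} {W W' p : ℝ[X]} {F : Fin (k + 2) → ℝ}
    (h0 : F 0 = 0) (hl : F (Fin.last (k + 1)) = 0)
    (hF : ∀ j, j ≠ 0 → j ≠ Fin.last (k + 1) →
      F j = α (G.node i j) * (e₀ (G.node i j) + W.eval (G.node i j)))
    (he₀ : ∀ x ∈ Icc (G.left i) (G.right i), |e₀ x| ≤ E)
    (he₁ : ∀ x ∈ Icc (G.left i) (G.right i), |e₁ x| ≤ E)
    (hW : ∀ x ∈ Icc (G.left i) (G.right i), alphaMax α G i * |W.eval x| ≤ C₁ * (G.len i * E))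
    (hW' : ∀ x ∈ Icc (G.left i) (G.right i), alphaMax α G i * |W'.eval x| ≤ C₁ * (G.len i * E))
    (hP : ∀ x ∈ Icc (G.left i) (G.right i), |p.eval x| ≤ P)
    (hP' : ∀ x ∈ Icc (G.left i) (G.right i), G.len i * |(derivative p).eval x| ≤ P) :
    alphaMax α G i * |pairing G i e₁ p + pairing G i (fun x => W'.eval x) p -
      ∑ j, G.weight i j * (derivative p).eval (G.node i j) * F j| ≤
      (2 * Λ + 2 * C₁ + Λ * (Λ + C₁)) * (G.len i ^ 2 * E * P) := by
  set A := alphaMax α G i with hA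
  set d := G.len i with hd
  have hlen : 0 < d := G.len_pos i
  have hA0 : 0 ≤ A := alphaMax_nonneg G i hα
  have hE0 : 0 ≤ E := (abs_nonneg _).trans (he₀ _ (G.left_mem i))
  have hP0 : 0 ≤ P := (abs_nonneg _).trans (hP _ (G.left_mem i))
  have hstar := abs_star_le G i hk hP hP'
  have b1 : |pairing G i e₁ p| ≤ 2 * P * (d * E) := abs_pairing_le G i hstar he₁
  -- `A` is moved inside the pairing because only `A W'` is bounded, not `W'`.
  have b2 : A * |pairing G i (fun x => W'.eval x) p| ≤ 2 * P * (d * (C₁ * (d * E))) := by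
    rw [← abs_of_nonneg hA0, ← abs_mul, ← pairing_const_mul]
    refine abs_pairing_le G i hstar fun x hx => ?_
    rw [abs_mul, abs_of_nonneg hA0]
    exact hW' x hx
  have b3 : |∑ j, G.weight i j * (derivative p).eval (G.node i j) * F j| ≤
      P * ((Λ + C₁) * (d * E)) := by
    refine abs_sum_weight_le G i hk hP' fun j => ?_
    have hnn : 0 ≤ (Λ + C₁) * (d * E) := by positivity
    by_cases hj0 : j = 0
    · rw [hj0, h0, abs_zero]; exact hnn
    by_cases hjl : j = Fin.last (k + 1)
    · rw [hjl, hl, abs_zero]; exact hnn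
    rw [hF j hj0 hjl, abs_mul]
    have hm := G.node_mem i j
    calc |α (G.node i j)| * |e₀ (G.node i j) + W.eval (G.node i j)|
        ≤ A * (|e₀ (G.node i j)| + |W.eval (G.node i j)|) :=
          mul_le_mul (le_alphaMax G i hα hm) (abs_add_le _ _) (abs_nonneg _) hA0
      _ = A * |e₀ (G.node i j)| + A * |W.eval (G.node i j)| := mul_add _ _ _
      _ ≤ (Λ * d) * E + C₁ * (d * E) :=
          add_le_add (mul_le_mul hΛ (he₀ _ hm) (abs_nonneg _) (by positivity)) (hW _ hm)
      _ = _ := by ring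
  set X := pairing G i e₁ p
  set Y := pairing G i (fun x => W'.eval x) p
  set Z := ∑ j, G.weight i j * (derivative p).eval (G.node i j) * F j
  -- Smallness of `A` gives one extra power of the length here and in `b5`.
  have b4 : A * |X| ≤ Λ * d * (2 * P * (d * E)) :=
    mul_le_mul hΛ b1 (abs_nonneg _) (by positivity)
  have b5 : A * |Z| ≤ Λ * d * (P * ((Λ + C₁) * (d * E))) :=
    mul_le_mul hΛ b3 (abs_nonneg _) (by positivity)
  calc A * |X + Y - Z| ≤ A * (|X| + |Y| + |Z|) := by
        refine mul_le_mul_of_nonneg_left ?_ hA0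
        exact (abs_sub _ _).trans (add_le_add_left (abs_add_le _ _) _)
    _ = A * |X| + A * |Y| + A * |Z| := by ring
    _ ≤ _ := add_le_add (add_le_add b4 b2) b5
    _ = _ := by ring

/-- The estimate on elements where `α` does not change sign. -/
lemma abs_form_le_of_sign (hk : 1 ≤ k) (hα : ContinuousOn α (Icc 0 (2 * Real.pi)))
    {Λ C₁ E J P c z : ℝ}
    (hΛ : alphaMax α G i ≤ Λ) {e₁ : ℝ → ℝ} {W W' p : ℝ[X]} {F : Fin (k + 2) → ℝ}
    (hloc : IsLocalCorrection G i c z e₁ W)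
    (hcα : ∀ x ∈ Icc (G.left i) (G.right i), |c - α x| ≤ 2 * Λ * G.len i)
    (hF : ∀ j ∈ (G.part i).kind.active k, F j = α (G.node i j) * W.eval (G.node i j))
    (he₁c : ContinuousOn e₁ (Icc (G.left i) (G.right i)))
    (he₁ : |∫ x in (G.left i)..(G.right i), e₁ x| ≤ J)
    (hW : ∀ x ∈ Icc (G.left i) (G.right i), alphaMax α G i * |W.eval x| ≤ C₁ * (G.len i * E))
    (hW' : ∀ x ∈ Icc (G.left i) (G.right i), alphaMax α G i * |W'.eval x| ≤ C₁ * (G.len i * E))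
    (hp : p.natDegree ≤ k)
    (hP : ∀ x ∈ Icc (G.left i) (G.right i), |p.eval x| ≤ P)
    (hP' : ∀ x ∈ Icc (G.left i) (G.right i), G.len i * |(derivative p).eval x| ≤ P) :
    alphaMax α G i * |pairing G i e₁ p + pairing G i (fun x => W'.eval x) p -
      ∑ j, G.weight i j * (derivative p).eval (G.node i j) * F j| ≤
      Λ * (P * J) + (2 * C₁ + 2 * Λ * C₁) * (G.len i ^ 2 * E * P) := by
  set A := alphaMax α G i with hA
  set d := G.len i with hd
  have hlen : 0 < d := G.len_pos i
  have hA0 : 0 ≤ A := alphaMax_nonneg G i hα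
  have hΛ0 : 0 ≤ Λ := hA0.trans hΛ
  have hP0 : 0 ≤ P := (abs_nonneg _).trans (hP _ (G.left_mem i))
  have hstar := abs_star_le G i hk hP hP'
  have b2 : A * |pairing G i (fun x => W'.eval x) p| ≤ 2 * P * (d * (C₁ * (d * E))) := by
    rw [← abs_of_nonneg hA0, ← abs_mul, ← pairing_const_mul]
    refine abs_pairing_le G i hstar fun x hx => ?_
    rw [abs_mul, abs_of_nonneg hA0]
    exact hW' x hx
  -- Normalised to vanish at the left end, `p` is admissible in the correction equation, and its
  -- derivative is unchanged.
  have hcorr := hloc.equation (p - C (p.eval (G.left i)))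
    ((natDegree_sub_C).le.trans hp) (by simp)
  rw [derivative_sub, derivative_C, sub_zero] at hcorr
  -- The integrand has degree at most `2k - 1`, for which even the `k`-point rule is exact.
  have hquad := G.integral_eq_sum_weight i hk (C c * W * derivative p) (by
    have h1 := natDegree_derivative_le p
    have h2 := hloc.degree
    have h3 : (C c * W).natDegree ≤ W.natDegree := natDegree_C_mul_le _ _
    have h4 : (C c * W * derivative p).natDegree ≤ (C c * W).natDegree + (derivative p).natDegree :=
      natDegree_mul_le
    have h5 := (G.part i).kind.card_active k
    omega)
  simp only [eval_mul, eval_C] at hquad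
  rw [hquad] at hcorr
  have hX := pairing_eq_add G i he₁c p
  rw [← hcorr] at hX
  -- Only quadrature points carry weight, so `F` may be replaced by `α W` throughout; what remains
  -- is the small factor `c - α`.
  have hdiff : (∑ j, G.weight i j * (c * W.eval (G.node i j) * (derivative p).eval (G.node i j))) -
      ∑ j, G.weight i j * (derivative p).eval (G.node i j) * F j =
      ∑ j, G.weight i j * (derivative p).eval (G.node i j) *
        ((c - α (G.node i j)) * W.eval (G.node i j)) := by
    rw [← Finset.sum_sub_distrib]
    refine Finset.sum_congr rfl fun j _ => ?_
    by_cases hj : j ∈ (G.part i).kind.active k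
    · rw [hF j hj]; ring
    · rw [G.weight_eq_zero i hj]; ring
  have b3 : A * |∑ j, G.weight i j * (derivative p).eval (G.node i j) *
        ((c - α (G.node i j)) * W.eval (G.node i j))| ≤
      P * (2 * Λ * d * (C₁ * (d * E))) := by
    rw [← abs_of_nonneg hA0, ← abs_mul, Finset.mul_sum]
    have : ∀ j, A * (G.weight i j * (derivative p).eval (G.node i j) *
        ((c - α (G.node i j)) * W.eval (G.node i j))) =
        G.weight i j * (derivative p).eval (G.node i j) *
        (A * ((c - α (G.node i j)) * W.eval (G.node i j))) := fun j => by ring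
    simp only [this]
    refine abs_sum_weight_le G i hk hP' fun j => ?_
    have hm := G.node_mem i j
    rw [abs_mul, abs_mul, abs_of_nonneg hA0, mul_left_comm]
    exact mul_le_mul (hcα _ hm) (hW _ hm) (by positivity) (by positivity)
  set Y := pairing G i (fun x => W'.eval x) p
  set Z := ∑ j, G.weight i j * (derivative p).eval (G.node i j) *
        ((c - α (G.node i j)) * W.eval (G.node i j))
  set K := ∫ x in (G.left i)..(G.right i), e₁ x
  have e : pairing G i e₁ p + Y -
      ∑ j, G.weight i j * (derivative p).eval (G.node i j) * F j =
      p.eval (G.left i) * K + Y + Z := by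
    rw [hX, ← hdiff]; ring
  rw [e]
  have b1 : A * |p.eval (G.left i) * K| ≤ Λ * (P * J) := by
    rw [abs_mul]
    exact mul_le_mul hΛ (mul_le_mul (hP _ (G.left_mem i)) he₁ (abs_nonneg _) hP0)
      (by positivity) hΛ0
  calc A * |p.eval (G.left i) * K + Y + Z| ≤ A * (|p.eval (G.left i) * K| + |Y| + |Z|) :=
        mul_le_mul_of_nonneg_left (abs_add_three _ _ _) hA0
    _ = A * |p.eval (G.left i) * K| + A * |Y| + A * |Z| := by ring
    _ ≤ _ := add_le_add (add_le_add b1 b2) b3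
    _ = _ := by ring

end Element

/-! ### Vanishing of the upwind fluxes -/

section Flux

variable {k N : ℕ} {α : ℝ → ℝ} {G : Grid k N}

/-- Such an element is positive or mixed, and both stencils contain the right end. -/
lemma interpErr_right (i : Fin N) (h : 0 < α (G.right i)) (f : ℝ → ℝ) :
    interpErr α G i f (G.right i) = 0 := by
  rw [← G.node_last]
  refine interpErr_node α G i f ?_
  cases hc : elemCase α G i with
  | positive =>
    simp only [ElemCase.stencil, Finset.mem_filter, Finset.mem_univ, true_and]
    simp [Fin.ext_iff]
  | negative => exact absurd ((elemCase_negative_iff α G i).1 hc).2 h.le.not_gt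
  | mixed => simp [ElemCase.stencil]

/-- Such an element is negative or mixed. The mixed stencil omits the index `k`, which differs from
0 because `k ≥ 1`. -/
lemma interpErr_left (hk : 1 ≤ k) (i : Fin N) (h : α (G.left i) < 0) (f : ℝ → ℝ) :
    interpErr α G i f (G.left i) = 0 := by
  rw [← G.node_zero]
  refine interpErr_node α G i f ?_
  cases hc : elemCase α G i with
  | positive => exact absurd ((elemCase_positive_iff α G i).1 hc).1 h.not_ge
  | negative =>
    simp only [ElemCase.stencil, Finset.mem_filter, Finset.mem_univ, true_and]
    simp [Fin.ext_iff]
  | mixed =>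
    simp only [ElemCase.stencil, Finset.mem_filter, Finset.mem_univ, true_and, Fin.val_zero]
    omega

namespace CorrectionOn

variable {i : Fin N} {f : ℝ → ℝ} {W : ℝ[X]}

lemma eval_right (h : CorrectionOn α G i f W) (hα : 0 < α (G.right i)) :
    W.eval (G.right i) = 0 := by
  cases hc : elemCase α G i with
  | positive => exact (h.1 hc).zero
  | negative => exact absurd ((elemCase_negative_iff α G i).1 hc).2 hα.le.not_gt
  | mixed => rw [h.2.2 hc, eval_zero]

/-- The excluded case `α = 0` at the left end and `α > 0` at the right end gives a positive element,
where nothing is prescribed at the left. This is the exception in the statement on upwind values. -/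
lemma eval_left (h : CorrectionOn α G i f W) (hα : α (G.left i) ≤ 0)
    (hα' : α (G.left i) = 0 → α (G.right i) ≤ 0) : W.eval (G.left i) = 0 := by
  cases hc : elemCase α G i with
  | positive =>
    obtain ⟨h1, h2⟩ := (elemCase_positive_iff α G i).1 hc
    exact absurd (hα' (le_antisymm hα h1)) h2.not_ge
  | negative => exact (h.2.1 hc).zero
  | mixed => rw [h.2.2 hc, eval_zero]

end CorrectionOn

variable [NeZero N] {v : Fin N → ℝ → ℝ}

lemma upwind_eq_zero (hper : α 0 = α (2 * Real.pi))
    (hr : ∀ i, 0 < α (G.right i) → v i (G.right i) = 0)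
    (hl : ∀ i, α (G.left i) < 0 → v i (G.left i) = 0) {i : Fin N} (hi : α (G.right i) ≠ 0) :
    upwind α G v i = 0 := by
  unfold upwind
  split_ifs with h
  · exact hr i h
  · refine hl _ ?_
    rw [G.apply_left_add_one i hper]
    exact lt_of_le_of_ne (not_lt.1 h) hi

lemma mul_upwind_eq_zero (hper : α 0 = α (2 * Real.pi))
    (hr : ∀ i, 0 < α (G.right i) → v i (G.right i) = 0)
    (hl : ∀ i, α (G.left i) < 0 → v i (G.left i) = 0) (i : Fin N) :
    α (G.right i) * upwind α G v i = 0 := by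
  by_cases h : α (G.right i) = 0
  · rw [h, zero_mul]
  · rw [upwind_eq_zero hper hr hl h, mul_zero]

lemma flux_zero (hper : α 0 = α (2 * Real.pi))
    (hr : ∀ i, 0 < α (G.right i) → v i (G.right i) = 0)
    (hl : ∀ i, α (G.left i) < 0 → v i (G.left i) = 0) (i : Fin N) : flux α G v i 0 = 0 := by
  have h := mul_upwind_eq_zero hper hr hl (i - 1)
  rw [← G.apply_left_add_one (i - 1) hper, sub_add_cancel] at h
  rw [flux, if_pos rfl, h]

lemma flux_last (hper : α 0 = α (2 * Real.pi))
    (hr : ∀ i, 0 < α (G.right i) → v i (G.right i) = 0)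
    (hl : ∀ i, α (G.left i) < 0 → v i (G.left i) = 0) (i : Fin N) :
    flux α G v i (Fin.last (k + 1)) = 0 := by
  rw [flux, if_neg (by simp [Fin.ext_iff]), if_pos rfl, mul_upwind_eq_zero hper hr hl i]

lemma flux_interior {i : Fin N} {j : Fin (k + 2)} (h0 : j ≠ 0) (hl : j ≠ Fin.last (k + 1)) :
    flux α G v i j = α (G.node i j) * v i (G.node i j) := by
  rw [flux, if_neg h0, if_neg hl]

/-- Summation by parts in the bilinear form. -/
lemma formElem_eq (T : ℝ) (v : ℝ → Fin N → ℝ → ℝ) (t : ℝ) (i : Fin N) (p : ℝ[X])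
    (h0 : flux α G (v t) i 0 = 0) (hl : flux α G (v t) i (Fin.last (k + 1)) = 0) :
    formElem α G T v t i p = pairing G i (timeDeriv T v t i) p -
      ∑ j, G.weight i j * (derivative p).eval (G.node i j) * flux α G (v t) i j := by
  rw [formElem, sub_eq_add_neg]
  congr 1
  exact sum_primitive_mul_sub (p.eval (G.left i))
    (fun l => G.weight i l * (derivative p).eval (G.node i l)) _ h0 hl

end Flux

/-! ### Classification of the elements -/

/-- By the intermediate value theorem `α` has a zero in the element, at distance at most its length
from the point of maximal modulus. -/
lemma alphaMax_le_of_zero {k N : ℕ} {α : ℝ → ℝ} {Λ : ℝ} (hα : LipBall 0 Λ α) (G : Grid k N)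
    (i : Fin N) (h1 : ¬(0 < α (G.left i) ∧ 0 < α (G.right i)))
    (h2 : ¬(α (G.left i) < 0 ∧ α (G.right i) < 0)) : alphaMax α G i ≤ Λ * G.len i := by
  have hle := (G.left_lt_right i).le
  have hmem : (0 : ℝ) ∈ uIcc (α (G.left i)) (α (G.right i)) := by
    rw [mem_uIcc]
    by_contra! hcon
    rcases lt_trichotomy (α (G.left i)) 0 with h | h | h
    · exact h2 ⟨h, hcon.1 h.le⟩
    · rcases le_total (α (G.right i)) 0 with h' | h'
      · exact absurd (hcon.2 h') (by rw [h]; exact lt_irrefl _)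
      · exact absurd (hcon.1 h.le) h'.not_gt
    · refine h1 ⟨h, ?_⟩
      by_contra! h'
      exact absurd (hcon.2 h') h.le.not_gt
  obtain ⟨y, hy, hy0⟩ := intermediate_value_uIcc (f := α) (a := G.left i) (b := G.right i)
    (by rw [uIcc_of_le hle]; exact hα.continuousOn.mono (G.Icc_subset i)) hmem
  rw [uIcc_of_le hle] at hy
  obtain ⟨x, hx, hxe⟩ := exists_alphaMax_eq G i hα.continuousOn
  rw [hxe]
  have h := hα.lipschitz x (G.Icc_subset i hx) y (G.Icc_subset i hy)
  rw [hy0, sub_zero] at h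
  refine h.trans (mul_le_mul_of_nonneg_left ?_ hα.nonneg)
  rw [Grid.len, abs_le]
  constructor <;> linarith [hx.1, hx.2, hy.1, hy.2]

/-- Where `α > 0` at the right end point, `α` is close to its maximal modulus. -/
lemma abs_alphaMax_sub_le {k N : ℕ} {α : ℝ → ℝ} {Λ : ℝ} (hα : LipBall 0 Λ α) (G : Grid k N)
    (i : Fin N) {σ : ℝ} (hσ : |σ| = 1) (h : 0 < σ * α (G.right i)) :
    ∀ x ∈ Icc (G.left i) (G.right i), |σ * alphaMax α G i - α x| ≤ 2 * Λ * G.len i := by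
  have hcont := hα.continuousOn
  obtain ⟨y, hy, hye⟩ := exists_alphaMax_eq G i hcont
  have hσ2 : σ * σ = 1 := by rw [← abs_mul_abs_self, hσ, mul_one]
  have hlip : ∀ x ∈ Icc (G.left i) (G.right i), ∀ y ∈ Icc (G.left i) (G.right i),
      |σ * α x - σ * α y| ≤ Λ * G.len i := by
    intro x hx y hy
    rw [← mul_sub, abs_mul, hσ, one_mul]
    refine (hα.lipschitz x (G.Icc_subset i hx) y (G.Icc_subset i hy)).trans ?_
    refine mul_le_mul_of_nonneg_left ?_ hα.nonneg
    rw [Grid.len, abs_le]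
    constructor <;> linarith [hx.1, hx.2, hy.1, hy.2]
  -- Since `σ α` is positive at the right end, the Lipschitz bound for `σ α` also controls `|α|`,
  -- even if `α` changes sign inside.
  have hmax : alphaMax α G i ≤ σ * α (G.right i) + Λ * G.len i := by
    have h1 := hlip y hy _ (G.right_mem i)
    rw [hye, ← one_mul |α y|, ← hσ, ← abs_mul]
    rw [abs_le] at h1 ⊢
    constructor <;> linarith
  intro x hx
  have h1 := le_alphaMax G i hcont hx
  have h2 := hlip x hx _ (G.right_mem i)
  have h3 : |σ * α x| = |α x| := by rw [abs_mul, hσ, one_mul]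
  have h4 : |σ * alphaMax α G i - α x| = |alphaMax α G i - σ * α x| := by
    rw [← one_mul |alphaMax α G i - σ * α x|, ← hσ, ← abs_mul, mul_sub, ← mul_assoc, hσ2, one_mul]
  rw [h4]
  rw [← h3] at h1
  rw [abs_le] at *
  constructor <;> linarith

/-- On elements where `α` has the same sign at both end points, the quadrature points are
interpolation points and the correction function vanishes at the outflow end. -/
lemma small_or_sign {k N : ℕ} (hk : 1 ≤ k) {α : ℝ → ℝ} {Λ : ℝ} (hα : LipBall 0 Λ α)
    (G : Grid k N) {m : Scheme} (hm : m.Uses α G) (hmk : m = .LSV → 2 ≤ k) (i : Fin N) :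
    alphaMax α G i ≤ Λ * G.len i ∨
    ((G.part i).kind.active k ⊆ (elemCase α G i).stencil k ∧
      2 ≤ ((G.part i).kind.active k).card ∧ ∃ c z : ℝ,
      (∀ x ∈ Icc (G.left i) (G.right i), |c - α x| ≤ 2 * Λ * G.len i) ∧
      (∀ f W, CorrectionOn α G i f W → IsLocalCorrection G i c z f W) ∧
      ∀ j ∈ (G.part i).kind.active k, (j = 0 → z = G.left i) ∧
        (j = Fin.last (k + 1) → z = G.right i)) := by
  have hcard := (G.part i).kind.card_active k
  by_cases hpos : 0 < α (G.left i) ∧ 0 < α (G.right i)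
  · right
    have hcase : elemCase α G i = .positive :=
      (elemCase_positive_iff α G i).2 ⟨hpos.1.le, hpos.2⟩
    have hd := abs_alphaMax_sub_le hα G i (σ := 1) (by simp) (by simpa using hpos.2)
    rw [one_mul] at hd
    rw [hcase]
    -- With strict signs at both ends the RSV method has no choice of Radau points.
    have hkind : ((G.part i).kind = .gauss ∧ 2 ≤ k) ∨ (G.part i).kind = .radauRight := by
      cases m with
      | LSV => exact Or.inl ⟨hm i, hmk rfl⟩
      | RSV => exact Or.inr ((hm i).1 hpos.1 hpos.2)
    have hact : (G.part i).kind.active k ⊆ (ElemCase.positive).stencil k := by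
      intro j hj
      rcases hkind with ⟨h, -⟩ | h <;> rw [h] at hj <;>
        simp_all [NodeKind.active, ElemCase.stencil]
    -- `k` Gauss points suffice for `k ≥ 2`; Radau rules have `k + 1` points.
    have h2 : 2 ≤ ((G.part i).kind.active k).card := by
      rcases hkind with ⟨h, hk2⟩ | h
      · omega
      · have : (NodeKind.radauRight.poly k).natDegree = k + 1 := by
          rw [NodeKind.poly, natDegree_sub_eq_left_of_natDegree_lt] <;>
            simp only [natDegree_legendre]
          omega
        rw [hcard.1, h, this]
        omega
    refine ⟨hact, h2, _, _, hd, fun f W hW => hW.1 hcase, fun j hj => ⟨fun h0 => ?_, fun _ => rfl⟩⟩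
    have := hact hj
    simp [ElemCase.stencil, h0] at this
  by_cases hneg : α (G.left i) < 0 ∧ α (G.right i) < 0
  · right
    have hcase : elemCase α G i = .negative :=
      (elemCase_negative_iff α G i).2 ⟨hneg.1.le, hneg.2⟩
    have hd := abs_alphaMax_sub_le hα G i (σ := -1) (by simp) (by simpa using hneg.2)
    rw [neg_one_mul] at hd
    rw [hcase]
    have hkind : ((G.part i).kind = .gauss ∧ 2 ≤ k) ∨ (G.part i).kind = .radauLeft := by
      cases m with
      | LSV => exact Or.inl ⟨hm i, hmk rfl⟩
      | RSV => exact Or.inr ((hm i).2.1 hneg.1 hneg.2)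
    have hact : (G.part i).kind.active k ⊆ (ElemCase.negative).stencil k := by
      intro j hj
      rcases hkind with ⟨h, -⟩ | h <;> rw [h] at hj <;>
        simp_all [NodeKind.active, ElemCase.stencil]
    have h2 : 2 ≤ ((G.part i).kind.active k).card := by
      rcases hkind with ⟨h, hk2⟩ | h
      · omega
      · have : (NodeKind.radauLeft.poly k).natDegree = k + 1 := by
          rw [NodeKind.poly, natDegree_add_eq_left_of_natDegree_lt] <;>
            simp only [natDegree_legendre]
          omega
        rw [hcard.1, h, this]
        omega
    refine ⟨hact, h2, _, _, hd, fun f W hW => hW.2.1 hcase, fun j hj => ⟨fun _ => rfl, fun h0 => ?_⟩⟩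
    have := hact hj
    simp [ElemCase.stencil, h0] at this
  · exact Or.inl (alphaMax_le_of_zero hα G i hpos hneg)

/-- The estimate of the bilinear form on one element. -/
lemma exists_element_estimate {k : ℕ} (hk : 1 ≤ k) {α : ℝ → ℝ} {Λ : ℝ} (hα : LipBall 0 Λ α) :
    ∃ C, 0 < C ∧ ∀ {N : ℕ} (G : Grid k N) {m : Scheme} (_ : m.Uses α G)
      (_ : m = .LSV → 2 ≤ k) (i : Fin N) {M P : ℝ} {f₀ f₁ f₂ : ℝ → ℝ} (_ : LipBall k M f₀)
      (_ : LipBall (k + 1) M f₁) (_ : LipBall k M f₂) {W W' p : ℝ[X]}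
      (_ : CorrectionOn α G i (interpErr α G i f₁) W)
      (_ : CorrectionOn α G i (interpErr α G i f₂) W') {F : Fin (k + 2) → ℝ}
      (_ : F 0 = 0) (_ : F (Fin.last (k + 1)) = 0)
      (_ : ∀ j, j ≠ 0 → j ≠ Fin.last (k + 1) →
        F j = α (G.node i j) * (interpErr α G i f₀ (G.node i j) + W.eval (G.node i j)))
      (_ : p.natDegree ≤ k) (_ : ∀ x ∈ Icc (G.left i) (G.right i), |p.eval x| ≤ P)
      (_ : ∀ x ∈ Icc (G.left i) (G.right i), G.len i * |(derivative p).eval x| ≤ P),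
      alphaMax α G i * |pairing G i (interpErr α G i f₁) p + pairing G i (fun x => W'.eval x) p -
        ∑ j, G.weight i j * (derivative p).eval (G.node i j) * F j| ≤
        C * (G.len i ^ (k + 3) * M * P) := by
  have hcont := hα.continuousOn
  have hΛ0 := hα.nonneg
  obtain ⟨C₁, hC₁, hbound⟩ := exists_correctionOn_bound hk hcont
  refine ⟨(2 * Λ + 2 * C₁ + Λ * (Λ + C₁)) + (Λ + (2 * C₁ + 2 * Λ * C₁)), by positivity, ?_⟩
  intro N G m hm hmk i M P f₀ f₁ f₂ hf₀ hf₁ hf₂ W W' p hW hW' F h0 hl hF hpd hP hP'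
  have hlen := G.len_pos i
  have hM := hf₀.nonneg
  have hP0 : 0 ≤ P := (abs_nonneg _).trans (hP _ (G.left_mem i))
  have hX : 0 ≤ G.len i ^ (k + 3) * M * P := by positivity
  have hWb := hbound G i hW fun x hx => abs_interpErr_le α G i hf₁.of_succ hx
  have hWb' := hbound G i hW' fun x hx => abs_interpErr_le α G i hf₂ hx
  rw [add_mul]
  rcases small_or_sign hk hα G hm hmk i with hs | ⟨hact, hcard, c, z, hcα, hloc, hz⟩
  · have h := abs_form_le_of_small G i hk hcont hΛ0 hC₁.le hs h0 hl hF
      (fun x hx => abs_interpErr_le α G i hf₀ hx)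
      (fun x hx => abs_interpErr_le α G i hf₁.of_succ hx) hWb hWb' hP hP'
    refine h.trans ((le_of_eq ?_).trans (le_add_of_nonneg_right (by positivity)))
    ring
  · have hmax : alphaMax α G i ≤ Λ := by
      obtain ⟨x, hx, hxe⟩ := exists_alphaMax_eq G i hcont
      rw [hxe]
      exact hα.bound x (G.Icc_subset i hx)
    -- A Radau point at an element end is the zero of `W`, and the flux vanishes there as well; at
    -- the other quadrature points the interpolation error vanishes.
    have hFact : ∀ j ∈ (G.part i).kind.active k, F j = α (G.node i j) * W.eval (G.node i j) := by
      intro j hj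
      have hWz := (hloc _ _ hW).zero
      by_cases hj0 : j = 0
      · rw [(hz j hj).1 hj0] at hWz
        rw [hj0, h0, G.node_zero, hWz, mul_zero]
      by_cases hjl : j = Fin.last (k + 1)
      · rw [(hz j hj).2 hjl] at hWz
        rw [hjl, hl, G.node_last, hWz, mul_zero]
      rw [hF j hj0 hjl, interpErr_node α G i f₀ (hact hj), zero_add]
    have h := abs_form_le_of_sign G i hk hcont hmax (hloc _ _ hW) hcα hFact
      (continuousOn_interpErr α G i hf₁.continuousOn)
      (abs_integral_interpErr_le α G i hk hf₁ hact hcard) hWb hWb' hpd hP hP'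
    refine h.trans ((le_of_eq ?_).trans (le_add_of_nonneg_left (by positivity)))
    ring

/-! ### Summation over the elements -/

lemma alphaSq_nonneg {k N : ℕ} (α : ℝ → ℝ) (G : Grid k N) (i : Fin N) : 0 ≤ alphaSq α G i := by
  unfold alphaSq; positivity

lemma alphaNorm_le {k N : ℕ} [NeZero N] {α : ℝ → ℝ} (hα : ContinuousOn α (Icc 0 (2 * Real.pi)))
    (G : Grid k N) {v : Fin N → ℝ → ℝ} {Q : ℝ}
    (h : ∀ i, ∀ x ∈ Icc (G.left i) (G.right i), alphaMax α G i * |v i x| ≤ Q) :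
    alphaNorm α G v ≤ 2 * Q * √(2 * Real.pi) := by
  have hQ : 0 ≤ Q := (mul_nonneg (alphaMax_nonneg G 0 hα) (abs_nonneg _)).trans
    (h 0 _ (G.left_mem 0))
  unfold alphaNorm
  refine Real.sqrt_le_iff.2 ⟨by positivity, ?_⟩
  rw [mul_pow, Real.sq_sqrt two_pi_pos.le, ← G.sum_len, Finset.mul_sum]
  refine Finset.sum_le_sum fun i _ => ?_
  have hle := (G.left_lt_right i).le
  rw [← intervalIntegral.integral_const_mul]
  have hb := intervalIntegral.norm_integral_le_of_norm_le_const (C := (2 * Q) ^ 2)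
    (f := fun x => alphaSq α G i * v i x ^ 2) (a := G.left i) (b := G.right i) (fun x hx => by
      rw [uIoc_of_le hle] at hx
      have h1 := h i x (Ioc_subset_Icc_self hx)
      have h2 := sqrt_alphaSq_le G i hα
      have h3 : √(alphaSq α G i) * |v i x| ≤ 2 * Q :=
        (mul_le_mul_of_nonneg_right h2 (abs_nonneg _)).trans (by linarith)
      have h4 := pow_le_pow_left₀ (by positivity) h3 2
      rw [mul_pow, Real.sq_sqrt (alphaSq_nonneg α G i), sq_abs] at h4
      rw [Real.norm_eq_abs, abs_of_nonneg (mul_nonneg (alphaSq_nonneg α G i) (sq_nonneg _))]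
      exact h4)
  rw [abs_of_pos (sub_pos.2 (G.left_lt_right i))] at hb
  exact (le_abs_self _).trans hb

/-- One factor `√(α̃²)` goes with `X` through `ᾱ`, the other with `v_h`. The inverse inequality
costs half a power of the length; of the spare power, the other half is summed by Cauchy-Schwarz, as
the lengths add up to `2π`. -/
lemma exists_sum_estimate (k : ℕ) {α : ℝ → ℝ} (hα : ContinuousOn α (Icc 0 (2 * Real.pi))) :
    ∃ C, 0 < C ∧ ∀ {N : ℕ} [NeZero N] (G : Grid k N) (vh : Fin N → ℝ[X])
      (_ : ∀ i, (vh i).natDegree ≤ k) (X : Fin N → ℝ) {Q : ℝ} (_ : 0 ≤ Q)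
      (_ : ∀ i P, (∀ x ∈ Icc (G.left i) (G.right i), |(vh i).eval x| ≤ P) →
        (∀ x ∈ Icc (G.left i) (G.right i), G.len i * |(derivative (vh i)).eval x| ≤ P) →
        alphaMax α G i * |X i| ≤ Q * (G.len i ^ (k + 3) * P)),
      |∑ i, alphaSq α G i * X i| ≤
        C * G.meshSize ^ (k + 2) * Q * alphaNorm α G (toFun vh) := by
  obtain ⟨C, hC, hinv⟩ := exists_eval_sq_le_integral_sq k
  refine ⟨2 * (√C * √(2 * Real.pi)), by positivity, ?_⟩
  intro N _ G vh hvh X Q hQ hX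
  have hh := G.meshSize_pos
  set S : Fin N → ℝ := fun i => ∫ x in (G.left i)..(G.right i), (vh i).eval x ^ 2 with hS
  have hS0 : ∀ i, 0 ≤ S i := fun i =>
    intervalIntegral.integral_nonneg (G.left_lt_right i).le fun x _ => sq_nonneg _
  have hlocal : ∀ i, |alphaSq α G i * X i| ≤
      2 * √C * G.meshSize ^ (k + 2) * Q * (√(G.len i) * √(alphaSq α G i * S i)) := by
    intro i
    have hlen := G.len_pos i
    -- The bound that the inverse inequalities provide for both `p` and `d p'`.
    set P := √(C * S i / G.len i) with hP
    have hPsq : ∀ y : ℝ, G.len i * y ^ 2 ≤ C * S i → |y| ≤ P := fun y hy => by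
      refine Real.abs_le_sqrt ?_
      rw [le_div_iff₀ hlen, mul_comm]
      exact hy
    have h1 := hX i P
      (fun x hx => hPsq _ (hinv _ _ (G.left_lt_right i) _ (hvh i) x hx).1)
      (fun x hx => by
        rw [← abs_of_pos hlen, ← abs_mul]
        exact hPsq _ (hinv _ _ (G.left_lt_right i) _ (hvh i) x hx).2)
    have ha := Real.sq_sqrt (alphaSq_nonneg α G i)
    set a := √(alphaSq α G i) with haDef
    have ha0 : 0 ≤ a := Real.sqrt_nonneg _
    have h2 : a * |X i| ≤ 2 * (Q * (G.len i ^ (k + 3) * P)) := by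
      have := mul_le_mul_of_nonneg_right (sqrt_alphaSq_le G i hα) (abs_nonneg (X i))
      linarith
    have h3 : G.len i * P = √C * (√(G.len i) * √(S i)) := by
      rw [hP, Real.sqrt_div (mul_nonneg hC.le (hS0 i)), Real.sqrt_mul hC.le]
      have hs : √(G.len i) ≠ 0 := (Real.sqrt_pos.2 hlen).ne'
      rw [mul_div_assoc', div_eq_iff hs]
      have hl := Real.mul_self_sqrt hlen.le
      linear_combination -(√C * √(S i)) * hl
    have h4 : G.len i ^ (k + 3) * P ≤ G.meshSize ^ (k + 2) * (√C * (√(G.len i) * √(S i))) := by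
      rw [← h3, pow_succ _ (k + 2), mul_assoc]
      have := G.len_le_meshSize i
      gcongr
    rw [abs_mul, abs_of_nonneg (alphaSq_nonneg α G i), Real.sqrt_mul' _ (hS0 i), ← haDef, ← ha]
    calc a ^ 2 * |X i| = a * (a * |X i|) := by ring
      _ ≤ a * (2 * (Q * (G.meshSize ^ (k + 2) * (√C * (√(G.len i) * √(S i)))))) := by
        refine mul_le_mul_of_nonneg_left (h2.trans ?_) ha0
        gcongr
      _ = _ := by ring
  have hcs := Real.sum_sqrt_mul_sqrt_le Finset.univ (fun i => (G.len_pos i).le)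
    (fun i => mul_nonneg (alphaSq_nonneg α G i) (hS0 i))
  rw [G.sum_len] at hcs
  calc |∑ i, alphaSq α G i * X i| ≤ ∑ i, |alphaSq α G i * X i| := Finset.abs_sum_le_sum_abs _ _
    _ ≤ ∑ i, 2 * √C * G.meshSize ^ (k + 2) * Q * (√(G.len i) * √(alphaSq α G i * S i)) :=
      Finset.sum_le_sum fun i _ => hlocal i
    _ = 2 * √C * G.meshSize ^ (k + 2) * Q * ∑ i, (√(G.len i) * √(alphaSq α G i * S i)) := by
      rw [Finset.mul_sum]
    _ ≤ 2 * √C * G.meshSize ^ (k + 2) * Q * (√(2 * Real.pi) * √(∑ i, alphaSq α G i * S i)) := by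
      gcongr
    _ = _ := by rw [alphaNorm]; simp only [toFun, hS]; ring

/-! ### The correction function in time -/

lemma CorrectionOn.hasDerivWithinAt {k N : ℕ} (hk : 1 ≤ k) {α : ℝ → ℝ}
    (hα : ContinuousOn α (Icc 0 (2 * Real.pi))) {G : Grid k N} {i : Fin N} {T M : ℝ}
    {f f' : ℝ → ℝ → ℝ} {W : ℝ → ℝ[X]} {W' : ℝ[X]} {t : ℝ}
    (h : ∀ s ∈ Icc 0 T, CorrectionOn α G i (f s) (W s)) (ht : t ∈ Icc 0 T)
    (h' : CorrectionOn α G i (f' t) W')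
    (hf : ∀ s ∈ Icc 0 T, ContinuousOn (f s) (Icc (G.left i) (G.right i)))
    (hd : ∀ s ∈ Icc 0 T, ∀ x ∈ Icc (G.left i) (G.right i),
      HasDerivWithinAt (fun r => f r x) (f' s x) (Icc 0 T) s)
    (hM : ∀ s ∈ Icc 0 T, ∀ x ∈ Icc (G.left i) (G.right i), |f' s x| ≤ M) (x : ℝ) :
    HasDerivWithinAt (fun s => (W s).eval x) (W'.eval x) (Icc 0 T) t := by
  have hmax : ∀ y ∈ Icc (G.left i) (G.right i), α y ≠ 0 → alphaMax α G i ≠ 0 := fun y hy hy0 =>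
    ((abs_pos.2 hy0).trans_le (le_alphaMax G i hα hy)).ne'
  cases hc : elemCase α G i with
  | positive =>
    exact IsLocalCorrection.hasDerivWithinAt hk (fun s hs => (h s hs).1 hc) ht (h'.1 hc)
      (hmax _ (G.right_mem i) ((elemCase_positive_iff α G i).1 hc).2.ne') (Or.inr rfl) hf hd hM x
  | negative =>
    exact IsLocalCorrection.hasDerivWithinAt hk (fun s hs => (h s hs).2.1 hc) ht (h'.2.1 hc)
      (neg_ne_zero.2 (hmax _ (G.right_mem i) ((elemCase_negative_iff α G i).1 hc).2.ne))
      (Or.inl rfl) hf hd hM x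
  | mixed =>
    rw [h'.2.2 hc, eval_zero]
    refine (hasDerivWithinAt_const t (Icc 0 T) (0 : ℝ)).congr (fun s hs => ?_) ?_
    · rw [(h s hs).2.2 hc, eval_zero]
    · rw [(h t ht).2.2 hc, eval_zero]

/-- The correction functions of a family are the solutions of the elementwise problems, and their
time derivatives solve the differentiated problems. -/
lemma correction_time_derivative {k N : ℕ} [NeZero N] (hk : 1 ≤ k) {α : ℝ → ℝ}
    (hα : ContinuousOn α (Icc 0 (2 * Real.pi))) {G : Grid k N} {T M : ℝ} (hT : 0 < T)
    {u p p' : ℝ → ℝ → ℝ} (hd : ∀ t ∈ Icc 0 T, ∀ x ∈ Icc 0 (2 * Real.pi),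
      HasDerivWithinAt (fun s => u s x) (p t x) (Icc 0 T) t ∧
      HasDerivWithinAt (fun s => p s x) (p' t x) (Icc 0 T) t)
    (hp : ∀ t ∈ Icc 0 T, ContinuousOn (p t) (Icc 0 (2 * Real.pi)))
    (hp' : ∀ t ∈ Icc 0 T, LipBall k M (p' t)) {w : ℝ → Fin N → ℝ[X]}
    (hw : ∀ t ∈ Icc 0 T, IsCorrection α G T u t (w t)) {t : ℝ} (ht : t ∈ Icc 0 T) (i : Fin N) :
    CorrectionOn α G i (interpErr α G i (p t)) (w t i) ∧
    ∃ W', CorrectionOn α G i (interpErr α G i (p' t)) W' ∧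
      (∀ x, HasDerivWithinAt (fun s => (w s i).eval x) (W'.eval x) (Icc 0 T) t) ∧
      ∀ x ∈ Icc (G.left i) (G.right i), timeDeriv T (correctedError α G u w) t i x =
        interpErr α G i (p t) x + W'.eval x := by
  have he : ∀ s ∈ Icc 0 T, ∀ x ∈ Icc (G.left i) (G.right i),
      HasDerivWithinAt (fun r => interpError α G u r i x) (interpErr α G i (p s) x) (Icc 0 T) s :=
    fun s hs x hx => hasDerivWithinAt_interpErr α G i (fun y hy => (hd s hs y hy).1) hx
  have hW : ∀ s ∈ Icc 0 T, CorrectionOn α G i (interpErr α G i (p s)) (w s i) := fun s hs =>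
    (isCorrection_iff.1 (hw s hs) i).congr fun x hx =>
      (he s hs x hx).derivWithin (uniqueDiffOn_Icc hT s hs)
  -- The candidate for `w_t`: the correction whose right hand side is the interpolation error of
  -- `u_tt`.
  obtain ⟨W', hW', -⟩ := exists_correctionOn hk hα G i (interpErr α G i (p' t))
  have hWd : ∀ x, HasDerivWithinAt (fun s => (w s i).eval x) (W'.eval x) (Icc 0 T) t :=
    CorrectionOn.hasDerivWithinAt hk hα hW ht (f' := fun s => interpErr α G i (p' s)) hW'
      (fun s hs => continuousOn_interpErr α G i (hp s hs))
      (fun s hs x hx => hasDerivWithinAt_interpErr α G i (fun y hy => (hd s hs y hy).2) hx)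
      (fun s hs x hx => abs_interpErr_le α G i (hp' s hs) hx)
  exact ⟨hW t ht, W', hW', hWd, fun x hx =>
    ((he t ht x hx).add (hWd x)).derivWithin (uniqueDiffOn_Icc hT t ht)⟩

lemma existsUnique_isCorrection {k N : ℕ} [NeZero N] (hk : 1 ≤ k) {α : ℝ → ℝ}
    (hα : ContinuousOn α (Icc 0 (2 * Real.pi))) (G : Grid k N) (T : ℝ) (u : ℝ → ℝ → ℝ) (t : ℝ) :
    ∃! W : Fin N → ℝ[X], IsCorrection α G T u t W := by
  choose W hW hu using fun i =>
    exists_correctionOn hk hα G i (timeDeriv T (interpError α G u) t i)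
  exact ⟨W, isCorrection_iff.2 hW, fun W' hW' =>
    funext fun i => hu i (W' i) (isCorrection_iff.1 hW' i)⟩

lemma IsCorrection.upwind_eq_zero {k N : ℕ} [NeZero N] {α : ℝ → ℝ} {G : Grid k N} {T t : ℝ}
    {u : ℝ → ℝ → ℝ} {W : Fin N → ℝ[X]} (h : IsCorrection α G T u t W)
    (hper : α 0 = α (2 * Real.pi)) (i : Fin N)
    (hi : α (G.right i) = 0 → α (G.right (i + 1)) ≤ 0) : upwind α G (toFun W) i = 0 := by
  have hW := isCorrection_iff.1 h
  unfold upwind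
  split_ifs with hpos
  · exact (hW i).eval_right hpos
  · refine (hW (i + 1)).eval_left ?_ ?_ <;> rw [G.apply_left_add_one i hper]
    · exact not_lt.1 hpos
    · exact hi

lemma IsCorrection.mul_upwind_eq_zero {k N : ℕ} [NeZero N] {α : ℝ → ℝ} {G : Grid k N} {T t : ℝ}
    {u : ℝ → ℝ → ℝ} {W : Fin N → ℝ[X]} (h : IsCorrection α G T u t W)
    (hper : α 0 = α (2 * Real.pi)) (i : Fin N) :
    α (G.right i) * upwind α G (toFun W) i = 0 := by
  by_cases h0 : α (G.right i) = 0
  · rw [h0, zero_mul]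
  · rw [h.upwind_eq_zero hper i fun h' => absurd h' h0, mul_zero]

/-! ### The estimates -/

lemma alphaNorm_nonneg {k N : ℕ} (α : ℝ → ℝ) (G : Grid k N) (v : Fin N → ℝ → ℝ) :
    0 ≤ alphaNorm α G v := Real.sqrt_nonneg _

lemma CorrectionEstimates.mono {k N : ℕ} [NeZero N] {m : Scheme} {α : ℝ → ℝ} {G : Grid k N}
    {T : ℝ} {u : ℝ → ℝ → ℝ} {w : ℝ → Fin N → ℝ[X]} {t B B' : ℝ}
    (h : CorrectionEstimates m α G T u w t B) (hB : B ≤ B') :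
    CorrectionEstimates m α G T u w t B' :=
  ⟨h.1.trans hB, fun hm vh hvh => (h.2 hm vh hvh).trans
    (mul_le_mul_of_nonneg_right hB (alphaNorm_nonneg _ _ _))⟩

lemma exists_correctionEstimates {k : ℕ} (hk : 1 ≤ k) {α : ℝ → ℝ}
    (hα : ContDiffOn ℝ ∞ α (Icc 0 (2 * Real.pi))) (hper : α 0 = α (2 * Real.pi)) :
    ∃ c : ℝ, 0 < c ∧ ∀ (T : ℝ) (_ : 0 < T) (g u : ℝ → ℝ → ℝ)
      (_ : ContDiffOn ℝ ∞ (fun p : ℝ × ℝ => g p.1 p.2) (Icc 0 T ×ˢ Icc 0 (2 * Real.pi)))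
      (_ : IsSolution (k + 3) α T g u)
      (m : Scheme) (N : ℕ) [NeZero N] (G : Grid k N) (_ : m.Uses α G) (w : ℝ → Fin N → ℝ[X])
      (_ : ∀ t ∈ Icc 0 T, IsCorrection α G T u t (w t)),
      ∀ t ∈ Icc 0 T, CorrectionEstimates m α G T u w t
        (c * G.meshSize ^ (k + 2) * dataNorm k T g u t) := by
  obtain ⟨Λ, hΛ⟩ := exists_lipBall_of_contDiffOn 0 hα
  have hcont := hα.continuousOn
  obtain ⟨CT, hCT, hreg⟩ := exists_time_derivatives (k := k) hα
  obtain ⟨CE, hCE, hel⟩ := exists_element_estimate hk hΛ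
  obtain ⟨CB, hCB, hbd⟩ := exists_correctionOn_bound hk hcont
  obtain ⟨CS, hCS, hsum⟩ := exists_sum_estimate k hcont
  -- The first term serves the norms of `w` and `w_t`, twice `2 √(2π)`; the second serves the
  -- bilinear form. `CT` converts the norms of the data into bounds for `u`, `u_t` and `u_tt`.
  refine ⟨4 * √(2 * Real.pi) * CB * CT + CS * CE * CT, by positivity, ?_⟩
  intro T hT g u hg hu m N _ G hm w hw t ht
  obtain ⟨p, p', hd, hL, Mmax, hMmax⟩ := hreg T hT g u hg hu
  obtain ⟨hLu, hLp, hLp'⟩ := hL t ht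
  have hD : 0 ≤ dataNorm k T g u t := by unfold dataNorm; positivity
  have hh := G.meshSize_pos
  set M := CT * dataNorm k T g u t with hM
  have hM0 : 0 ≤ M := mul_nonneg hCT.le hD
  have hfacts := fun i => correction_time_derivative hk hcont (G := G) hT hd
    (fun s hs => (hL s hs).2.1.continuousOn)
    (fun s hs => (hL s hs).2.2.mono (mul_le_mul_of_nonneg_left (hMmax s hs) hCT.le)) hw ht i
  choose hW W' hW' hWd hce using hfacts
  have hsmall : ∀ i, CB * (G.len i * (M * G.len i ^ (k + 1))) ≤ CB * M * G.meshSize ^ (k + 2) := by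
    intro i
    have h1 := G.len_pos i
    have h2 := G.len_le_meshSize i
    calc CB * (G.len i * (M * G.len i ^ (k + 1))) = CB * M * G.len i ^ (k + 2) := by ring
      _ ≤ _ := by gcongr
  constructor
  · have h1 : alphaNorm α G (toFun (w t)) ≤ 2 * (CB * M * G.meshSize ^ (k + 2)) * √(2 * Real.pi) :=
      alphaNorm_le hcont G fun i x hx => (hbd G i (hW i)
        (fun y hy => abs_interpErr_le α G i hLp.of_succ hy) x hx).trans (hsmall i)
    have h2 : alphaNorm α G (timeDeriv T (fun s => toFun (w s)) t) ≤
        2 * (CB * M * G.meshSize ^ (k + 2)) * √(2 * Real.pi) := by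
      refine alphaNorm_le hcont G fun i x hx => ?_
      have e : timeDeriv T (fun s => toFun (w s)) t i x = (W' i).eval x :=
        (hWd i x).derivWithin (uniqueDiffOn_Icc hT t ht)
      rw [e]
      exact (hbd G i (hW' i) (fun y hy => abs_interpErr_le α G i hLp' hy) x hx).trans (hsmall i)
    have h3 : 0 ≤ CS * CE * CT * G.meshSize ^ (k + 2) * dataNorm k T g u t := by positivity
    calc _ ≤ _ := add_le_add h1 h2
      _ = 4 * √(2 * Real.pi) * CB * CT * G.meshSize ^ (k + 2) * dataNorm k T g u t := by
        rw [hM]; ring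
      _ ≤ _ := by linarith
  · intro hmk vh hvh
    have hr : ∀ i, 0 < α (G.right i) → correctedError α G u w t i (G.right i) = 0 := by
      intro i hi
      have h1 := interpErr_right (G := G) i hi (u t)
      have h2 := (hW i).eval_right hi
      show interpErr α G i (u t) (G.right i) + (w t i).eval (G.right i) = 0
      rw [h1, h2, add_zero]
    have hl : ∀ i, α (G.left i) < 0 → correctedError α G u w t i (G.left i) = 0 := by
      intro i hi
      have h1 := interpErr_left (G := G) hk i hi (u t)
      have h2 := (hW i).eval_left hi.le fun h => absurd h hi.ne
      show interpErr α G i (u t) (G.left i) + (w t i).eval (G.left i) = 0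
      rw [h1, h2, add_zero]
    have h0 := flux_zero hper hr hl
    have h1 := flux_last hper hr hl
    have key := hsum G vh hvh
      (fun i => formElem α G T (correctedError α G u w) t i (vh i)) (Q := CE * M)
      (mul_nonneg hCE.le hM0) (fun i P hP hP' => by
        rw [formElem_eq T _ t i (vh i) (h0 i) (h1 i), pairing_congr G i (hce i),
          pairing_add G i (continuousOn_interpErr α G i hLp.continuousOn)
            (W' i).continuous.continuousOn]
        refine (hel G hm hmk i (hLu.of_le (by omega)) hLp hLp' (hW i) (hW' i) (h0 i) (h1 i)
          (fun j hj0 hjl => flux_interior hj0 hjl) (hvh i) hP hP').trans (le_of_eq ?_)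
        ring)
    have h3 : 0 ≤ 4 * √(2 * Real.pi) * CB * CT * G.meshSize ^ (k + 2) * dataNorm k T g u t := by
      positivity
    refine key.trans (mul_le_mul_of_nonneg_right ?_ (alphaNorm_nonneg _ _ _))
    calc CS * G.meshSize ^ (k + 2) * (CE * M) =
        CS * CE * CT * G.meshSize ^ (k + 2) * dataNorm k T g u t := by rw [hM]; ring
      _ ≤ _ := by linarith

/-! ### Bounding the source by the solution -/

lemma lipBall_zero : ∀ n : ℕ, LipBall n 0 fun _ => 0
  | 0 => ⟨fun _ _ => by simp, fun _ _ _ _ => by simp⟩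
  | n + 1 => ⟨fun _ _ => by simp, _, fun x _ => hasDerivWithinAt_const x _ 0, lipBall_zero n⟩

lemma sobolevNorm_eq_zero {m : ℕ} {f : ℝ → ℝ} (h : EqOn f 0 (Icc 0 (2 * Real.pi))) :
    sobolevNorm m f = 0 := by
  have := ((lipBall_zero m).congr (g := f) h.symm).sobolevNorm_le
  simpa using this

/-- If the source does not vanish, then the solution cannot be small. -/
lemma exists_source_le {k : ℕ} {α : ℝ → ℝ} (hα : ContDiffOn ℝ ∞ α (Icc 0 (2 * Real.pi)))
    {T : ℝ} (hT : 0 < T) {g : ℝ → ℝ → ℝ}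
    (hg : ContDiffOn ℝ ∞ (fun p : ℝ × ℝ => g p.1 p.2) (Icc 0 T ×ˢ Icc 0 (2 * Real.pi)))
    {t₀ x₀ : ℝ} (ht₀ : t₀ ∈ Icc 0 T) (hx₀ : x₀ ∈ Icc 0 (2 * Real.pi)) (h0 : g t₀ x₀ ≠ 0) :
    ∃ δ, 0 < δ ∧ ∀ u, IsSolution (k + 3) α T g u → δ ≤ (sobolevSupNorm (k + 3) T u).toReal := by
  obtain ⟨K, hK⟩ := exists_lipBall_of_contDiffOn (k + 2) hα
  have hK0 := hK.nonneg
  have hgc : ContinuousOn (fun s => g s x₀) (Icc 0 T) :=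
    hg.continuousOn.comp (f := fun s => (s, x₀)) (by fun_prop) fun s hs => ⟨hs, hx₀⟩
  set η := |g t₀ x₀| / 2 with hη
  have hη0 : 0 < η := half_pos (abs_pos.2 h0)
  obtain ⟨ε, hε, hclose⟩ := Metric.continuousOn_iff.1 hgc t₀ ht₀ η hη0
  -- A time interval of positive length inside `[0, T]`, even if `t₀` is an end point, on which `g`
  -- stays away from zero at `x₀`.
  set t₁ := max 0 (t₀ - ε / 2) with ht₁
  set t₂ := min T (t₀ + ε / 2) with ht₂
  have h12 : t₁ < t₂ := by
    rw [ht₁, ht₂, max_lt_iff, lt_min_iff, lt_min_iff]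
    refine ⟨⟨hT, by linarith [ht₀.1]⟩, ⟨by linarith [ht₀.2], by linarith⟩⟩
  have hsub : Icc t₁ t₂ ⊆ Icc 0 T :=
    Icc_subset_Icc (le_max_left _ _) (min_le_left _ _)
  have hlow : ∀ s ∈ Icc t₁ t₂, η ≤ |g s x₀| := by
    intro s hs
    have hd := hclose s (hsub hs) (by
      rw [Real.dist_eq, abs_lt]
      have h1 := (le_max_right _ _).trans hs.1
      have h2 := hs.2.trans (min_le_right _ _)
      constructor <;> linarith)
    rw [Real.dist_eq, abs_sub_comm] at hd
    have := abs_sub_abs_le_abs_sub (g t₀ x₀) (g s x₀)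
    linarith
  -- By the mean value theorem, `g` at some time of this interval, multiplied by its length, is an
  -- increment of `u` plus a contribution of `(α u)_x`. The increment costs `2S`; the space
  -- derivative, over a time at most `T`, costs the rest.
  set L : ℝ := 2 + T * (2 ^ (k + 3) * K) with hL
  have hL0 : 0 < L := by positivity
  refine ⟨η * (t₂ - t₁) / L, div_pos (mul_pos hη0 (sub_pos.2 h12)) hL0, fun u hu => ?_⟩
  set S := (sobolevSupNorm (k + 3) T u).toReal
  have hS0 : 0 ≤ S := ENNReal.toReal_nonneg
  have hul : ∀ s ∈ Icc 0 T, LipBall (k + 2) S (u s) := fun s hs =>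
    (hu.lipBall hs).mono (hu.sobolevNorm_le hs)
  have hder := fun s hs => hu.equation s hs x₀ hx₀
  obtain ⟨ξ, hξ, hslope⟩ := exists_hasDerivAt_eq_slope (fun s => u s x₀)
    (fun s => g s x₀ - derivWithin (fun y => α y * u s y) (Icc 0 (2 * Real.pi)) x₀) h12
    (fun s hs => ((hder s (hsub hs)).continuousWithinAt).mono hsub)
    (fun s hs => (hder s (hsub (Ioo_subset_Icc_self hs))).hasDerivAt
      (Icc_mem_nhds ((le_max_left _ _).trans_lt hs.1) (hs.2.trans_le (min_le_left _ _))))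
  have hξI := hsub (Ioo_subset_Icc_self hξ)
  have b1 := hlow ξ (Ioo_subset_Icc_self hξ)
  have b2 : |derivWithin (fun y => α y * u ξ y) (Icc 0 (2 * Real.pi)) x₀| ≤
      2 ^ (k + 3) * (K * S) := (hK.mul (hul ξ hξI)).lipBall_derivWithin.bound x₀ hx₀
  have b3 := (hul t₂ (hsub ⟨h12.le, le_rfl⟩)).bound x₀ hx₀
  have b4 := (hul t₁ (hsub ⟨le_rfl, h12.le⟩)).bound x₀ hx₀
  have hΔ : 0 < t₂ - t₁ := sub_pos.2 h12
  have hΔT : t₂ - t₁ ≤ T := by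
    have h1 : 0 ≤ t₁ := le_max_left _ _
    have h2 : t₂ ≤ T := min_le_left _ _
    linarith
  rw [eq_div_iff hΔ.ne'] at hslope
  have b5 : |g ξ x₀ * (t₂ - t₁)| ≤ 2 * S + 2 ^ (k + 3) * (K * S) * (t₂ - t₁) := by
    have e : g ξ x₀ * (t₂ - t₁) = u t₂ x₀ + -u t₁ x₀ +
        derivWithin (fun y => α y * u ξ y) (Icc 0 (2 * Real.pi)) x₀ * (t₂ - t₁) := by
      linear_combination hslope
    rw [e]
    refine (abs_add_three _ _ _).trans ?_
    rw [abs_neg, abs_mul, abs_of_pos hΔ]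
    have := mul_le_mul_of_nonneg_right b2 hΔ.le
    linarith
  rw [abs_mul, abs_of_pos hΔ] at b5
  rw [div_le_iff₀ hL0]
  have b6 := mul_le_mul_of_nonneg_right b1 hΔ.le
  have b7 : 2 ^ (k + 3) * (K * S) * (t₂ - t₁) ≤ 2 ^ (k + 3) * (K * S) * T :=
    mul_le_mul_of_nonneg_left hΔT (by positivity)
  rw [hL]
  linarith

/-- Either the source vanishes and its norms drop out, or the solution norm is bounded below by some
`δ` independent of `u`, and then the bounded norms of the source are at most a multiple of it. -/
lemma exists_dataNorm_le {k : ℕ} {α : ℝ → ℝ} (hα : ContDiffOn ℝ ∞ α (Icc 0 (2 * Real.pi)))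
    {T : ℝ} (hT : 0 < T) {g : ℝ → ℝ → ℝ}
    (hg : ContDiffOn ℝ ∞ (fun p : ℝ × ℝ => g p.1 p.2) (Icc 0 T ×ˢ Icc 0 (2 * Real.pi))) :
    ∃ c, 0 < c ∧ ∀ u, IsSolution (k + 3) α T g u → ∀ t ∈ Icc 0 T,
      dataNorm k T g u t ≤ c * (sobolevSupNorm (k + 3) T u).toReal := by
  by_cases h0 : ∀ t ∈ Icc 0 T, ∀ x ∈ Icc 0 (2 * Real.pi), g t x = 0
  · refine ⟨1, one_pos, fun u hu t ht => ?_⟩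
    have h1 : sobolevNorm (k + 2) (g t) = 0 := sobolevNorm_eq_zero fun x hx => h0 t ht x hx
    have h2 : sobolevNorm (k + 1) (fun x => derivWithin (fun s => g s x) (Icc 0 T) t) = 0 := by
      refine sobolevNorm_eq_zero fun x hx => ?_
      have : derivWithin (fun s => g s x) (Icc 0 T) t = derivWithin (fun _ => 0) (Icc 0 T) t :=
        derivWithin_congr (fun s hs => h0 s hs x hx) (h0 t ht x hx)
      simpa using this
    rw [dataNorm, h1, h2]
    simpa using hu.sobolevNorm_le ht
  · push Not at h0
    obtain ⟨t₀, ht₀, x₀, hx₀, hne⟩ := h0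
    obtain ⟨δ, hδ, hle⟩ := exists_source_le (k := k) hα hT hg ht₀ hx₀ hne
    obtain ⟨-, K, hK⟩ := exists_bound_source (k := k) hT hg
    have hK0 : 0 ≤ K := (add_nonneg ENNReal.toReal_nonneg ENNReal.toReal_nonneg).trans (hK t₀ ht₀)
    refine ⟨1 + K / δ, by positivity, fun u hu t ht => ?_⟩
    have h1 := hle u hu
    have h2 : K ≤ K / δ * (sobolevSupNorm (k + 3) T u).toReal := by
      rw [div_mul_eq_mul_div, le_div_iff₀ hδ]
      exact mul_le_mul_of_nonneg_left h1 hK0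
    rw [dataNorm, add_assoc, add_mul, one_mul]
    exact add_le_add (hu.sobolevNorm_le ht) ((hK t ht).trans h2)

end SpectralVolume

/-! ### The theorem -/

theorem theorem5p1 (k : ℕ) (hk : 1 ≤ k) (α : ℝ → ℝ)
    (hα : ContDiffOn ℝ ∞ α (Icc 0 (2 * Real.pi))) (hper : α 0 = α (2 * Real.pi)) (κ : ℝ) :
    -- existence, uniqueness and differentiability in time of the correction function; zero flux
    (∀ (T : ℝ) (_ : 0 < T) (g u : ℝ → ℝ → ℝ)
      (_ : ContDiffOn ℝ ∞ (fun p : ℝ × ℝ => g p.1 p.2) (Icc 0 T ×ˢ Icc 0 (2 * Real.pi)))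
      (_ : SpectralVolume.IsSolution (k + 3) α T g u)
      (m : SpectralVolume.Scheme) (N : ℕ) [NeZero N] (G : SpectralVolume.Grid k N)
      (_ : G.ShapeRegular κ) (_ : m.Uses α G),
      (∀ t ∈ Icc 0 T, ∃! W : Fin N → ℝ[X], SpectralVolume.IsCorrection α G T u t W) ∧
      ∀ w : ℝ → Fin N → ℝ[X],
        (∀ t ∈ Icc 0 T, SpectralVolume.IsCorrection α G T u t (w t)) →
        ∀ t ∈ Icc 0 T, ∀ i,
          (∀ x, DifferentiableWithinAt ℝ (fun s => (w s i).eval x) (Icc 0 T) t) ∧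
          α (G.right i) * SpectralVolume.upwind α G (SpectralVolume.toFun (w t)) i = 0 ∧
          ((α (G.right i) = 0 → α (G.right (i + 1)) ≤ 0) →
            SpectralVolume.upwind α G (SpectralVolume.toFun (w t)) i = 0)) ∧
    -- estimates by the solution and the source at the time considered
    (∃ c : ℝ, 0 < c ∧ ∀ (T : ℝ) (_ : 0 < T) (g u : ℝ → ℝ → ℝ)
      (_ : ContDiffOn ℝ ∞ (fun p : ℝ × ℝ => g p.1 p.2) (Icc 0 T ×ˢ Icc 0 (2 * Real.pi)))
      (_ : SpectralVolume.IsSolution (k + 3) α T g u)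
      (m : SpectralVolume.Scheme) (N : ℕ) [NeZero N] (G : SpectralVolume.Grid k N)
      (_ : G.ShapeRegular κ) (_ : m.Uses α G) (w : ℝ → Fin N → ℝ[X])
      (_ : ∀ t ∈ Icc 0 T, SpectralVolume.IsCorrection α G T u t (w t)),
      ∀ t ∈ Icc 0 T, SpectralVolume.CorrectionEstimates m α G T u w t
        (c * G.meshSize ^ (k + 2) *
          ((SpectralVolume.sobolevNorm (k + 3) (u t)).toReal +
            (SpectralVolume.sobolevNorm (k + 2) (g t)).toReal +
            (SpectralVolume.sobolevNorm (k + 1)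
              (fun x => derivWithin (fun s => g s x) (Icc 0 T) t)).toReal))) ∧
    -- estimates by the solution alone, for a fixed source
    (∀ (T : ℝ) (_ : 0 < T) (g : ℝ → ℝ → ℝ)
      (_ : ContDiffOn ℝ ∞ (fun p : ℝ × ℝ => g p.1 p.2) (Icc 0 T ×ˢ Icc 0 (2 * Real.pi))),
      ∃ c : ℝ, 0 < c ∧ ∀ (u : ℝ → ℝ → ℝ)
      (_ : SpectralVolume.IsSolution (k + 3) α T g u)
      (m : SpectralVolume.Scheme) (N : ℕ) [NeZero N] (G : SpectralVolume.Grid k N)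
      (_ : G.ShapeRegular κ) (_ : m.Uses α G) (w : ℝ → Fin N → ℝ[X])
      (_ : ∀ t ∈ Icc 0 T, SpectralVolume.IsCorrection α G T u t (w t)),
      ∀ t ∈ Icc 0 T, SpectralVolume.CorrectionEstimates m α G T u w t
        (c * G.meshSize ^ (k + 2) * (SpectralVolume.sobolevSupNorm (k + 3) T u).toReal)) := by
  have hcont := hα.continuousOn
  obtain ⟨c₀, hc₀, hest⟩ := SpectralVolume.exists_correctionEstimates hk hα hper
  refine ⟨?_, ⟨c₀, hc₀, ?_⟩, ?_⟩
  · intro T hT g u hg hu m N _ G _ hm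
    refine ⟨fun t _ => SpectralVolume.existsUnique_isCorrection hk hcont G T u t, ?_⟩
    intro w hw t ht i
    obtain ⟨C, hC, hreg⟩ := SpectralVolume.exists_time_derivatives (k := k) hα
    obtain ⟨p, p', hd, hL, M, hM⟩ := hreg T hT g u hg hu
    obtain ⟨-, W', -, hWd, -⟩ := SpectralVolume.correction_time_derivative hk hcont (G := G) hT hd
      (fun s hs => (hL s hs).2.1.continuousOn)
      (fun s hs => (hL s hs).2.2.mono (mul_le_mul_of_nonneg_left (hM s hs) hC.le)) hw ht i
    exact ⟨fun x => (hWd x).differentiableWithinAt, (hw t ht).mul_upwind_eq_zero hper i,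
      (hw t ht).upwind_eq_zero hper i⟩
  · intro T hT g u hg hu m N _ G _ hm w hw t ht
    exact hest T hT g u hg hu m N G hm w hw t ht
  · intro T hT g hg
    obtain ⟨c₁, hc₁, hdata⟩ := SpectralVolume.exists_dataNorm_le (k := k) hα hT hg
    refine ⟨c₀ * c₁, mul_pos hc₀ hc₁, ?_⟩
    intro u hu m N _ G _ hm w hw t ht
    refine (hest T hT g u hg hu m N G hm w hw t ht).mono ?_
    have hh := G.meshSize_pos
    calc c₀ * G.meshSize ^ (k + 2) * SpectralVolume.dataNorm k T g u t
        ≤ c₀ * G.meshSize ^ (k + 2) * (c₁ * (SpectralVolume.sobolevSupNorm (k + 3) T u).toReal) :=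
          mul_le_mul_of_nonneg_left (hdata u hu t ht) (by positivity)
      _ = _ := by ring
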